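/- Let $k\in\{1,2,4,8\}$, $n_k=3k+2\in\{5,8,14,26\}$, and let $e_0=1,e_1,\dots,e_7$ be the basis of the octonions $\mathbb O$ with $e_\mu^2=-1$, $e_\mu e_\nu=-e_\nu e_\mu$ for $\mu\ne\nu$ in $\{1,\dots,7\}$, and $e_\mu e_{\mu+1}=e_{\mu+3}$ together with its cyclic permutations (indices modulo $7$). For $\vec X=(x^1,\dots,x^{n_k})\in\mathbb R^{n_k}$ put $x^I=0$ for $I>n_k$, $$X^1=x^1+x^6e_1+x^9e_2+x^{10}e_4+x^{15}e_3+x^{16}e_5+x^{17}e_6+x^{18}e_7,$$ $$X^2=x^2+x^7e_1+x^{11}e_2+x^{12}e_4+x^{19}e_3+x^{20}e_5+x^{21}e_6+x^{22}e_7,$$ $$X^3=x^3+x^8e_1+x^{13}e_2+x^{14}e_4+x^{23}e_3+x^{24}e_5+x^{25}e_6+x^{26}e_7,$$ $$A=\begin{pmatrix}x^5-\sqrt3x^4&\sqrt3X^3&\sqrt3X^2\\ \sqrt3\,\overline{X^3}&x^5+\sqrt3x^4&\sqrt3X^1\\ \sqrt3\,\overline{X^2}&\sqrt3\,\overline{X^1}&-2x^5\end{pmatrix},$$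 a generic traceless Hermitian matrix over $\mathbb R,\mathbb C,\mathbb H,\mathbb O$ for $k=1,2,4,8$. For Hermitian $A=(a_{ij})$ let $D=a_{11}a_{22}a_{33}-a_{12}a_{21}a_{33}-a_{13}a_{22}a_{31}-a_{11}a_{23}a_{32}$ and $${\det}_1A=D+a_{13}(a_{32}a_{21})+(a_{12}a_{23})a_{31},\qquad {\det}_2A=D+a_{31}(a_{23}a_{12})+(a_{21}a_{32})a_{13}.$$ Let $\Upsilon_a(\vec X,\vec X,\vec X)=\tfrac12{\det}_aA$ and $\Upsilon^a_{IJK}=\tfrac16\,\partial^3\Upsilon_a/\partial x^I\partial x^J\partial x^K$, for $a=1,2$ and $I,J,K=1,\dots,n_k$. Let $g_{IJ}=\delta_{IJ}$. Then, for each $k\in\{1,2,4,8\}$ and $a\in\{1,2\}$: * $A$ is Hermitian and traceless, and ${\det}_aA$ is real and equal to $2\sum_{I,J,K}\Upsilon^a_{IJK}x^Ix^Jx^K$. * i) $\Upsilon^a_{IJK}=\Upsilon^a_{(IJK)}$; ii) $\sum_J\Upsilon^a_{IJJ}=0$; iii) $\sum_I\big(\Upsilon^a_{JKI}\Upsilon^a_{LMI}+\Upsilon^a_{LJI}\Upsilon^a_{KMI}+\Upsilon^a_{KLI}\Upsilon^a_{JMI}\big)=g_{JK}g_{LM}+g_{LJ}g_{KM}+g_{KL}g_{JM}$.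 * The stabilizer of $\Upsilon^a$ in $GL(n_k,\mathbb R)$ is contained in $O(n_k)$. Its intersection $H_k$ with $SO(n_k)$ is the irreducible $SO(3)$, $SU(3)$, $Sp(3)$, $F_4$ for $k=1,2,4,8$ respectively; that is, $H_k$ is the image of this compact group under a continuous irreducible representation on $\mathbb R^{n_k}$, which is faithful for $SO(3)$ and $F_4$ and has the centre of the group as its kernel for $SU(3)$ and $Sp(3)$. Here $F_4$ is the automorphism group of the Jordan algebra of Hermitian octonionic $3\times3$ matrices with product $\tfrac12(AB+BA)$. For $k=1,4,8$ the stabilizer of $\Upsilon^a$ in $GL(n_k,\mathbb R)$ is $H_k$ itself; for $k=2$ it is $H_2\cup\sigma H_2$ with $\sigma=\mathrm{diag}(1,1,1,1,1,-1,-1,-1)$. * If $k=1,2$, then $\Upsilon^1_{IJK}=\Upsilon^2_{IJK}$. If $k=4,8$, then $\Upsilon^1$ and $\Upsilon^2$ belong to the same $O(n_k)$ orbit and are related by the element $\mathrm{diag}(1,1,1,1,1,-1,\dots,-1)$ of $O(n_k)$, but they are not equivalent under $SO(n_k)$. -/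

import Mathlib

open scoped Quaternion

noncomputable section

/-- The real octonions, in the basis `e₀ = 1, e₁, …, e₇`: the first component is the coefficient
of `e₀`, the entry `i : Fin 7` of the second one is the coefficient of `e_{i+1}`. -/
def Octonion : Type := ℝ × (Fin 7 → ℝ)

namespace Octonion

instance : AddCommGroup Octonion := inferInstanceAs (AddCommGroup (ℝ × (Fin 7 → ℝ)))
instance : Module ℝ Octonion := inferInstanceAs (Module ℝ (ℝ × (Fin 7 → ℝ)))
instance : TopologicalSpace Octonion := inferInstanceAs (TopologicalSpace (ℝ × (Fin 7 → ℝ)))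

/-- The octonion with real part `r` and imaginary coefficients `v`. -/
def mk (r : ℝ) (v : Fin 7 → ℝ) : Octonion := (r, v)

/-- The coefficient of `e₀`. -/
def re (a : Octonion) : ℝ := a.1

/-- The coefficients of `e₁, …, e₇`. -/
def im (a : Octonion) : Fin 7 → ℝ := a.2

/-- The real number `r`, as the octonion `r e₀`. -/
def ofReal (r : ℝ) : Octonion := mk r 0

@[ext] theorem ext {a b : Octonion} (h : a.re = b.re) (h' : ∀ i, a.im i = b.im i) : a = b :=
  Prod.ext h (funext h')

/-- The product determined by: `e₀` is the unit, `e_μ² = -1`, `e_μ e_ν = - e_ν e_μ` for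
`μ ≠ ν`, and `e_μ e_{μ+1} = e_{μ+3}` together with the cyclic permutations of this relation,
all indices `1, …, 7` being read modulo `7`. -/
instance : Mul Octonion where
  mul a b := mk (a.re * b.re - ∑ i, a.im i * b.im i) fun i =>
    a.re * b.im i + b.re * a.im i
      + (a.im (i - 3) * b.im (i - 2) - a.im (i - 2) * b.im (i - 3))
      + (a.im (i + 1) * b.im (i + 3) - a.im (i + 3) * b.im (i + 1))
      + (a.im (i + 2) * b.im (i - 1) - a.im (i - 1) * b.im (i + 2))

/-- Octonionic conjugation. -/
instance : Star Octonion where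
  star a := mk a.re (-a.im)

@[simp] theorem re_mk (r : ℝ) (v : Fin 7 → ℝ) : (mk r v).re = r := rfl
@[simp] theorem im_mk (r : ℝ) (v : Fin 7 → ℝ) : (mk r v).im = v := rfl
@[simp] theorem re_ofReal (r : ℝ) : (ofReal r).re = r := rfl
@[simp] theorem im_ofReal (r : ℝ) (i : Fin 7) : (ofReal r).im i = 0 := rfl
@[simp] theorem re_sub (a b : Octonion) : (a - b).re = a.re - b.re := rfl
@[simp] theorem im_sub (a b : Octonion) (i : Fin 7) : (a - b).im i = a.im i - b.im i := rfl
@[simp] theorem re_add (a b : Octonion) : (a + b).re = a.re + b.re := rfl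
@[simp] theorem im_add (a b : Octonion) (i : Fin 7) : (a + b).im i = a.im i + b.im i := rfl
@[simp] theorem re_zero : (0 : Octonion).re = 0 := rfl
@[simp] theorem im_zero (i : Fin 7) : (0 : Octonion).im i = 0 := rfl
@[simp] theorem re_smul (c : ℝ) (a : Octonion) : (c • a).re = c * a.re := rfl
@[simp] theorem im_smul (c : ℝ) (a : Octonion) (i : Fin 7) : (c • a).im i = c * a.im i := rfl
@[simp] theorem re_star (a : Octonion) : (star a).re = a.re := rfl
@[simp] theorem im_star (a : Octonion) (i : Fin 7) : (star a).im i = -a.im i := rfl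
@[simp] theorem re_mul (a b : Octonion) : (a * b).re = a.re * b.re - ∑ i, a.im i * b.im i := rfl
@[simp] theorem im_mul (a b : Octonion) (i : Fin 7) : (a * b).im i =
    a.re * b.im i + b.re * a.im i
      + (a.im (i - 3) * b.im (i - 2) - a.im (i - 2) * b.im (i - 3))
      + (a.im (i + 1) * b.im (i + 3) - a.im (i + 3) * b.im (i + 1))
      + (a.im (i + 2) * b.im (i - 1) - a.im (i - 1) * b.im (i + 2)) := rfl

instance : NonUnitalNonAssocRing Octonion where
  left_distrib a b c := by
    ext i
    · simp only [re_mul, re_add, im_add, mul_add, Finset.sum_add_distrib]; ring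
    · simp only [im_mul, re_add, im_add]; ring
  right_distrib a b c := by
    ext i
    · simp only [re_mul, re_add, im_add, add_mul, Finset.sum_add_distrib]; ring
    · simp only [im_mul, re_add, im_add]; ring
  zero_mul a := by ext i <;> simp
  mul_zero a := by ext i <;> simp

instance : StarRing Octonion where
  star_involutive a := by ext i <;> simp
  star_mul a b := by
    ext i
    · simp only [re_star, re_mul, im_star, neg_mul_neg, mul_comm]
    · simp only [im_star, im_mul, re_star]; ring
  star_add a b := by
    ext i
    · simp
    · simp only [im_star, im_add]; ring

instance : StarModule ℝ Octonion where
  star_smul c a := by ext i <;> simp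

end Octonion

/-! ### The two determinants and the two cubic forms -/

/-- The two readings of the determinant of a `3 × 3` Hermitian octonionic matrix, `det₁` for
`a = 0` and `det₂` for `a = 1`; they differ in the order of the factors of the last two terms. -/
def octDet (a : Fin 2) (A : Matrix (Fin 3) (Fin 3) Octonion) : Octonion :=
  A 0 0 * A 1 1 * A 2 2 - A 0 1 * A 1 0 * A 2 2 - A 0 2 * A 1 1 * A 2 0 - A 0 0 * A 1 2 * A 2 1
    + if a = 0 then A 0 2 * (A 2 1 * A 1 0) + (A 0 1 * A 1 2) * A 2 0
      else A 2 0 * (A 1 2 * A 0 1) + (A 1 0 * A 2 1) * A 0 2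

/-- The coordinate `x^I` (`I = 1, 2, …`) of `x = (x^1, …, x^n)`, and `0` when `I > n`. -/
def coord {n : ℕ} (x : Fin n → ℝ) (I : ℕ) : ℝ :=
  if h : 1 ≤ I ∧ I ≤ n then x ⟨I - 1, by omega⟩ else 0

/-- The octonion `X¹`; it is real, complex, quaternionic when `n = 5, 8, 14`. The entries of the
vector are the coefficients of `e₁, e₂, e₃, e₄, e₅, e₆, e₇`, in this order. -/
def octX1 {n : ℕ} (x : Fin n → ℝ) : Octonion :=
  .mk (coord x 1) ![coord x 6, coord x 9, coord x 15, coord x 10,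
    coord x 16, coord x 17, coord x 18]

/-- The octonion `X²`. -/
def octX2 {n : ℕ} (x : Fin n → ℝ) : Octonion :=
  .mk (coord x 2) ![coord x 7, coord x 11, coord x 19, coord x 12,
    coord x 20, coord x 21, coord x 22]

/-- The octonion `X³`. -/
def octX3 {n : ℕ} (x : Fin n → ℝ) : Octonion :=
  .mk (coord x 3) ![coord x 8, coord x 13, coord x 23, coord x 14,
    coord x 24, coord x 25, coord x 26]

/-- The generic traceless Hermitian matrix `A`, over `ℝ, ℂ, ℍ, 𝕆` when `n = 5, 8, 14, 26`. -/
def hermMatrix {n : ℕ} (x : Fin n → ℝ) : Matrix (Fin 3) (Fin 3) Octonion :=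
  !![.ofReal (coord x 5 - √3 * coord x 4), √3 • octX3 x, √3 • octX2 x;
     √3 • star (octX3 x), .ofReal (coord x 5 + √3 * coord x 4), √3 • octX1 x;
     √3 • star (octX2 x), √3 • star (octX1 x), .ofReal (-2 * coord x 5)]

/-- The cubic form `Υ_a(X, X, X) = ½ det_a A` on `ℝ^n` (the determinant is real-valued). -/
def cubicForm (a : Fin 2) (n : ℕ) (x : Fin n → ℝ) : ℝ :=
  (1 / 2) * (octDet a (hermMatrix x)).re

/-- The tensor `Υ^a_{IJK} = (1/6) ∂³Υ_a / ∂x^I ∂x^J ∂x^K` on `ℝ^{n_k}`, `n_k = 3k + 2` (the third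
derivative of a cubic form is constant; it is taken at the origin). -/
def upsilon (a : Fin 2) (k : ℕ) (I J K : Fin (3 * k + 2)) : ℝ :=
  (1 / 6) * iteratedFDeriv ℝ 3 (cubicForm a (3 * k + 2)) 0
    ![Pi.single I 1, Pi.single J 1, Pi.single K 1]

/-! ### The action on 3-tensors, orthogonal groups, stabilizers -/

/-- The transform of a 3-tensor by a matrix: `(T h)(u, v, w) = T (h u, h v, h w)`. -/
def transform {n : ℕ} (T : Fin n → Fin n → Fin n → ℝ) (h : Matrix (Fin n) (Fin n) ℝ) :
    Fin n → Fin n → Fin n → ℝ :=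
  fun I J K => ∑ P, ∑ Q, ∑ R, h P I * h Q J * h R K * T P Q R

theorem transform_one {n : ℕ} (T : Fin n → Fin n → Fin n → ℝ) : transform T 1 = T := by
  funext I J K
  simp [transform, Matrix.one_apply]

theorem transform_mul {n : ℕ} (T : Fin n → Fin n → Fin n → ℝ) (g h : Matrix (Fin n) (Fin n) ℝ) :
    transform T (g * h) = transform (transform T g) h := by
  funext I J K
  have e (f : Fin n → Fin n → Fin n → ℝ) :
      ∑ P, ∑ Q, ∑ R, f P Q R = ∑ p : Fin n × Fin n × Fin n, f p.1 p.2.1 p.2.2 := by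
    simp only [Fintype.sum_prod_type]
  have e' (u v w : Fin n → ℝ) : (∑ A, u A) * (∑ B, v B) * (∑ C, w C)
      = ∑ p : Fin n × Fin n × Fin n, u p.1 * v p.2.1 * w p.2.2 := by
    simp only [Fintype.sum_prod_type, ← Finset.mul_sum, ← Finset.sum_mul]
  simp only [transform, Matrix.mul_apply, e]
  simp only [e']
  simp only [Finset.sum_mul, Finset.mul_sum]
  rw [Finset.sum_comm]
  refine Finset.sum_congr rfl fun _ _ => Finset.sum_congr rfl fun _ _ => ?_
  ring

/-- The stabilizer of a 3-tensor in the general linear group. -/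
def tensorStabilizer {n : ℕ} (T : Fin n → Fin n → Fin n → ℝ) : Subgroup (GL (Fin n) ℝ) where
  carrier := {h | transform T (h : Matrix (Fin n) (Fin n) ℝ) = T}
  one_mem' := transform_one T
  mul_mem' {g h} hg hh := by
    simp only [Set.mem_ofPred_eq] at *
    rw [Units.val_mul, transform_mul, hg, hh]
  inv_mem' {h} hh := by
    simp only [Set.mem_ofPred_eq] at *
    calc _ = transform (transform T h) (h⁻¹ : GL (Fin n) ℝ) := by rw [hh]
      _ = T := by rw [← transform_mul, Units.mul_inv, transform_one]

/-- `O(n)`, as a subgroup of `GL(n, ℝ)`. -/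
def orthogonalSubgroup (n : ℕ) : Subgroup (GL (Fin n) ℝ) where
  carrier := {h | (h : Matrix (Fin n) (Fin n) ℝ) ∈ Matrix.orthogonalGroup (Fin n) ℝ}
  one_mem' := one_mem (Matrix.orthogonalGroup (Fin n) ℝ)
  mul_mem' hg hh := (Matrix.orthogonalGroup (Fin n) ℝ).mul_mem hg hh
  inv_mem' {h} hh := by
    have h1 : h * star h = 1 := Units.ext (Matrix.mem_unitaryGroup_iff.1 hh)
    have h2 : h⁻¹ = star h := inv_eq_of_mul_eq_one_right h1
    rw [h2]
    exact Unitary.star_mem hh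

/-- `SO(n)`, as a subgroup of `GL(n, ℝ)`. -/
def specialOrthogonalSubgroup (n : ℕ) : Subgroup (GL (Fin n) ℝ) :=
  orthogonalSubgroup n ⊓ Matrix.GeneralLinearGroup.det.ker

/-- The matrix `diag(1, 1, 1, 1, 1, -1, …, -1)` as an element of `GL(n, ℝ)`. -/
def reflection (n : ℕ) : GL (Fin n) ℝ :=
  have h : Matrix.diagonal (fun i : Fin n => if (i : ℕ) < 5 then (1 : ℝ) else -1)
      * Matrix.diagonal (fun i : Fin n => if (i : ℕ) < 5 then (1 : ℝ) else -1) = 1 := by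
    rw [Matrix.diagonal_mul_diagonal, ← Matrix.diagonal_one]
    congr 1
    funext i
    split_ifs <;> norm_num
  ⟨_, _, h, h⟩

/-! ### The groups `SO(3)`, `SU(3)`, `Sp(3)`, `F₄` and their irreducible images -/

/-- `SO(3)`. -/
abbrev SO3 : Type := Matrix.specialOrthogonalGroup (Fin 3) ℝ

/-- `SU(3)`. -/
abbrev SU3 : Type := Matrix.specialUnitaryGroup (Fin 3) ℂ

/-- The compact group `Sp(3)` of unitary quaternionic `3 × 3` matrices. -/
abbrev Sp3 : Type := unitary (Matrix (Fin 3) (Fin 3) ℍ[ℝ])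

/-- The space of Hermitian octonionic `3 × 3` matrices. -/
abbrev Albert : Type := selfAdjoint.submodule ℝ (Matrix (Fin 3) (Fin 3) Octonion)

/-- The Jordan product `½ (AB + BA)`, which makes `Albert` the exceptional Jordan algebra. -/
def Albert.jordan (A B : Albert) : Albert :=
  ⟨(1 / 2 : ℝ) • ((A : Matrix (Fin 3) (Fin 3) Octonion) * B + B * A), by
    have hA : star (A : Matrix (Fin 3) (Fin 3) Octonion) = A := A.2
    have hB : star (B : Matrix (Fin 3) (Fin 3) Octonion) = B := B.2
    change star _ = _
    rw [star_smul, star_add, star_mul, star_mul, hA, hB, star_trivial, add_comm]⟩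

/-- The compact exceptional group `F₄`, that is, the automorphism group of the exceptional Jordan
algebra of Hermitian octonionic `3 × 3` matrices. -/
def F4 : Subgroup (Albert ≃ₗ[ℝ] Albert) where
  carrier := {φ | ∀ A B, φ (A.jordan B) = (φ A).jordan (φ B)}
  one_mem' _ _ := rfl
  mul_mem' {φ ψ} hφ hψ A B := by
    simp only [Set.mem_ofPred_eq] at hφ hψ
    rw [LinearEquiv.mul_apply, hψ, hφ]; rfl
  inv_mem' {φ} hφ A B := by
    simp only [Set.mem_ofPred_eq] at hφ
    apply φ.injective
    rw [hφ]
    simp only [← LinearEquiv.mul_apply, mul_inv_cancel]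
    rfl

/-- The topology of pointwise convergence, which is the usual topology of a linear group. -/
instance : TopologicalSpace F4 :=
  TopologicalSpace.induced (fun (φ : F4) (A : Albert) => (φ : Albert ≃ₗ[ℝ] Albert) A) inferInstance

/-- A homomorphism into `GL(n, ℝ)`, as a representation on `ℝ^n`. -/
def toRep {G : Type} [Group G] {n : ℕ} (ρ : G →* GL (Fin n) ℝ) :
    Representation ℝ G (Fin n → ℝ) :=
  (Matrix.toLinAlgEquiv' : Matrix (Fin n) (Fin n) ℝ ≃ₐ[ℝ] _).toMulEquiv.toMonoidHom.comp
    ((Units.coeHom _).comp ρ)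

/-- `H` is the image of the group `G` under a continuous irreducible representation on `ℝ^n` with
kernel `Z`. -/
def IsIrreducibleImage (G : Type) [Group G] [TopologicalSpace G] (Z : Subgroup G) {n : ℕ}
    (H : Subgroup (GL (Fin n) ℝ)) : Prop :=
  ∃ ρ : G →* GL (Fin n) ℝ,
    Continuous ρ ∧ (toRep ρ).IsIrreducible ∧ ρ.ker = Z ∧ ρ.range = H

end

/-!
The theorem is proved uniformly for a positive definite composition algebra `K` over `ℝ` (`CompAlg`),
with `ℝ`, `ℂ`, `ℍ` and the octonions as instances. The space `TH K` of traceless Hermitian `3 × 3`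
matrices over `K` carries an inner product `inn`, a commutative product `prd` (the traceless part of
the Jordan product) and the cubic form `cub = ½ det`, with `cub v = inn (prd v v) v`. The form
`inn (prd u v) w` is symmetric, and `|v * v|² = |v|⁴` (`inn_prd_self`); polarized, this is the
identity iii). A linear isometry `e` from `ℝⁿ` onto `TH K` that turns `cub` into the cubic form of
the theorem (`IsModel`) identifies the tensor `Υ` with `inn (prd u v) w`, and its stabilizer with
the group `aut K` of linear automorphisms of `cub` (`IsModel.mem_stabilizer_iff`).

A linear map that preserves `cub` is an isometry: since `|v * v| = |v|²`, the operator norms of the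
map and of its inverse bound each other in a way that makes both at most `1`
(`norm_eq_of_preserves_square`). Hence the stabilizer lies in `O(n)`, and it consists of the
automorphisms of the product `prd`.

Explicit automorphisms generate a subgroup `elem K` of `aut K`: conjugations by plane rotations, by
a cyclic permutation and, in the associative case, by `diag(u, 1, ū)`; for octonions the last ones
are replaced by the corresponding triality maps. This group acts irreducibly
(`eq_top_of_invariant`), so an invariant linear form vanishes; applied to `v ↦ trace (prd v)` this
gives ii). Diagonalization shows that, up to `elem K`, every automorphism fixes the diagonal matrices,
and then that it is an algebra automorphism of `K` applied to the matrix entries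
(`exists_normalForm`).

It remains to know the automorphisms of `K`. For `ℝ` there is only the identity; for `ℂ` there is also
the conjugation, of determinant `-1`; for `ℍ` all of them are inner. So `aut K` is the image of
`SO(3)` or `Sp(3)` under conjugation, and for `ℂ` the automorphisms of determinant `1` are the image
of `SU(3)`. For octonions `F₄` itself is identified with `aut K`: an automorphism of the Jordan
algebra preserves the trace, because the trace of the operator of multiplication by a traceless
matrix is again an invariant linear form (`F4.map_tr`).

Automorphisms of `K` have determinant `1` for `K ≠ ℂ`. For octonions this follows from a volume form
that is expressed by the algebra: the alternatization of the real part of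
`v̄₀ (v₁ (v̄₂ (v₃ (v̄₄ (v₅ (v̄₆ v₇))))))` (`det_eq_one_of_octupleProduct`). Consequently the stabilizers
lie in `SO(n)` for `k ≠ 2`. The second determinant of a matrix is the first one of its conjugate, so
the reflection exchanges the two tensors; for `k = 4, 8` it has determinant `-1`, while any two
transformations that do so differ by an element of the stabilizer, of determinant `1`.
-/

set_option linter.unusedSectionVars false

noncomputable section

/-! ### Real composition algebras -/

/-- A positive definite real composition algebra, not necessarily associative, described by its
conjugation and by the linear form `re`; the quadratic norm is `re (star x * x)`.  By Hurwitz'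
theorem these are `ℝ`, `ℂ`, `ℍ` and the octonions. -/
class CompAlg (K : Type) [NonAssocRing K] [Module ℝ K] [IsScalarTower ℝ K K]
    [SMulCommClass ℝ K K] [StarRing K] where
  /-- The real part. -/
  re : K →ₗ[ℝ] ℝ
  re_one : re 1 = 1
  star_eq (x : K) : star x = (2 * re x) • (1 : K) - x
  re_mul_comm (x y : K) : re (x * y) = re (y * x)
  re_mul_assoc (x y z : K) : re ((x * y) * z) = re (x * (y * z))
  star_mul_mul (x y : K) : star x * (x * y) = re (star x * x) • y
  re_pos (x : K) : x ≠ 0 → 0 < re (star x * x)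

namespace CompAlg

section basic

variable {K : Type} [NonAssocRing K] [Module ℝ K] [IsScalarTower ℝ K K]
    [SMulCommClass ℝ K K] [StarRing K] [CompAlg K]

/-- The inner product of a real composition algebra. -/
def ip : K →ₗ[ℝ] K →ₗ[ℝ] ℝ :=
  LinearMap.mk₂ ℝ (fun x y => re (star x * y))
    (fun x x' y => by rw [star_add, add_mul, map_add])
    (fun c x y => by
      have : star (c • x) = c • star x := by
        rw [star_eq, star_eq, map_smul, smul_sub, smul_smul, smul_eq_mul]; congr 2; ring
      rw [this, smul_mul_assoc, map_smul])
    (fun x y y' => by rw [mul_add, map_add])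
    (fun c x y => by rw [mul_smul_comm, map_smul])

/-- The square of the norm. -/
def nsq (x : K) : ℝ := ip x x

theorem ip_def (x y : K) : ip x y = re (star x * y) := rfl

theorem star_rsmul (c : ℝ) (x : K) : star (c • x) = c • star x := by
  rw [star_eq, star_eq, map_smul, smul_sub, smul_smul, smul_eq_mul]; congr 2; ring

@[simp] theorem re_star (x : K) : re (star x) = re x := by
  rw [star_eq, map_sub, map_smul, re_one]; simp; ring

theorem ip_comm (x y : K) : ip x y = ip y x := by
  rw [ip_def, ip_def, ← re_star, star_mul, star_star]

theorem ip_eq (x y : K) : ip x y = 2 * re x * re y - re (x * y) := by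
  rw [ip_def, star_eq, sub_mul, smul_mul_assoc, one_mul, map_sub, map_smul, smul_eq_mul]

@[simp] theorem ip_one_left (x : K) : ip 1 x = re x := by rw [ip_def, star_one, one_mul]
@[simp] theorem ip_one_right (x : K) : ip x 1 = re x := by rw [ip_comm, ip_one_left]
@[simp] theorem nsq_one : nsq (1 : K) = 1 := by rw [nsq, ip_one_left, re_one]

theorem ip_star_star (x y : K) : ip (star x) (star y) = ip x y := by
  rw [ip_eq, ip_eq, re_star, re_star, ← star_mul, re_star, re_mul_comm]

@[simp] theorem nsq_star (x : K) : nsq (star x) = nsq x := ip_star_star x x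

theorem nsq_smul (c : ℝ) (x : K) : nsq (c • x) = c ^ 2 * nsq x := by
  simp only [nsq, map_smul, LinearMap.smul_apply, smul_eq_mul]; ring

theorem nsq_add (x y : K) : nsq (x + y) = nsq x + nsq y + 2 * ip x y := by
  simp only [nsq, map_add, LinearMap.add_apply, ip_comm y x]; ring

@[simp] theorem nsq_neg (x : K) : nsq (-x) = nsq x := by simp [nsq]
@[simp] theorem nsq_zero : nsq (0 : K) = 0 := by simp [nsq]

theorem nsq_nonneg (x : K) : 0 ≤ nsq x := by
  rcases eq_or_ne x 0 with rfl | h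
  · simp
  · exact (re_pos x h).le

theorem nsq_eq_zero {x : K} : nsq x = 0 ↔ x = 0 :=
  ⟨fun h => by_contra fun h' => (re_pos x h').ne' h, fun h => by simp [h]⟩

theorem eq_of_ip {x y : K} (h : ∀ z, ip x z = ip y z) : x = y := by
  rw [← sub_eq_zero, ← nsq_eq_zero, nsq, map_sub ip, LinearMap.sub_apply, h, sub_self]

theorem star_mul_cancel (x y : K) : star x * (x * y) = nsq x • y := star_mul_mul x y

theorem mul_star_cancel (x y : K) : x * (star x * y) = nsq x • y := by
  simpa using star_mul_cancel (star x) y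

theorem mul_cancel_star (x y : K) : y * x * star x = nsq x • y := by
  have := congrArg star (mul_star_cancel x (star y))
  simpa [star_mul, star_rsmul] using this

theorem mul_star_mul_cancel (x y : K) : y * star x * x = nsq x • y := by
  simpa using mul_cancel_star (star x) y

theorem star_mul_self_eq (x : K) : star x * x = nsq x • (1 : K) := by
  simpa using star_mul_cancel x 1

theorem mul_star_self_eq (x : K) : x * star x = nsq x • (1 : K) := by
  simpa using mul_star_cancel x 1

theorem ip_mul_left (x y z : K) : ip (x * y) z = ip y (star x * z) := by
  rw [ip_def, ip_def, star_mul, re_mul_assoc]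

/-- The quadratic norm is multiplicative. -/
theorem nsq_mul (x y : K) : nsq (x * y) = nsq x * nsq y := by
  rw [nsq, ip_mul_left, star_mul_cancel, map_smul, smul_eq_mul]; rfl

theorem star_mul_mul_add (x z y : K) :
    star x * (z * y) + star z * (x * y) = (2 * ip x z) • y := by
  have h := star_mul_cancel (x + z) y
  rw [star_add, nsq_add] at h
  simp only [add_mul, mul_add, star_mul_cancel, add_smul] at h
  rw [← add_right_inj (nsq x • y + nsq z • y), ← h]; abel

theorem ip_mul_exchange (x y z w : K) :
    ip (x * y) (z * w) + ip (x * w) (z * y) = 2 * ip x z * ip y w := by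
  rw [ip_comm (x * w), ip_mul_left, ip_mul_left, ← map_add, star_mul_mul_add, map_smul,
    smul_eq_mul]

/-- The middle Moufang identity; it makes `(L_u, R_u, L_u R_u)` a triality triple. -/
theorem moufang (u x y : K) : (u * x) * (y * u) = u * ((x * y) * u) := by
  refine eq_of_ip fun z => ?_
  have h1 := ip_mul_exchange y u (star x * star u) z
  have h2 := ip_mul_exchange (x * y) u (star u) z
  rw [mul_star_mul_cancel, map_smul, smul_eq_mul] at h1
  rw [star_mul_self_eq, map_smul, smul_eq_mul] at h2
  rw [ip_mul_left (u * x), star_mul, ip_mul_left u]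
  have h3 : ip y (star x * star u) = ip (x * y) (star u) := by rw [ip_mul_left]
  have h4 : ip (y * z) (star x) = ip (x * y * z) 1 := by
    rw [ip_one_right, re_mul_assoc, ip_comm, ip_def, star_star]
  rw [h3, h4] at h1
  linarith

theorem mul_mul_self (u x : K) : u * x * u = u * (x * u) := by
  simpa using moufang u x 1

theorem re_mul_rotate (x y z : K) : re (x * y * z) = re (y * z * x) := by
  rw [re_mul_assoc, re_mul_comm]

/-- Every unit vector has a cube root, inside the plane that it spans with `1`. -/
theorem exists_cube_root (u : K) (hu : nsq u = 1) : ∃ w : K, nsq w = 1 ∧ w * (w * w) = u := by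
  set v : K := u - re u • (1 : K) with hv
  have hrv : re v = 0 := by simp [hv, re_one]
  have hnv : nsq u = re u ^ 2 + nsq v := by
    have : u = re u • (1 : K) + v := by rw [hv]; abel
    rw [this, nsq_add, nsq_smul, nsq_one]
    simp [hrv, re_one]
  rcases eq_or_ne v 0 with h0 | h0
  · have hu1 : u = re u • (1 : K) := by rw [← sub_eq_zero]; exact h0
    have : re u ^ 2 = 1 := by rw [h0, nsq_zero] at hnv; linarith
    refine ⟨u, hu, ?_⟩
    rw [hu1]
    simp only [smul_mul_assoc, mul_smul_comm, one_mul, smul_smul]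
    congr 1
    linear_combination re u * this
  · set r := √(nsq v)
    have hr2 : r ^ 2 = nsq v := Real.sq_sqrt (nsq_nonneg v)
    have hr : r ≠ 0 := by
      intro h; rw [h] at hr2; exact h0 (nsq_eq_zero.1 (by rw [← hr2]; norm_num))
    set j : K := r⁻¹ • v
    have hrj : re j = 0 := by simp [j, hrv]
    have hnj : nsq j = 1 := by
      rw [nsq_smul, ← hr2, ← mul_pow, inv_mul_cancel₀ hr, one_pow]
    have hjj : j * j = -1 := by
      have := star_mul_self_eq j
      rw [star_eq, hrj, hnj] at this
      simp at this
      rw [← this, neg_neg]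
    have huj : u = re u • (1 : K) + r • j := by
      rw [smul_smul, mul_inv_cancel₀ hr, one_smul, hv]; abel
    obtain ⟨z, hz⟩ := IsAlgClosed.exists_pow_nat_eq (⟨re u, r⟩ : ℂ) (n := 3) (by norm_num)
    have hz1 : z.re ^ 3 - 3 * z.re * z.im ^ 2 = re u := by
      have := congrArg Complex.re hz
      simp only [pow_succ, pow_zero, one_mul, Complex.mul_re, Complex.mul_im] at this
      linarith
    have hz2 : 3 * z.re ^ 2 * z.im - z.im ^ 3 = r := by
      have := congrArg Complex.im hz
      simp only [pow_succ, pow_zero, one_mul, Complex.mul_re, Complex.mul_im] at this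
      linarith
    have hz3 : z.re ^ 2 + z.im ^ 2 = 1 := by
      have h : (z.re ^ 2 + z.im ^ 2) ^ 3 = 1 := by
        have : re u ^ 2 + r ^ 2 = 1 := by rw [hr2, ← hnv, hu]
        rw [← this, ← hz1, ← hz2]; ring
      exact (pow_eq_one_iff_of_nonneg (by positivity) (by norm_num)).1 h
    refine ⟨z.re • (1 : K) + z.im • j, ?_, ?_⟩
    · rw [nsq_add, nsq_smul, nsq_smul, hnj, nsq_one]
      simp [hrj]
      linarith
    · rw [huj, ← hz1, ← hz2]
      simp only [mul_add, add_mul, smul_mul_assoc, mul_smul_comm, one_mul, mul_one, hjj,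
        smul_neg, mul_neg]
      module

theorem exists_normalize {x : K} (hx : x ≠ 0) : ∃ u : K, nsq u = 1 ∧ x = √(nsq x) • u := by
  have h0 : √(nsq x) ≠ 0 := by
    rw [Real.sqrt_ne_zero (nsq_nonneg x)]; exact fun h => hx (nsq_eq_zero.1 h)
  refine ⟨(√(nsq x))⁻¹ • x, ?_, ?_⟩
  · rw [nsq_smul, inv_pow, Real.sq_sqrt (nsq_nonneg x), inv_mul_cancel₀]
    exact fun h => hx (nsq_eq_zero.1 h)
  · rw [smul_smul, mul_inv_cancel₀ h0, one_smul]

end basic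
end CompAlg

/-! ### The space of traceless Hermitian matrices -/

/-- The traceless Hermitian `3 × 3` matrices over `K`.  The vector `(p, q, Y₁, Y₂, Y₃)` stands for
the matrix with diagonal `p - √3 q, p + √3 q, -2p` and with `a₂₃ = √3 Y₁`, `a₃₁ = √3 Y₂`,
`a₁₂ = √3 Y₃`; with this choice of `Y₂` the cyclic symmetry of the indices is visible. -/
abbrev TH (K : Type) : Type := ℝ × ℝ × K × K × K

namespace TH

open CompAlg

theorem ext5 {K : Type} {v w : TH K} (h1 : v.1 = w.1) (h2 : v.2.1 = w.2.1) (h3 : v.2.2.1 = w.2.2.1)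
    (h4 : v.2.2.2.1 = w.2.2.2.1) (h5 : v.2.2.2.2 = w.2.2.2.2) : v = w :=
  Prod.ext h1 (Prod.ext h2 (Prod.ext h3 (Prod.ext h4 h5)))

variable {K : Type} [NonAssocRing K] [Module ℝ K] [IsScalarTower ℝ K K]
    [SMulCommClass ℝ K K] [StarRing K] [CompAlg K]

/-- The inner product on traceless Hermitian matrices, `tr (A B) / 6`. -/
def inn : TH K →ₗ[ℝ] TH K →ₗ[ℝ] ℝ :=
  LinearMap.mk₂ ℝ (fun v w => v.1 * w.1 + v.2.1 * w.2.1 + ip v.2.2.1 w.2.2.1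
      + ip v.2.2.2.1 w.2.2.2.1 + ip v.2.2.2.2 w.2.2.2.2)
    (fun v v' w => by simp; ring) (fun c v w => by simp; ring)
    (fun v w w' => by simp; ring) (fun c v w => by simp; ring)

theorem inn_def (v w : TH K) : inn v w = v.1 * w.1 + v.2.1 * w.2.1 + ip v.2.2.1 w.2.2.1
      + ip v.2.2.2.1 w.2.2.2.1 + ip v.2.2.2.2 w.2.2.2.2 := rfl

/-- The commutative product on traceless Hermitian matrices: the traceless part of
`½ (A B + B A)`. -/
def prd : TH K →ₗ[ℝ] TH K →ₗ[ℝ] TH K :=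
  LinearMap.mk₂ ℝ (fun v w =>
    (-(v.1 * w.1) + v.2.1 * w.2.1 - (1 / 2) * ip v.2.2.1 w.2.2.1
        - (1 / 2) * ip v.2.2.2.1 w.2.2.2.1 + ip v.2.2.2.2 w.2.2.2.2,
      v.1 * w.2.1 + v.2.1 * w.1 + (√3 / 2) * (ip v.2.2.1 w.2.2.1 - ip v.2.2.2.1 w.2.2.2.1),
      ((√3 * v.2.1 - v.1) / 2) • w.2.2.1 + ((√3 * w.2.1 - w.1) / 2) • v.2.2.1
        + (√3 / 2) • star (v.2.2.2.1 * w.2.2.2.2 + w.2.2.2.1 * v.2.2.2.2),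
      ((-(√3 * v.2.1) - v.1) / 2) • w.2.2.2.1 + ((-(√3 * w.2.1) - w.1) / 2) • v.2.2.2.1
        + (√3 / 2) • star (v.2.2.2.2 * w.2.2.1 + w.2.2.2.2 * v.2.2.1),
      v.1 • w.2.2.2.2 + w.1 • v.2.2.2.2
        + (√3 / 2) • star (v.2.2.1 * w.2.2.2.1 + w.2.2.1 * v.2.2.2.1)))
    (fun v v' w => by
      refine ext5 ?_ ?_ ?_ ?_ ?_ <;>
        simp only [Prod.fst_add, Prod.snd_add, map_add, LinearMap.add_apply, star_add, add_mul,
          mul_add] <;> first | ring1 | module)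
    (fun c v w => by
      refine ext5 ?_ ?_ ?_ ?_ ?_ <;>
        simp only [Prod.smul_fst, Prod.smul_snd, map_smul, LinearMap.smul_apply, smul_mul_assoc,
          mul_smul_comm, star_add, star_rsmul, smul_eq_mul] <;> first | ring1 | module)
    (fun v w w' => by
      refine ext5 ?_ ?_ ?_ ?_ ?_ <;>
        simp only [Prod.fst_add, Prod.snd_add, map_add, star_add, add_mul,
          mul_add] <;> first | ring1 | module)
    (fun c v w => by
      refine ext5 ?_ ?_ ?_ ?_ ?_ <;>
        simp only [Prod.smul_fst, Prod.smul_snd, map_smul, smul_mul_assoc,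
          mul_smul_comm, star_add, star_rsmul, smul_eq_mul] <;> first | ring1 | module)

theorem prd_def (v w : TH K) : prd v w =
    (-(v.1 * w.1) + v.2.1 * w.2.1 - (1 / 2) * ip v.2.2.1 w.2.2.1
        - (1 / 2) * ip v.2.2.2.1 w.2.2.2.1 + ip v.2.2.2.2 w.2.2.2.2,
      v.1 * w.2.1 + v.2.1 * w.1 + (√3 / 2) * (ip v.2.2.1 w.2.2.1 - ip v.2.2.2.1 w.2.2.2.1),
      ((√3 * v.2.1 - v.1) / 2) • w.2.2.1 + ((√3 * w.2.1 - w.1) / 2) • v.2.2.1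
        + (√3 / 2) • star (v.2.2.2.1 * w.2.2.2.2 + w.2.2.2.1 * v.2.2.2.2),
      ((-(√3 * v.2.1) - v.1) / 2) • w.2.2.2.1 + ((-(√3 * w.2.1) - w.1) / 2) • v.2.2.2.1
        + (√3 / 2) • star (v.2.2.2.2 * w.2.2.1 + w.2.2.2.2 * v.2.2.1),
      v.1 • w.2.2.2.2 + w.1 • v.2.2.2.2
        + (√3 / 2) • star (v.2.2.1 * w.2.2.2.1 + w.2.2.1 * v.2.2.2.1)) := rfl

/-- The cubic form `½ det`, in coordinates. -/
def cub (v : TH K) : ℝ :=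
  -v.1 ^ 3 + 3 * v.1 * v.2.1 ^ 2 + 3 * v.1 * nsq v.2.2.2.2
    - (3 / 2) * (v.1 + √3 * v.2.1) * nsq v.2.2.2.1
    - (3 / 2) * (v.1 - √3 * v.2.1) * nsq v.2.2.1
    + 3 * √3 * re (v.2.2.1 * v.2.2.2.1 * v.2.2.2.2)

theorem inn_comm (v w : TH K) : inn v w = inn w v := by
  simp only [inn_def, ip_comm w.2.2.1, ip_comm w.2.2.2.1, ip_comm w.2.2.2.2]; ring

theorem prd_comm (v w : TH K) : prd v w = prd w v := by
  refine ext5 ?_ ?_ ?_ ?_ ?_ <;>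
    simp only [prd_def, ip_comm w.2.2.1, ip_comm w.2.2.2.1, ip_comm w.2.2.2.2, star_add] <;>
    first | ring1 | module

theorem ip_star_eq (x y : K) : ip (star x) y = re (x * y) := by rw [ip_def, star_star]

theorem inn_prd_right_comm (u v w : TH K) : inn (prd u v) w = inn (prd u w) v := by
  obtain ⟨p, q, x, y, z⟩ := u
  obtain ⟨p', q', x', y', z'⟩ := v
  obtain ⟨p'', q'', x'', y'', z''⟩ := w
  simp only [inn_def, prd_def, map_add, LinearMap.add_apply, map_smul, LinearMap.smul_apply,
    smul_eq_mul, ip_star_eq, star_add, ip_comm x'' x', ip_comm y'' y', ip_comm z'' z']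
  linear_combination (√3 / 2) * (re_mul_rotate y' z x'' - re_mul_rotate z'' x y'
    + re_mul_rotate x' y z'' + re_mul_rotate z' x y'' - re_mul_rotate y'' z x'
    - re_mul_rotate x'' y z')

theorem cub_eq (v : TH K) : cub v = inn (prd v v) v := by
  obtain ⟨p, q, x, y, z⟩ := v
  simp only [cub, inn_def, prd_def, map_add, LinearMap.add_apply, map_smul, LinearMap.smul_apply,
    smul_eq_mul, ip_star_eq, star_add, nsq]
  rw [re_mul_rotate z x y, ← re_mul_rotate x y z]
  ring_nf

theorem inn_prd_self (v : TH K) : inn (prd v v) (prd v v) = inn v v ^ 2 := by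
  obtain ⟨p, q, x, y, z⟩ := v
  have h3 : √3 ^ 2 = 3 := Real.sq_sqrt (by norm_num)
  have e1 : ip (star (y * z)) x = re (x * y * z) := by rw [ip_star_eq, ← re_mul_rotate x y z]
  have e2 : ip (star (z * x)) y = re (x * y * z) := by rw [ip_star_eq, re_mul_rotate z x y]
  have e3 : ip (star (x * y)) z = re (x * y * z) := by rw [ip_star_eq]
  have f (a b : K) : ip (a * b) (a * b) = ip a a * ip b b := nsq_mul a b
  simp only [inn_def, prd_def, map_add, LinearMap.add_apply, map_smul, LinearMap.smul_apply,
    smul_eq_mul, ip_star_star, star_add, e1, e2, e3, ip_comm x (star _), ip_comm y (star _),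
    ip_comm z (star _), f]
  linear_combination (q ^ 2 * (ip x x + ip y y) + ip x x * ip y y / 2 + ip x x * ip z z
    + ip x x ^ 2 / 4 + ip y y * ip z z + ip y y ^ 2 / 4) * h3
  
end TH

/-! ### Automorphisms of the cubic form -/

/-- A linear automorphism `φ` that preserves the form `⟪x * x, w⟫`, where `|x * x| = |x|²`, is an
isometry.  As `|φ x|² = |φ x * φ x|` is at most `‖φ⁻¹‖ |x|²`, one has `‖φ‖² ≤ ‖φ⁻¹‖`; likewise
`‖φ⁻¹‖² ≤ ‖φ‖`, and both operator norms are at most `1`. -/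
theorem norm_eq_of_preserves_square {E : Type*} [NormedAddCommGroup E] [InnerProductSpace ℝ E]
    [FiniteDimensional ℝ E] (m : E → E) (hm : ∀ x, ‖m x‖ = ‖x‖ ^ 2) (φ : E ≃ₗ[ℝ] E)
    (hφ : ∀ x w, inner ℝ (m (φ x)) (φ w) = inner ℝ (m x) w) (v : E) : ‖φ v‖ = ‖v‖ := by
  have key (φ : E ≃ₗ[ℝ] E) (hφ : ∀ x w, inner ℝ (m (φ x)) (φ w) = inner ℝ (m x) w) :
      ‖LinearMap.toContinuousLinearMap (φ : E →ₗ[ℝ] E)‖ ^ 2 ≤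
        ‖LinearMap.toContinuousLinearMap (φ.symm : E →ₗ[ℝ] E)‖ := by
    set F := LinearMap.toContinuousLinearMap (φ : E →ₗ[ℝ] E)
    set G := LinearMap.toContinuousLinearMap (φ.symm : E →ₗ[ℝ] E)
    have h1 (x : E) : ‖φ x‖ ^ 2 ≤ ‖G‖ * ‖x‖ ^ 2 := by
      rw [← hm]
      set w := m (φ x) with hw
      have h2 : φ (G w) = w := φ.apply_symm_apply w
      have h3 : ‖w‖ * ‖w‖ ≤ (‖G‖ * ‖x‖ ^ 2) * ‖w‖ := by
        calc ‖w‖ * ‖w‖ = inner ℝ (m (φ x)) (φ (G w)) := by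
              rw [h2, ← hw, real_inner_self_eq_norm_mul_norm]
          _ = inner ℝ (m x) (G w) := hφ _ _
          _ ≤ ‖m x‖ * ‖G w‖ := real_inner_le_norm _ _
          _ ≤ ‖x‖ ^ 2 * (‖G‖ * ‖w‖) := by
            rw [hm]; gcongr; exact G.le_opNorm w
          _ = _ := by ring
      rcases (norm_nonneg w).eq_or_lt with h0 | h0
      · rw [← h0]; positivity
      · exact le_of_mul_le_mul_right h3 h0
    have h4 : ‖F‖ ≤ √‖G‖ := by
      refine F.opNorm_le_bound (Real.sqrt_nonneg _) fun x => ?_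
      refine (pow_le_pow_iff_left₀ (norm_nonneg _) (by positivity) two_ne_zero).1 ?_
      rw [mul_pow, Real.sq_sqrt (norm_nonneg _)]
      exact h1 x
    calc ‖F‖ ^ 2 ≤ √‖G‖ ^ 2 := by gcongr
      _ = ‖G‖ := Real.sq_sqrt (norm_nonneg _)
  have hs (x w : E) : inner ℝ (m (φ.symm x)) (φ.symm w) = inner ℝ (m x) w := by
    simpa using (hφ (φ.symm x) (φ.symm w)).symm
  have h1 := key φ hφ
  have h2 := key φ.symm hs
  rw [φ.symm_symm] at h2
  set F := LinearMap.toContinuousLinearMap (φ : E →ₗ[ℝ] E)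
  set G := LinearMap.toContinuousLinearMap (φ.symm : E →ₗ[ℝ] E)
  have hF0 := norm_nonneg F
  have hG0 := norm_nonneg G
  have hF : ‖F‖ ≤ 1 := by
    by_contra! h
    have h3 : ‖F‖ < ‖G‖ := by nlinarith
    nlinarith
  have hG : ‖G‖ ≤ 1 := by nlinarith
  refine le_antisymm ?_ ?_
  · exact (F.le_of_opNorm_le hF v).trans (one_mul _).le
  · have := G.le_of_opNorm_le hG (φ v)
    rw [show G (φ v) = v from φ.symm_apply_apply v] at this
    simpa using this

namespace TH

open CompAlg

section aut

variable {K : Type} [NonAssocRing K] [Module ℝ K] [IsScalarTower ℝ K K]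
    [SMulCommClass ℝ K K] [StarRing K] [CompAlg K]

theorem inn_self_nonneg (v : TH K) : 0 ≤ inn v v := by
  have h1 : 0 ≤ ip v.2.2.1 v.2.2.1 := nsq_nonneg _
  have h2 : 0 ≤ ip v.2.2.2.1 v.2.2.2.1 := nsq_nonneg _
  have h3 : 0 ≤ ip v.2.2.2.2 v.2.2.2.2 := nsq_nonneg _
  rw [inn_def]
  nlinarith [mul_self_nonneg v.1, mul_self_nonneg v.2.1]

theorem inn_self_eq_zero {v : TH K} (h : inn v v = 0) : v = 0 := by
  have h1 : 0 ≤ nsq v.2.2.1 := nsq_nonneg _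
  have h2 : 0 ≤ nsq v.2.2.2.1 := nsq_nonneg _
  have h3 : 0 ≤ nsq v.2.2.2.2 := nsq_nonneg _
  have e : inn v v = v.1 ^ 2 + v.2.1 ^ 2 + nsq v.2.2.1 + nsq v.2.2.2.1 + nsq v.2.2.2.2 := by
    rw [inn_def, nsq, nsq, nsq]; ring
  rw [e] at h
  refine ext5 ?_ ?_ (nsq_eq_zero.1 ?_) (nsq_eq_zero.1 ?_) (nsq_eq_zero.1 ?_)
  · exact pow_eq_zero_iff two_ne_zero |>.1 (by nlinarith [sq_nonneg v.1, sq_nonneg v.2.1])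
  · exact pow_eq_zero_iff two_ne_zero |>.1 (by nlinarith [sq_nonneg v.1, sq_nonneg v.2.1])
  all_goals nlinarith [sq_nonneg v.1, sq_nonneg v.2.1]

theorem eq_of_inn {v w : TH K} (h : ∀ z, inn v z = inn w z) : v = w := by
  rw [← sub_eq_zero]
  apply inn_self_eq_zero
  rw [map_sub inn, LinearMap.sub_apply, h, sub_self]

theorem inn_prd_left_comm (u v w : TH K) : inn (prd u v) w = inn (prd v w) u := by
  rw [prd_comm u v, inn_prd_right_comm]

/-- Polarization of the cubic form. -/
theorem cub_polar (u v w : TH K) : 6 * inn (prd u v) w = cub (u + v + w) - cub (u + v)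
    - cub (u + w) - cub (v + w) + cub u + cub v + cub w := by
  simp only [cub_eq, map_add, LinearMap.add_apply, prd_comm v u, prd_comm w u, prd_comm w v,
    inn_prd_right_comm u w v, inn_prd_left_comm v w u]
  have e1 := inn_prd_right_comm u v w
  have e2 := inn_prd_left_comm v w u
  have e3 := inn_prd_right_comm v u w
  have f1 := inn_prd_right_comm u u v
  have f2 := inn_prd_right_comm u u w
  have f3 := inn_prd_right_comm v v w
  have f4 := inn_prd_right_comm v v u
  have f5 := inn_prd_right_comm w w u
  have f6 := inn_prd_right_comm w w v
  rw [prd_comm v u] at *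
  rw [prd_comm w u] at *
  rw [prd_comm w v] at *
  linarith

/-- The identity `|v * v| = |v|²`, polarized. -/
theorem inn_prd_polar (x y z w : TH K) :
    inn (prd x y) (prd z w) + inn (prd z x) (prd y w) + inn (prd y z) (prd x w)
      = inn x y * inn z w + inn z x * inn y w + inn y z * inn x w := by
  -- The quartic identity is polarized one pair of variables at a time.
  have two (x z : TH K) : inn (prd x x) (prd z z) + 2 * inn (prd x z) (prd x z)
      = inn x x * inn z z + 2 * inn x z ^ 2 := by
    have h1 := inn_prd_self (x + z)
    have h2 := inn_prd_self (x - z)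
    have h3 := inn_prd_self x
    have h4 := inn_prd_self z
    simp only [map_add, LinearMap.add_apply, map_sub, LinearMap.sub_apply, prd_comm z x,
      inn_comm z x, inn_comm (prd x z) (prd x x), inn_comm (prd x z) (prd z z),
      inn_comm (prd z z) (prd x x)] at h1 h2
    linarith
  have three (x y z : TH K) : inn (prd x y) (prd z z) + 2 * inn (prd x z) (prd y z)
      = inn x y * inn z z + 2 * inn x z * inn y z := by
    have h1 := two (x + y) z
    have h2 := two x z
    have h3 := two y z
    simp only [map_add, LinearMap.add_apply, prd_comm y x, inn_comm y x,
      inn_comm (prd y z) (prd x z)] at h1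
    linarith
  have h1 := three x y (z + w)
  have h2 := three x y z
  have h3 := three x y w
  simp only [map_add, LinearMap.add_apply, prd_comm w z, inn_comm w z] at h1
  rw [prd_comm z x, inn_comm z x, inn_comm (prd y z)]
  linarith

variable (K) in
/-- The linear automorphisms of the space of traceless Hermitian matrices that preserve the
cubic form `½ det`. -/
def aut : Subgroup (TH K ≃ₗ[ℝ] TH K) where
  carrier := {φ | ∀ v, cub (φ v) = cub v}
  one_mem' _ := rfl
  mul_mem' {φ ψ} hφ hψ v := by
    simp only [Set.mem_ofPred_eq] at hφ hψ
    rw [LinearEquiv.mul_apply, hφ, hψ]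
  inv_mem' {φ} hφ v := by
    simp only [Set.mem_ofPred_eq] at hφ
    rw [← hφ, ← LinearEquiv.mul_apply, mul_inv_cancel]; rfl

theorem mem_aut {φ : TH K ≃ₗ[ℝ] TH K} : φ ∈ aut K ↔ ∀ v, cub (φ v) = cub v := Iff.rfl

theorem aut_trilinear {φ : TH K ≃ₗ[ℝ] TH K} (hφ : φ ∈ aut K) (u v w : TH K) :
    inn (prd (φ u) (φ v)) (φ w) = inn (prd u v) w := by
  have h1 := cub_polar u v w
  have h2 := cub_polar (φ u) (φ v) (φ w)
  simp only [← map_add, mem_aut.1 hφ] at h2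
  linarith

variable (K) in
/-- The Euclidean structure of the space of traceless Hermitian matrices. -/
@[reducible] def innerCore : InnerProductSpace.Core ℝ (TH K) where
  inner v w := inn v w
  conj_inner_symm v w := by simpa using inn_comm w v
  re_inner_nonneg v := by simpa using inn_self_nonneg v
  add_left u v w := by simp
  smul_left u v c := by simp
  definite v h := inn_self_eq_zero h

/-- Linear maps preserving the cubic form are isometries. -/
theorem aut_inn_self [FiniteDimensional ℝ K] {φ : TH K ≃ₗ[ℝ] TH K} (hφ : φ ∈ aut K)
    (v : TH K) : inn (φ v) (φ v) = inn v v := by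
  let I : NormedAddCommGroup (TH K) := (innerCore K).toNormedAddCommGroup
  let J : InnerProductSpace ℝ (TH K) := InnerProductSpace.ofCore (innerCore K).toCore
  have hn (x : TH K) : inn x x = ‖x‖ ^ 2 := (real_inner_self_eq_norm_sq x)
  have hm (x : TH K) : ‖prd x x‖ = ‖x‖ ^ 2 := by
    have := inn_prd_self x
    rw [hn, hn] at this
    exact (pow_left_inj₀ (norm_nonneg _) (by positivity) two_ne_zero).1 this
  have := norm_eq_of_preserves_square (fun x : TH K => prd x x) hm φ
    (fun x w => aut_trilinear hφ x x w) v
  rw [hn, hn, this]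

theorem mem_aut_of {φ : TH K ≃ₗ[ℝ] TH K} (h1 : ∀ v, φ (prd v v) = prd (φ v) (φ v))
    (h2 : ∀ v, inn (φ v) (φ v) = inn v v) : φ ∈ aut K := by
  have h3 (v w : TH K) : inn (φ v) (φ w) = inn v w := by
    have h := h2 (v + w)
    simp only [map_add, LinearMap.add_apply, h2, inn_comm w v, inn_comm (φ w) (φ v)] at h
    linarith
  intro v
  rw [cub_eq, cub_eq, ← h1, h3]

variable [FiniteDimensional ℝ K]

theorem aut_inn {φ : TH K ≃ₗ[ℝ] TH K} (hφ : φ ∈ aut K)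
    (v w : TH K) : inn (φ v) (φ w) = inn v w := by
  have h := aut_inn_self hφ (v + w)
  simp only [map_add, LinearMap.add_apply, aut_inn_self hφ, inn_comm w v,
    inn_comm (φ w) (φ v)] at h
  linarith

theorem aut_prd {φ : TH K ≃ₗ[ℝ] TH K} (hφ : φ ∈ aut K)
    (v w : TH K) : φ (prd v w) = prd (φ v) (φ w) := by
  refine eq_of_inn fun z => ?_
  obtain ⟨z, rfl⟩ := φ.surjective z
  rw [aut_inn hφ, aut_trilinear hφ]

end aut

/-! ### The elementary automorphisms -/

section generators

variable {K : Type} [NonAssocRing K] [Module ℝ K] [IsScalarTower ℝ K K]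
    [SMulCommClass ℝ K K] [StarRing K] [CompAlg K]

/-- The automorphism attached to a unit vector `u`; for associative `K` it is conjugation by the
diagonal matrix with entries `u, 1, star u`. -/
def torus (u : K) (hu : nsq u = 1) : TH K ≃ₗ[ℝ] TH K where
  toFun v := (v.1, v.2.1, v.2.2.1 * u, star u * (v.2.2.2.1 * star u), u * v.2.2.2.2)
  invFun v := (v.1, v.2.1, v.2.2.1 * star u, u * (v.2.2.2.1 * u), star u * v.2.2.2.2)
  map_add' v w := by
    refine ext5 rfl rfl ?_ ?_ ?_ <;> simp only [Prod.fst_add, Prod.snd_add, add_mul, mul_add]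
  map_smul' r v := by
    refine ext5 rfl rfl ?_ ?_ ?_ <;>
      simp only [Prod.smul_fst, Prod.smul_snd, smul_mul_assoc, mul_smul_comm, RingHom.id_apply]
  left_inv v := by
    refine ext5 rfl rfl ?_ ?_ ?_ <;> dsimp only
    · rw [mul_cancel_star, hu, one_smul]
    · rw [← mul_mul_self, mul_star_cancel, hu, one_smul, mul_star_mul_cancel, hu, one_smul]
    · rw [star_mul_cancel, hu, one_smul]
  right_inv v := by
    refine ext5 rfl rfl ?_ ?_ ?_ <;> dsimp only
    · rw [mul_star_mul_cancel, hu, one_smul]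
    · rw [← mul_mul_self, star_mul_cancel, hu, one_smul, mul_cancel_star, hu, one_smul]
    · rw [mul_star_cancel, hu, one_smul]

/-- Conjugation by the rotation matrix with entries `c, -s, s, c` in the first two coordinates. -/
def rot (c s : ℝ) (h : c ^ 2 + s ^ 2 = 1) : TH K ≃ₗ[ℝ] TH K where
  toFun v := (v.1, (c ^ 2 - s ^ 2) * v.2.1 + 2 * c * s * re v.2.2.2.2,
    c • v.2.2.1 + s • star v.2.2.2.1, c • v.2.2.2.1 - s • star v.2.2.1,
    v.2.2.2.2 - (2 * s ^ 2 * re v.2.2.2.2 + 2 * c * s * v.2.1) • (1 : K))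
  invFun v := (v.1, (c ^ 2 - s ^ 2) * v.2.1 - 2 * c * s * re v.2.2.2.2,
    c • v.2.2.1 - s • star v.2.2.2.1, c • v.2.2.2.1 + s • star v.2.2.1,
    v.2.2.2.2 - (2 * s ^ 2 * re v.2.2.2.2 - 2 * c * s * v.2.1) • (1 : K))
  map_add' v w := by
    refine ext5 rfl ?_ ?_ ?_ ?_ <;> simp only [Prod.fst_add, Prod.snd_add, map_add, star_add] <;>
      first | ring1 | module
  map_smul' r v := by
    refine ext5 rfl ?_ ?_ ?_ ?_ <;>
      simp only [Prod.smul_fst, Prod.smul_snd, map_smul, star_rsmul, RingHom.id_apply,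
        smul_eq_mul] <;>
      first | ring1 | module
  left_inv v := by
    refine ext5 rfl ?_ ?_ ?_ ?_ <;>
      simp only [map_sub, map_smul, re_one, star_add, star_sub, star_rsmul, star_star, smul_eq_mul]
    · linear_combination (v.2.1 * (c ^ 2 + s ^ 2 + 1) + 2 * c * s * re v.2.2.2.2) * h
    · match_scalars <;> first | ring1 | linear_combination h
    · match_scalars <;> first | ring1 | linear_combination h
    · match_scalars
      · ring
      · linear_combination (4 * s ^ 2 * re v.2.2.2.2 + 2 * c * s * v.2.1) * h
  right_inv v := by
    refine ext5 rfl ?_ ?_ ?_ ?_ <;>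
      simp only [map_sub, map_smul, re_one, star_add, star_sub, star_rsmul, star_star, smul_eq_mul]
    · linear_combination (v.2.1 * (c ^ 2 + s ^ 2 + 1) - 2 * c * s * re v.2.2.2.2) * h
    · match_scalars <;> first | ring1 | linear_combination h
    · match_scalars <;> first | ring1 | linear_combination h
    · match_scalars
      · ring
      · linear_combination (4 * s ^ 2 * re v.2.2.2.2 - 2 * c * s * v.2.1) * h

variable (K) in
/-- Conjugation by the permutation matrix of the cycle `1 ↦ 2 ↦ 3 ↦ 1`. -/
def cyc : TH K ≃ₗ[ℝ] TH K where
  toFun v := (-(v.1 + √3 * v.2.1) / 2, (√3 * v.1 - v.2.1) / 2, v.2.2.2.2, v.2.2.1, v.2.2.2.1)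
  invFun v := (-(v.1 - √3 * v.2.1) / 2, -(√3 * v.1 + v.2.1) / 2, v.2.2.2.1, v.2.2.2.2, v.2.2.1)
  map_add' v w := by
    refine ext5 ?_ ?_ rfl rfl rfl <;> simp only [Prod.fst_add, Prod.snd_add] <;> ring
  map_smul' r v := by
    refine ext5 ?_ ?_ rfl rfl rfl <;>
      simp only [Prod.smul_fst, Prod.smul_snd, RingHom.id_apply, smul_eq_mul] <;> ring
  left_inv v := by
    have h3 : √3 ^ 2 = 3 := Real.sq_sqrt (by norm_num)
    refine ext5 ?_ ?_ rfl rfl rfl <;> dsimp only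
    · linear_combination v.1 / 4 * h3
    · linear_combination v.2.1 / 4 * h3
  right_inv v := by
    have h3 : √3 ^ 2 = 3 := Real.sq_sqrt (by norm_num)
    refine ext5 ?_ ?_ rfl rfl rfl <;> dsimp only
    · linear_combination v.1 / 4 * h3
    · linear_combination v.2.1 / 4 * h3

theorem torus_apply (u : K) (hu : nsq u = 1) (v : TH K) : torus u hu v =
    (v.1, v.2.1, v.2.2.1 * u, star u * (v.2.2.2.1 * star u), u * v.2.2.2.2) := rfl

theorem rot_apply (c s : ℝ) (h : c ^ 2 + s ^ 2 = 1) (v : TH K) : rot c s h v =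
    (v.1, (c ^ 2 - s ^ 2) * v.2.1 + 2 * c * s * re v.2.2.2.2,
    c • v.2.2.1 + s • star v.2.2.2.1, c • v.2.2.2.1 - s • star v.2.2.1,
    v.2.2.2.2 - (2 * s ^ 2 * re v.2.2.2.2 + 2 * c * s * v.2.1) • (1 : K)) := rfl

theorem cyc_apply (v : TH K) : cyc K v =
    (-(v.1 + √3 * v.2.1) / 2, (√3 * v.1 - v.2.1) / 2, v.2.2.2.2, v.2.2.1, v.2.2.2.1) := rfl

theorem torus_mem_aut (u : K) (hu : nsq u = 1) : torus u hu ∈ aut K := by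
  intro v
  obtain ⟨p, q, x, y, z⟩ := v
  have h : re (x * u * (star u * (y * star u)) * (u * z)) = re (x * y * z) := by
    rw [← re_mul_rotate, moufang, re_mul_rotate, re_mul_comm, ← re_mul_assoc, ← re_mul_rotate,
      re_mul_assoc, ← mul_mul_self (star u) y, ← re_mul_assoc, mul_star_mul_cancel, hu,
      one_smul, re_mul_comm, re_mul_assoc (z * x), mul_star_cancel, hu, one_smul]
    exact re_mul_rotate z x y
  simp only [cub, torus_apply, nsq_mul, nsq_star, hu, h, mul_one, one_mul]

theorem rot_mem_aut (c s : ℝ) (h : c ^ 2 + s ^ 2 = 1) : rot c s h ∈ aut K := by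
  intro v
  obtain ⟨p, q, x, y, z⟩ := v
  have e1 : nsq (c • x + s • star y) = c ^ 2 * nsq x + s ^ 2 * nsq y + 2 * c * s * re (x * y) := by
    rw [nsq_add, nsq_smul, nsq_smul, nsq_star, map_smul, map_smul, LinearMap.smul_apply,
      ip_comm, ip_star_eq, re_mul_comm, smul_eq_mul, smul_eq_mul]
    ring
  have e2 : nsq (c • y - s • star x) = c ^ 2 * nsq y + s ^ 2 * nsq x - 2 * c * s * re (x * y) := by
    rw [sub_eq_add_neg, nsq_add, nsq_neg, nsq_smul, nsq_smul, nsq_star, map_neg, map_smul,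
      map_smul, LinearMap.smul_apply, ip_comm, ip_star_eq, smul_eq_mul, smul_eq_mul]
    ring
  have e3 (a : ℝ) : nsq (z - a • (1 : K)) = nsq z + a ^ 2 - 2 * a * re z := by
    rw [sub_eq_add_neg, nsq_add, nsq_neg, nsq_smul, nsq_one, map_neg, map_smul, ip_one_right,
      smul_eq_mul]
    ring
  have e4 : (c • x + s • star y) * (c • y - s • star x) = c ^ 2 • (x * y)
      + (c * s * (nsq y - nsq x)) • (1 : K) - s ^ 2 • star (x * y) := by
    simp only [mul_sub, add_mul, smul_mul_assoc, mul_smul_comm, mul_star_self_eq,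
      star_mul_self_eq, star_mul]
    module
  have e5 : re (star (x * y) * z) = 2 * re (x * y) * re z - re (x * y * z) := ip_eq _ _
  simp only [cub, rot_apply, e1, e2, e3, e4]
  simp only [mul_sub, add_mul, sub_mul, smul_mul_assoc, mul_smul_comm, map_add, map_sub, map_smul,
    one_mul, mul_one, e5, re_one, re_star, smul_eq_mul]
  generalize re (x * y * z) = t
  generalize re (x * y) = m
  generalize re z = r
  generalize nsq x = a
  generalize nsq y = b
  generalize nsq z = n
  grind

theorem cyc_mem_aut : cyc K ∈ aut K := by
  intro v
  obtain ⟨p, q, x, y, z⟩ := v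
  have h3 : √3 ^ 2 = 3 := Real.sq_sqrt (by norm_num)
  simp only [cub, cyc_apply, re_mul_rotate z x y]
  linear_combination (√3 * q ^ 3 / 8 + 9 * p * q ^ 2 / 8 - 3 / 4 * p * nsq x
    + 3 / 4 * p * nsq z - 3 / 8 * p ^ 2 * √3 * q - 3 / 8 * p ^ 3) * h3

end generators

section reduction

variable {K : Type} [NonAssocRing K] [Module ℝ K] [IsScalarTower ℝ K K]
    [SMulCommClass ℝ K K] [StarRing K] [CompAlg K]

variable (K) in
/-- The group generated by the elementary automorphisms. -/
def elem : Subgroup (TH K ≃ₗ[ℝ] TH K) :=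
  Subgroup.closure {φ | φ = cyc K ∨ (∃ c s h, φ = rot c s h) ∨ ∃ u hu, φ = torus u hu}

theorem cyc_mem : cyc K ∈ elem K := Subgroup.subset_closure (Or.inl rfl)

theorem rot_mem (c s : ℝ) (h : c ^ 2 + s ^ 2 = 1) : (rot c s h : TH K ≃ₗ[ℝ] TH K) ∈ elem K :=
  Subgroup.subset_closure (Or.inr (Or.inl ⟨c, s, h, rfl⟩))

theorem torus_mem (u : K) (hu : nsq u = 1) : torus u hu ∈ elem K :=
  Subgroup.subset_closure (Or.inr (Or.inr ⟨u, hu, rfl⟩))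

theorem elem_le {G : Subgroup (TH K ≃ₗ[ℝ] TH K)} (h1 : cyc K ∈ G)
    (h2 : ∀ c s h, rot c s h ∈ G) (h3 : ∀ u hu, torus u hu ∈ G) : elem K ≤ G := by
  rw [elem, Subgroup.closure_le]
  rintro φ (rfl | ⟨c, s, h, rfl⟩ | ⟨u, hu, rfl⟩)
  exacts [h1, h2 c s h, h3 u hu]

theorem elem_le_aut : elem K ≤ aut K := elem_le cyc_mem_aut rot_mem_aut torus_mem_aut

/-! ### Irreducibility -/

/-- The group of elementary automorphisms acts irreducibly: sign changes split off the diagonal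
and each of the three off-diagonal entries, and the other automorphisms move these around. -/
theorem eq_top_of_invariant (W : Submodule ℝ (TH K)) (hW : ∀ φ ∈ elem K, ∀ v ∈ W, φ v ∈ W)
    (h0 : W ≠ ⊥) : W = ⊤ := by
  have hcyc {v : TH K} (hv : v ∈ W) := hW _ cyc_mem v hv
  have hr2 : (√2 / 2) ^ 2 + (√2 / 2) ^ 2 = 1 := by
    rw [div_pow, Real.sq_sqrt (by norm_num)]; norm_num
  have hrot (p q : ℝ) (z : K) (hv : ((p, q, 0, 0, z) : TH K) ∈ W) :
      ((p, re z, 0, 0, z - (re z + q) • (1 : K)) : TH K) ∈ W := by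
    have := hW _ (rot_mem _ _ hr2) _ hv
    rw [rot_apply] at this
    convert this using 1
    refine ext5 rfl ?_ (by simp) (by simp) ?_ <;> dsimp only
    · linear_combination -re z * hr2
    · congr 2; linear_combination -(re z + q) * hr2
  -- the sign change of the first and third off-diagonal entries
  have hA {v : TH K} (hv : v ∈ W) : ((v.1, v.2.1, 0, v.2.2.2.1, 0) : TH K) ∈ W ∧
      ((0, 0, v.2.2.1, 0, v.2.2.2.2) : TH K) ∈ W := by
    have hs := hW _ (torus_mem (-1 : K) (by simp)) v hv
    rw [torus_apply] at hs
    constructor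
    · convert W.smul_mem (1 / 2) (W.add_mem hv hs) using 1
      refine ext5 ?_ ?_ ?_ ?_ ?_ <;> simp
      · ring
      · ring
      · module
    · convert W.smul_mem (1 / 2) (W.sub_mem hv hs) using 1
      refine ext5 ?_ ?_ ?_ ?_ ?_ <;> simp
      · module
      · module
  -- a nonzero off-diagonal entry generates everything
  have hC (a : K) (ha : a ≠ 0) (hv : ((0, 0, 0, 0, a) : TH K) ∈ W) : W = ⊤ := by
    obtain ⟨u, hu, hau⟩ := exists_normalize ha
    have hr : √(nsq a) ≠ 0 := fun h => ha (by rw [hau, h, zero_smul])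
    have h1 : ((0, 0, 0, 0, 1) : TH K) ∈ W := by
      have := W.smul_mem (√(nsq a))⁻¹ (hW _ (torus_mem (star u) (by rw [nsq_star, hu])) _ hv)
      rw [torus_apply] at this
      convert this using 1
      refine ext5 ?_ ?_ ?_ ?_ ?_ <;> simp
      rw [hau, mul_smul_comm, smul_smul, ← hau, inv_mul_cancel₀ hr, star_mul_self_eq, hu, one_smul,
        one_smul]
    have h3 (z : K) : ((0, 0, 0, 0, z) : TH K) ∈ W := by
      rcases eq_or_ne z 0 with rfl | hz
      · exact W.zero_mem
      · obtain ⟨u, hu, hzu⟩ := exists_normalize hz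
        have := W.smul_mem (√(nsq z)) (hW _ (torus_mem u hu) _ h1)
        rw [torus_apply] at this
        convert this using 1
        refine ext5 ?_ ?_ ?_ ?_ ?_ <;> simp
        exact hzu
    have h1' (z : K) : ((0, 0, z, 0, 0) : TH K) ∈ W := by
      simpa [cyc_apply] using hcyc (h3 z)
    have h2' (z : K) : ((0, 0, 0, z, 0) : TH K) ∈ W := by
      simpa [cyc_apply] using hcyc (h1' z)
    have hQ : ((0, 1, 0, 0, 0) : TH K) ∈ W := by
      simpa [re_one] using hrot _ _ _ h1
    have hP : ((1, 0, 0, 0, 0) : TH K) ∈ W := by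
      have h := W.smul_mem (-(2 / √3)) (W.add_mem (hcyc hQ) (W.smul_mem (1 / 2) hQ))
      rw [cyc_apply] at h
      convert h using 1
      refine ext5 ?_ ?_ ?_ ?_ ?_ <;> simp
      field_simp
      norm_num
    refine Submodule.eq_top_iff'.2 fun v => ?_
    convert W.add_mem (W.add_mem (W.smul_mem v.1 hP) (W.smul_mem v.2.1 hQ))
      (W.add_mem (W.add_mem (h1' v.2.2.1) (h2' v.2.2.2.1)) (h3 v.2.2.2.2)) using 1
    refine ext5 ?_ ?_ ?_ ?_ ?_ <;> simp
  have hD (p q : ℝ) (hv : ((p, q, 0, 0, 0) : TH K) ∈ W) (hq : q ≠ 0) : W = ⊤ := by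
    have h1 := hrot _ _ _ hv
    have h2 := (hA (hA h1).1).1
    have h3 := (hA h1).2
    refine hC _ ?_ h3
    have h11 : (1 : K) ≠ 0 := fun h => by
      have := nsq_one (K := K); rw [h, nsq_zero] at this; norm_num at this
    simp [hq, h11]
  obtain ⟨v, hv, hv0⟩ := W.exists_mem_ne_zero_of_ne_bot h0
  by_cases hY1 : v.2.2.1 = 0
  · by_cases hY2 : v.2.2.2.1 = 0
    · by_cases hY3 : v.2.2.2.2 = 0
      · have hd : ((v.1, v.2.1, 0, 0, 0) : TH K) ∈ W := by
          convert hv using 1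
          exact ext5 rfl rfl hY1.symm hY2.symm hY3.symm
        by_cases hq : v.2.1 = 0
        · have hp : v.1 ≠ 0 := fun hp => hv0 (ext5 hp hq hY1 hY2 hY3)
          have := hcyc hd
          rw [cyc_apply] at this
          refine hD _ _ this ?_
          simp [hq, hp]
        · exact hD _ _ hd hq
      · have := (hA hv).2
        rw [hY1] at this
        exact hC _ hY3 this
    · have h1 := (hA (hcyc (hA hv).1)).2
      rw [cyc_apply] at h1
      exact hC _ hY2 h1
  · have h1 := (hA (hcyc (hA hv).2)).1
    rw [cyc_apply] at h1
    have h2 := hcyc h1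
    rw [cyc_apply] at h2
    refine hC _ hY1 ?_
    simpa using h2

/-- There is no invariant linear form but `0`: its kernel is invariant, and it is not zero, because
`P = (1, 0, 0, 0, 0)` and its two images under the cyclic permutation add up to `0`. -/
theorem eq_zero_of_invariant (τ : TH K →ₗ[ℝ] ℝ) (hτ : ∀ φ ∈ elem K, ∀ v, τ (φ v) = τ v) :
    τ = 0 := by
  rw [← LinearMap.ker_eq_top]
  refine eq_top_of_invariant _ (fun φ hφ v hv => ?_) fun h => ?_
  · rw [LinearMap.mem_ker] at *
    rw [hτ φ hφ, hv]
  · have h3 : √3 ^ 2 = 3 := Real.sq_sqrt (by norm_num)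
    have hP : ((1, 0, 0, 0, 0) : TH K) ∈ LinearMap.ker τ := by
      rw [LinearMap.mem_ker]
      set P : TH K := (1, 0, 0, 0, 0) with hP
      have e1 := hτ _ cyc_mem P
      have e2 := hτ _ cyc_mem (cyc K P)
      have e3 : P + cyc K P + cyc K (cyc K P) = 0 := by
        rw [cyc_apply, cyc_apply]
        refine ext5 ?_ ?_ ?_ ?_ ?_ <;> simp [hP]
        · linear_combination -(1 / 4) * h3
        · ring
      have e4 := congrArg τ e3
      rw [map_add, map_add, map_zero] at e4
      linarith
    rw [h, Submodule.mem_bot] at hP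
    simpa using congrArg Prod.fst hP

/-- The multiplication operators of the product are traceless, since their traces form an invariant
linear form. -/
theorem trace_prd [FiniteDimensional ℝ K] (v : TH K) : LinearMap.trace ℝ _ (prd v) = 0 := by
  have h := eq_zero_of_invariant (K := K) ((LinearMap.trace ℝ (TH K)).comp prd) fun φ hφ v => by
    rw [LinearMap.comp_apply, LinearMap.comp_apply, ← LinearMap.trace_conj' (prd v) φ]
    congr 1
    refine LinearMap.ext fun w => ?_
    rw [LinearEquiv.conj_apply_apply, aut_prd (elem_le_aut hφ), φ.apply_symm_apply]
  exact LinearMap.congr_fun h v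

end reduction

/-! ### Reduction of an automorphism to an algebra automorphism -/

section reduction

variable {K : Type} [NonAssocRing K] [Module ℝ K] [IsScalarTower ℝ K K]
    [SMulCommClass ℝ K K] [StarRing K] [CompAlg K]

/-- One off-diagonal entry can be removed by an elementary automorphism: it is first made real,
and then a rotation diagonalizes the corresponding `2 × 2` block. -/
theorem exists_kill (v : TH K) : ∃ φ ∈ elem K, (φ v).2.2.2.2 = 0 ∧ (∀ w, (φ w).1 = w.1) ∧
    (∀ w, w.2.2.1 = 0 → w.2.2.2.1 = 0 → (φ w).2.2.1 = 0 ∧ (φ w).2.2.2.1 = 0) ∧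
    φ (1, 0, 0, 0, 0) = (1, 0, 0, 0, 0) := by
  obtain ⟨u, hu, r, hr⟩ : ∃ u : K, nsq u = 1 ∧ ∃ r : ℝ, u * v.2.2.2.2 = r • (1 : K) := by
    rcases eq_or_ne v.2.2.2.2 0 with h | h
    · exact ⟨1, nsq_one, 0, by simp [h]⟩
    · obtain ⟨u, hu, h'⟩ := exists_normalize h
      refine ⟨star u, by rw [nsq_star, hu], √(nsq v.2.2.2.2), ?_⟩
      rw [h', mul_smul_comm, star_mul_self_eq, hu, one_smul, ← h']
  obtain ⟨c, s, hcs, h0⟩ : ∃ c s : ℝ, c ^ 2 + s ^ 2 = 1 ∧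
      (c ^ 2 - s ^ 2) * r - 2 * c * s * v.2.1 = 0 := by
    by_cases h : v.2.1 ^ 2 + r ^ 2 = 0
    · have h1 : v.2.1 = 0 := by nlinarith [sq_nonneg v.2.1, sq_nonneg r]
      have h2 : r = 0 := by nlinarith [sq_nonneg v.2.1, sq_nonneg r]
      exact ⟨1, 0, by norm_num, by simp [h1, h2]⟩
    · set ρ := √(v.2.1 ^ 2 + r ^ 2) with hρ
      have hρ2 : ρ ^ 2 = v.2.1 ^ 2 + r ^ 2 := Real.sq_sqrt (by positivity)
      have hρ0 : ρ ≠ 0 := fun h' => h (by rw [← hρ2, h']; norm_num)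
      -- A rotation by an angle turns `q + i r` by twice that angle, hence the square root.
      obtain ⟨z, hz⟩ := IsAlgClosed.exists_pow_nat_eq (⟨v.2.1 / ρ, r / ρ⟩ : ℂ) (n := 2)
        (by norm_num)
      have h1 : z.re ^ 2 - z.im ^ 2 = v.2.1 / ρ := by
        have := congrArg Complex.re hz
        simp only [pow_succ, pow_zero, one_mul, Complex.mul_re] at this
        linarith
      have h2 : 2 * z.re * z.im = r / ρ := by
        have := congrArg Complex.im hz
        simp only [pow_succ, pow_zero, one_mul, Complex.mul_im] at this
        linarith
      refine ⟨z.re, z.im, ?_, ?_⟩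
      · refine (pow_eq_one_iff_of_nonneg (by positivity) two_ne_zero).1 ?_
        have : (z.re ^ 2 + z.im ^ 2) ^ 2 = (z.re ^ 2 - z.im ^ 2) ^ 2 + (2 * z.re * z.im) ^ 2 := by
          ring
        rw [this, h1, h2, div_pow, div_pow, ← add_div, ← hρ2, div_self (pow_ne_zero 2 hρ0)]
      · rw [h1, h2]; ring
  refine ⟨rot c s hcs * torus u hu, mul_mem (rot_mem _ _ _) (torus_mem _ _), ?_, fun w => rfl,
    fun w h1 h2 => ?_, ?_⟩
  · rw [LinearEquiv.mul_apply, rot_apply, torus_apply]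
    dsimp only
    rw [hr, map_smul, re_one, smul_eq_mul, mul_one, ← sub_smul]
    have : r - (2 * s ^ 2 * r + 2 * c * s * v.2.1) = 0 := by linear_combination h0 - r * hcs
    rw [this, zero_smul]
  · rw [LinearEquiv.mul_apply, rot_apply, torus_apply]
    simp [h1, h2]
  · rw [LinearEquiv.mul_apply, rot_apply, torus_apply]
    simp

variable [FiniteDimensional ℝ K]

/-- The group of elementary automorphisms is transitive on the primitive idempotents, which
correspond to the vectors `y` with `y * y = -y`. -/
theorem exists_fix_P {φ : TH K ≃ₗ[ℝ] TH K} (hφ : φ ∈ aut K) :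
    ∃ g ∈ elem K, (g * φ) (1, 0, 0, 0, 0) = (1, 0, 0, 0, 0) := by
  suffices H : ∀ y : TH K, prd y y = -y → inn y y = 1 → ∃ g ∈ elem K, g y = (1, 0, 0, 0, 0) by
    refine H (φ (1, 0, 0, 0, 0)) ?_ ?_
    · rw [← aut_prd hφ, ← map_neg]
      congr 1
      refine ext5 ?_ ?_ ?_ ?_ ?_ <;> simp [prd_def]
    · rw [aut_inn hφ]; simp [inn_def]
  have step {y : TH K} {g : TH K ≃ₗ[ℝ] TH K} (hg : g ∈ elem K)
      (h : ∃ g' ∈ elem K, g' (g y) = (1, 0, 0, 0, 0)) : ∃ g ∈ elem K, g y = (1, 0, 0, 0, 0) := by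
    obtain ⟨g', hg', h⟩ := h
    exact ⟨g' * g, mul_mem hg' hg, h⟩
  have hprd {y : TH K} {g : TH K ≃ₗ[ℝ] TH K} (hg : g ∈ elem K) (h : prd y y = -y) :
      prd (g y) (g y) = -g y := by rw [← aut_prd (elem_le_aut hg), h, map_neg]
  have hinn {y : TH K} {g : TH K ≃ₗ[ℝ] TH K} (hg : g ∈ elem K) (h : inn y y = 1) :
      inn (g y) (g y) = 1 := by rw [aut_inn (elem_le_aut hg), h]
  have h3 : √3 ^ 2 = 3 := Real.sq_sqrt (by norm_num)
  have h30 : √3 ≠ 0 := by intro h; rw [h] at h3; norm_num at h3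
  -- There are three diagonal solutions `y`, and `cyc` permutes them.
  have diag (y : TH K) (h1 : prd y y = -y) (h2 : inn y y = 1) (hY1 : y.2.2.1 = 0)
      (hY2 : y.2.2.2.1 = 0) (hY3 : y.2.2.2.2 = 0) : ∃ g ∈ elem K, g y = (1, 0, 0, 0, 0) := by
    obtain ⟨p, q, x, y, z⟩ := y
    dsimp only at hY1 hY2 hY3
    subst hY1 hY2 hY3
    have e1 := congrArg Prod.fst h1
    have e2 := congrArg (fun w => w.2.1) h1
    simp [prd_def] at e1 e2
    simp [inn_def] at h2
    by_cases hq : q = 0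
    · refine ⟨1, one_mem _, ext5 ?_ hq rfl rfl rfl⟩
      change p = 1
      nlinarith
    · have hp : p = -1 / 2 := by
        have : q * (2 * p + 1) = 0 := by linarith
        have := (mul_eq_zero.1 this).resolve_left hq
        linarith
      subst hp
      have : (q - √3 / 2) * (q + √3 / 2) = 0 := by linear_combination h2 - h3 / 4
      rcases mul_eq_zero.1 this with h | h
      · obtain rfl : q = √3 / 2 := by linarith
        refine ⟨cyc K * cyc K, mul_mem cyc_mem cyc_mem, ?_⟩
        rw [LinearEquiv.mul_apply, cyc_apply, cyc_apply]
        refine ext5 ?_ ?_ rfl rfl rfl <;> dsimp only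
        · linear_combination (3 / 8 : ℝ) * h3
        · linear_combination (-(√3 / 8)) * h3
      · obtain rfl : q = -(√3 / 2) := by linarith
        refine ⟨cyc K, cyc_mem, ?_⟩
        rw [cyc_apply]
        refine ext5 ?_ ?_ rfl rfl rfl <;> dsimp only
        · linear_combination (1 / 4 : ℝ) * h3
        · ring
  have two (y : TH K) (h1 : prd y y = -y) (h2 : inn y y = 1) (hY1 : y.2.2.1 = 0)
      (hY2 : y.2.2.2.1 = 0) : ∃ g ∈ elem K, g y = (1, 0, 0, 0, 0) := by
    obtain ⟨g, hg, hk, -, h, -⟩ := exists_kill y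
    exact step hg (diag _ (hprd hg h1) (hinn hg h2) (h _ hY1 hY2).1 (h _ hY1 hY2).2 hk)
  intro y h1 h2
  obtain ⟨g, hg, hk, -, -, -⟩ := exists_kill y
  refine step hg ?_
  replace h1 := hprd hg h1
  replace h2 := hinn hg h2
  generalize g y = y at *
  -- As the third entry vanishes, `y * y = -y` makes the product of the other two vanish.
  have h0 : y.2.2.1 * y.2.2.2.1 = 0 := by
    have := congrArg (fun w => w.2.2.2.2) h1
    simpa [prd_def, hk, h30, -star_mul, ← two_smul ℝ, star_rsmul] using this
  rcases nsq_eq_zero.2 h0 |> fun h => mul_eq_zero.1 ((nsq_mul _ _).symm.trans h) with h | h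
  · exact step cyc_mem (two _ (hprd cyc_mem h1) (hinn cyc_mem h2) hk (nsq_eq_zero.1 h))
  · exact step cyc_mem (step cyc_mem (two _ (hprd cyc_mem (hprd cyc_mem h1))
      (hinn cyc_mem (hinn cyc_mem h2)) (nsq_eq_zero.1 h) hk))

/-- Up to elementary automorphisms, an automorphism fixes all diagonal matrices.  If it fixes
`P = (1, 0, 0, 0, 0)`, it maps `(0, 1, 0, 0, 0)` into the eigenspace of multiplication by `P` for
the eigenvalue `1`, and the elementary automorphisms that fix `P` are transitive on its unit
sphere. -/
theorem exists_fix_PQ {φ : TH K ≃ₗ[ℝ] TH K} (hφ : φ ∈ aut K) :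
    ∃ g ∈ elem K, (g * φ) (1, 0, 0, 0, 0) = (1, 0, 0, 0, 0) ∧
      (g * φ) (0, 1, 0, 0, 0) = (0, 1, 0, 0, 0) := by
  obtain ⟨g, hg, hP⟩ := exists_fix_P hφ
  have hgφ : g * φ ∈ aut K := mul_mem (elem_le_aut hg) hφ
  set ψ := g * φ
  set z := ψ (0, 1, 0, 0, 0) with hz
  have h1 : prd (1, 0, 0, 0, 0) z = z := by
    rw [hz, ← hP, ← aut_prd hgφ]
    congr 1
    refine ext5 ?_ ?_ ?_ ?_ ?_ <;> simp [prd_def]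
  have h2 : inn z z = 1 := by
    rw [aut_inn hgφ]; simp [inn_def]
  obtain ⟨g', hg', hk, hf, hY, hP'⟩ := exists_kill z
  have hz1 : z.1 = 0 := by
    have := congrArg Prod.fst h1
    simp [prd_def] at this
    linarith
  have hz3 : z.2.2.1 = 0 := by
    have := congrArg (fun w => w.2.2.1) h1
    simp [prd_def] at this
    have h : (-1 / 2 - 1 : ℝ) • z.2.2.1 = 0 := by rw [sub_smul, this, one_smul, sub_self]
    exact (smul_eq_zero.1 h).resolve_left (by norm_num)
  have hz4 : z.2.2.2.1 = 0 := by
    have := congrArg (fun w => w.2.2.2.1) h1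
    simp [prd_def] at this
    have h : (-1 / 2 - 1 : ℝ) • z.2.2.2.1 = 0 := by rw [sub_smul, this, one_smul, sub_self]
    exact (smul_eq_zero.1 h).resolve_left (by norm_num)
  have h2' : inn (g' z) (g' z) = 1 := by rw [aut_inn (elem_le_aut hg'), h2]
  have hq : (g' z).2.1 ^ 2 = 1 := by
    rw [inn_def, hf, hz1, hk, (hY z hz3 hz4).1, (hY z hz3 hz4).2] at h2'
    simp at h2'
    nlinarith
  rcases sq_eq_one_iff.1 hq with h | h
  · refine ⟨g' * g, mul_mem hg' hg, ?_, ?_⟩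
    · rw [mul_assoc, LinearEquiv.mul_apply, hP, hP']
    · rw [mul_assoc, LinearEquiv.mul_apply]
      exact ext5 (by rw [hf, ← hz, hz1]) h (hY z hz3 hz4).1 (hY z hz3 hz4).2 hk
  · refine ⟨rot 0 1 (by norm_num) * g' * g, mul_mem (mul_mem (rot_mem _ _ _) hg') hg, ?_, ?_⟩
    · rw [mul_assoc, mul_assoc, LinearEquiv.mul_apply, LinearEquiv.mul_apply, hP, hP', rot_apply]
      simp
    · rw [mul_assoc, mul_assoc, LinearEquiv.mul_apply, LinearEquiv.mul_apply, ← hz, rot_apply]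
      refine ext5 ?_ ?_ ?_ ?_ ?_ <;> simp [h, hk, (hY z hz3 hz4).1, (hY z hz3 hz4).2, hf, hz1]

/-- An automorphism fixing the diagonal matrices acts separately on the three off-diagonal
entries: these are joint eigenspaces of the multiplications by diagonal matrices. -/
theorem exists_triality {φ : TH K ≃ₗ[ℝ] TH K} (hφ : φ ∈ aut K)
    (hP : φ (1, 0, 0, 0, 0) = (1, 0, 0, 0, 0)) (hQ : φ (0, 1, 0, 0, 0) = (0, 1, 0, 0, 0)) :
    ∃ α β γ : K →ₗ[ℝ] K, ∀ v, φ v = (v.1, v.2.1, α v.2.2.1, β v.2.2.2.1, γ v.2.2.2.2) := by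
  have eP (v : TH K) : prd (1, 0, 0, 0, 0) v
      = (-v.1, v.2.1, (-1 / 2 : ℝ) • v.2.2.1, (-1 / 2 : ℝ) • v.2.2.2.1, v.2.2.2.2) := by
    refine ext5 ?_ ?_ ?_ ?_ ?_ <;> simp [prd_def]
  have eQ (v : TH K) : prd (0, 1, 0, 0, 0) v
      = (v.2.1, v.1, (√3 / 2 : ℝ) • v.2.2.1, (-√3 / 2 : ℝ) • v.2.2.2.1, 0) := by
    refine ext5 ?_ ?_ ?_ ?_ ?_ <;> simp [prd_def]
  have hP' (v : TH K) : prd (1, 0, 0, 0, 0) (φ v) = φ (prd (1, 0, 0, 0, 0) v) := by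
    rw [aut_prd hφ, hP]
  have hQ' (v : TH K) : prd (0, 1, 0, 0, 0) (φ v) = φ (prd (0, 1, 0, 0, 0) v) := by
    rw [aut_prd hφ, hQ]
  have h3 : √3 ^ 2 = 3 := Real.sq_sqrt (by norm_num)
  have h30 : √3 ≠ 0 := by intro h; rw [h] at h3; norm_num at h3
  have zero_of {a b : ℝ} {x : K} (h : a • x = b • x) (hab : a ≠ b) : x = 0 := by
    rw [← sub_eq_zero, ← sub_smul] at h
    exact (smul_eq_zero.1 h).resolve_left (sub_ne_zero.2 hab)
  have h1 (x : K) : φ (0, 0, x, 0, 0) = (0, 0, (φ (0, 0, x, 0, 0)).2.2.1, 0, 0) := by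
    have a := hP' (0, 0, x, 0, 0)
    have b := hQ' (0, 0, x, 0, 0)
    have a' : prd (1, 0, 0, 0, 0) (0, 0, x, 0, 0) = (-1 / 2 : ℝ) • ((0, 0, x, 0, 0) : TH K) := by
      rw [eP]; refine ext5 ?_ ?_ ?_ ?_ ?_ <;> simp
    have b' : prd (0, 1, 0, 0, 0) (0, 0, x, 0, 0) = (√3 / 2 : ℝ) • ((0, 0, x, 0, 0) : TH K) := by
      rw [eQ]; refine ext5 ?_ ?_ ?_ ?_ ?_ <;> simp
    rw [a', map_smul, eP] at a
    rw [b', map_smul, eQ] at b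
    generalize φ (0, 0, x, 0, 0) = w at *
    obtain ⟨p, q, x, y, z⟩ := w
    simp only [Prod.smul_mk, Prod.mk.injEq, smul_eq_mul] at a b
    refine ext5 ?_ ?_ rfl ?_ ?_ <;> dsimp only
    · linarith
    · linarith
    · exact zero_of b.2.2.2.1 (by intro h; apply h30; linarith)
    · exact zero_of ((one_smul ℝ z).trans a.2.2.2.2) (by norm_num)
  have h2 (x : K) : φ (0, 0, 0, x, 0) = (0, 0, 0, (φ (0, 0, 0, x, 0)).2.2.2.1, 0) := by
    have a := hP' (0, 0, 0, x, 0)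
    have b := hQ' (0, 0, 0, x, 0)
    have a' : prd (1, 0, 0, 0, 0) (0, 0, 0, x, 0) = (-1 / 2 : ℝ) • ((0, 0, 0, x, 0) : TH K) := by
      rw [eP]; refine ext5 ?_ ?_ ?_ ?_ ?_ <;> simp
    have b' : prd (0, 1, 0, 0, 0) (0, 0, 0, x, 0) = (-√3 / 2 : ℝ) • ((0, 0, 0, x, 0) : TH K) := by
      rw [eQ]; refine ext5 ?_ ?_ ?_ ?_ ?_ <;> simp
    rw [a', map_smul, eP] at a
    rw [b', map_smul, eQ] at b
    generalize φ (0, 0, 0, x, 0) = w at *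
    obtain ⟨p, q, x, y, z⟩ := w
    simp only [Prod.smul_mk, Prod.mk.injEq, smul_eq_mul] at a b
    refine ext5 ?_ ?_ ?_ rfl ?_ <;> dsimp only
    · linarith
    · linarith
    · exact zero_of b.2.2.1 (by intro h; apply h30; linarith)
    · exact zero_of ((one_smul ℝ z).trans a.2.2.2.2) (by norm_num)
  have h3 (x : K) : φ (0, 0, 0, 0, x) = (0, 0, 0, 0, (φ (0, 0, 0, 0, x)).2.2.2.2) := by
    have a := hP' (0, 0, 0, 0, x)
    have b := hQ' (0, 0, 0, 0, x)
    have a' : prd (1, 0, 0, 0, 0) (0, 0, 0, 0, x) = ((0, 0, 0, 0, x) : TH K) := by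
      rw [eP]; refine ext5 ?_ ?_ ?_ ?_ ?_ <;> simp
    have b' : prd (0, 1, 0, 0, 0) (0, 0, 0, 0, x) = (0 : TH K) := by
      rw [eQ]; refine ext5 ?_ ?_ ?_ ?_ ?_ <;> simp
    rw [a', eP] at a
    rw [b', map_zero, eQ] at b
    generalize φ (0, 0, 0, 0, x) = w at *
    obtain ⟨p, q, x, y, z⟩ := w
    simp only [Prod.mk_eq_zero, Prod.mk.injEq] at a b
    refine ext5 ?_ ?_ ?_ ?_ rfl <;> dsimp only
    · exact b.2.1
    · exact b.1
    · exact zero_of (a.2.2.1.trans (one_smul ℝ x).symm) (by norm_num)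
    · exact zero_of (a.2.2.2.1.trans (one_smul ℝ y).symm) (by norm_num)
  refine ⟨⟨⟨fun x => (φ (0, 0, x, 0, 0)).2.2.1, fun x y => ?_⟩, fun c x => ?_⟩,
    ⟨⟨fun x => (φ (0, 0, 0, x, 0)).2.2.2.1, fun x y => ?_⟩, fun c x => ?_⟩,
    ⟨⟨fun x => (φ (0, 0, 0, 0, x)).2.2.2.2, fun x y => ?_⟩, fun c x => ?_⟩, fun v => ?_⟩
  · have : ((0, 0, x + y, 0, 0) : TH K) = (0, 0, x, 0, 0) + (0, 0, y, 0, 0) := by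
      refine ext5 ?_ ?_ ?_ ?_ ?_ <;> simp
    rw [this, map_add]; rfl
  · have : ((0, 0, c • x, 0, 0) : TH K) = c • (0, 0, x, 0, 0) := by
      refine ext5 ?_ ?_ ?_ ?_ ?_ <;> simp
    change (φ (0, 0, c • x, 0, 0)).2.2.1 = _
    rw [this, map_smul]; rfl
  · have : ((0, 0, 0, x + y, 0) : TH K) = (0, 0, 0, x, 0) + (0, 0, 0, y, 0) := by
      refine ext5 ?_ ?_ ?_ ?_ ?_ <;> simp
    rw [this, map_add]; rfl
  · have : ((0, 0, 0, c • x, 0) : TH K) = c • (0, 0, 0, x, 0) := by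
      refine ext5 ?_ ?_ ?_ ?_ ?_ <;> simp
    change (φ (0, 0, 0, c • x, 0)).2.2.2.1 = _
    rw [this, map_smul]; rfl
  · have : ((0, 0, 0, 0, x + y) : TH K) = (0, 0, 0, 0, x) + (0, 0, 0, 0, y) := by
      refine ext5 ?_ ?_ ?_ ?_ ?_ <;> simp
    rw [this, map_add]; rfl
  · have : ((0, 0, 0, 0, c • x) : TH K) = c • (0, 0, 0, 0, x) := by
      refine ext5 ?_ ?_ ?_ ?_ ?_ <;> simp
    change (φ (0, 0, 0, 0, c • x)).2.2.2.2 = _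
    rw [this, map_smul]; rfl
  · have : v = v.1 • (1, 0, 0, 0, 0) + v.2.1 • (0, 1, 0, 0, 0) + (0, 0, v.2.2.1, 0, 0)
        + (0, 0, 0, v.2.2.2.1, 0) + (0, 0, 0, 0, v.2.2.2.2) := by
      refine ext5 ?_ ?_ ?_ ?_ ?_ <;> simp
    conv_lhs => rw [this]
    simp only [map_add, map_smul, hP, hQ]
    rw [h1, h2, h3]
    refine ext5 ?_ ?_ ?_ ?_ ?_ <;> simp

end reduction

section normalForm

variable {K : Type} [NonAssocRing K] [Module ℝ K] [IsScalarTower ℝ K K]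
    [SMulCommClass ℝ K K] [StarRing K] [CompAlg K]

/-- Linear maps that preserve the unit, the product and the norm. -/
structure IsIsometricHom (α : K →ₗ[ℝ] K) : Prop where
  map_one : α 1 = 1
  map_mul : ∀ x y, α (x * y) = α x * α y
  map_nsq : ∀ x, nsq (α x) = nsq x

namespace IsIsometricHom

variable {α : K →ₗ[ℝ] K}

theorem of_isometry_re (h1 : α 1 = 1) (hn : ∀ x, nsq (α x) = nsq x) (x : K) :
    re (α x) = re x := by
  have h := hn (x + 1)
  rw [map_add, nsq_add, nsq_add, h1, hn, ip_one_right, ip_one_right] at h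
  linarith

theorem of_isometry_star (h1 : α 1 = 1) (hn : ∀ x, nsq (α x) = nsq x) (x : K) :
    α (star x) = star (α x) := by
  rw [star_eq, star_eq, map_sub, map_smul, h1, of_isometry_re h1 hn]

theorem map_re (h : IsIsometricHom α) (x : K) : re (α x) = re x :=
  of_isometry_re h.map_one h.map_nsq x

theorem map_star (h : IsIsometricHom α) (x : K) : α (star x) = star (α x) :=
  of_isometry_star h.map_one h.map_nsq x

end IsIsometricHom

/-- Some elementary automorphism acts separately on the off-diagonal entries, fixes `1` as the first
of them and sends a given unit vector `b` to `1` in the second: with `w³ = star b` it acts on these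
two entries by `x ↦ w x w̄` and `y ↦ w y w²`. -/
theorem exists_normalize_snd (b : K) (hb : nsq b = 1) : ∃ g ∈ elem K,
    ∃ α β γ : K →ₗ[ℝ] K, (∀ v, g v = (v.1, v.2.1, α v.2.2.1, β v.2.2.2.1, γ v.2.2.2.2)) ∧
      α 1 = 1 ∧ β b = 1 := by
  obtain ⟨w, hw, hwb⟩ := exists_cube_root (star b) (by rw [nsq_star, hb])
  have hb' : b = star w * star w * star w := by
    rw [← star_star b, ← hwb, star_mul, star_mul]
  refine ⟨cyc K * torus w hw * (cyc K)⁻¹ * torus (star w) (by rw [nsq_star, hw]),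
    mul_mem (mul_mem (mul_mem cyc_mem (torus_mem _ _)) (inv_mem cyc_mem)) (torus_mem _ _),
    (LinearMap.mulLeft ℝ w).comp (LinearMap.mulRight ℝ (star w)),
    (LinearMap.mulRight ℝ w).comp ((LinearMap.mulLeft ℝ w).comp (LinearMap.mulRight ℝ w)),
    (LinearMap.mulLeft ℝ (star w)).comp ((LinearMap.mulRight ℝ (star w)).comp
      (LinearMap.mulLeft ℝ (star w))), fun v => ?_, ?_, ?_⟩
  · have hcyc : (cyc K)⁻¹ (torus (star w) (by rw [nsq_star, hw]) v) =
        (-(v.1 - √3 * v.2.1) / 2, -(√3 * v.1 + v.2.1) / 2, w * (v.2.2.2.1 * w),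
          star w * v.2.2.2.2, v.2.2.1 * star w) := by
      rw [torus_apply, star_star]; rfl
    have h3 : √3 ^ 2 = 3 := Real.sq_sqrt (by norm_num)
    rw [LinearEquiv.mul_apply, LinearEquiv.mul_apply, LinearEquiv.mul_apply, hcyc, torus_apply,
      cyc_apply]
    refine ext5 ?_ ?_ ?_ ?_ ?_ <;> simp
    · linear_combination v.1 / 4 * h3
    · linear_combination v.2.1 / 4 * h3
  · simp [mul_star_self_eq, hw]
  · simp only [LinearMap.comp_apply, LinearMap.mulLeft_apply, LinearMap.mulRight_apply]
    rw [hb', mul_star_mul_cancel, hw, one_smul, mul_star_cancel, hw, one_smul, star_mul_self_eq,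
      hw, one_smul]

variable [FiniteDimensional ℝ K]

/-- Up to elementary automorphisms, every automorphism of the cubic form is an automorphism of the
composition algebra applied to the matrix entries. -/
theorem exists_normalForm {φ : TH K ≃ₗ[ℝ] TH K} (hφ : φ ∈ aut K) :
    ∃ g ∈ elem K, ∃ α : K →ₗ[ℝ] K, IsIsometricHom α ∧
      ∀ v, (g * φ) v = (v.1, v.2.1, α v.2.2.1, α v.2.2.2.1, α v.2.2.2.2) := by
  obtain ⟨g₀, hg₀, hP, hQ⟩ := exists_fix_PQ hφ
  have h₀ : g₀ * φ ∈ aut K := mul_mem (elem_le_aut hg₀) hφ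
  obtain ⟨α₀, β₀, γ₀, e₀⟩ := exists_triality h₀ hP hQ
  have hα₀ (x : K) : nsq (α₀ x) = nsq x := by
    have := aut_inn h₀ (0, 0, x, 0, 0) (0, 0, x, 0, 0)
    rw [e₀] at this
    simpa [inn_def, nsq] using this
  have hβ₀ (x : K) : nsq (β₀ x) = nsq x := by
    have := aut_inn h₀ (0, 0, 0, x, 0) (0, 0, 0, x, 0)
    rw [e₀] at this
    simpa [inn_def, nsq] using this
  -- The images of `1` in the first two entries are moved back to `1`, one after the other.
  set a := α₀ 1 with ha
  have ha1 : nsq (star a) = 1 := by rw [nsq_star, hα₀, nsq_one]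
  set b := a * (β₀ 1 * a) with hb
  have hb1 : nsq b = 1 := by
    rw [nsq_mul, nsq_mul, hβ₀, hα₀, nsq_one]; norm_num
  obtain ⟨g₁, hg₁, α₁, β₁, γ₁, e₁, hα₁, hβ₁⟩ := exists_normalize_snd b hb1
  set g := g₁ * torus (star a) ha1 * g₀ with hg
  have hg' : g ∈ elem K := mul_mem (mul_mem hg₁ (torus_mem _ _)) hg₀
  have hgφ : g * φ ∈ aut K := mul_mem (elem_le_aut hg') hφ
  obtain ⟨α, β, γ, e, hα, hβ⟩ : ∃ α β γ : K →ₗ[ℝ] K,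
      (∀ v, (g * φ) v = (v.1, v.2.1, α v.2.2.1, β v.2.2.2.1, γ v.2.2.2.2)) ∧
      α 1 = 1 ∧ β 1 = 1 := by
    refine ⟨α₁.comp ((LinearMap.mulRight ℝ (star a)).comp α₀),
      β₁.comp ((LinearMap.mulLeft ℝ a).comp ((LinearMap.mulRight ℝ a).comp β₀)),
      γ₁.comp ((LinearMap.mulLeft ℝ (star a)).comp γ₀), fun v => ?_, ?_, ?_⟩
    · rw [hg, mul_assoc, mul_assoc, LinearEquiv.mul_apply, LinearEquiv.mul_apply, e₀, torus_apply,
        e₁, star_star]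
      rfl
    · simp only [LinearMap.comp_apply, LinearMap.mulRight_apply]
      rw [← ha, mul_star_self_eq, ← nsq_star, ha1, one_smul, hα₁]
    · exact hβ₁
  have hαn (x : K) : nsq (α x) = nsq x := by
    have := aut_inn hgφ (0, 0, x, 0, 0) (0, 0, x, 0, 0)
    rw [e] at this
    simpa [inn_def, nsq] using this
  -- The product of first and second entry is the conjugate of the third.
  have hmul (x y : K) : γ (star (x * y)) = star (α x * β y) := by
    have := aut_prd hgφ (0, 0, x, 0, 0) (0, 0, 0, y, 0)
    rw [e, e, e] at this
    have := congrArg (fun w => w.2.2.2.2) this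
    simpa [prd_def, -star_mul] using this
  have hγα (x : K) : γ (star x) = star (α x) := by simpa [hβ] using hmul x 1
  have hγβ (x : K) : γ (star x) = star (β x) := by simpa [hα] using hmul 1 x
  have hβα (x : K) : β x = α x := by rw [← star_inj, ← hγα, hγβ]
  have hm (x y : K) : α (x * y) = α x * α y := by
    rw [← star_inj, ← hγα, hmul, hβα]
  refine ⟨g, hg', α, ⟨hα, hm, hαn⟩, fun v => ?_⟩
  have hγ (x : K) : γ x = α x := by
    have := hγα (star x)
    rw [IsIsometricHom.of_isometry_star hα hαn, star_star, star_star] at this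
    exact this
  rw [e, hβα, hγ]

end normalForm

/-! ### Determinants -/

section determinants

variable {K : Type} [NonAssocRing K] [Module ℝ K] [IsScalarTower ℝ K K]
    [SMulCommClass ℝ K K] [StarRing K] [CompAlg K]

theorem rot_mul (c s c' s' : ℝ) (h : c ^ 2 + s ^ 2 = 1) (h' : c' ^ 2 + s' ^ 2 = 1) :
    (rot c s h * rot c' s' h' : TH K ≃ₗ[ℝ] TH K) =
      rot (c * c' - s * s') (c * s' + s * c')
        (by linear_combination (c' ^ 2 + s' ^ 2) * h + h') := by
  refine LinearEquiv.ext fun v => ?_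
  rw [LinearEquiv.mul_apply, rot_apply, rot_apply, rot_apply]
  refine ext5 rfl ?_ ?_ ?_ ?_ <;>
    simp only [map_sub, map_smul, re_one, star_add, star_sub, star_rsmul, star_star, smul_eq_mul]
  · grind
  · module
  · module
  · match_scalars
    · ring
    · grind

theorem torus_neg_one_conj (c s : ℝ) (h : c ^ 2 + s ^ 2 = 1) :
    (torus (-1 : K) (by simp) * rot c s h * torus (-1 : K) (by simp) : TH K ≃ₗ[ℝ] TH K) =
      rot c (-s) (by rw [neg_sq, h]) := by
  refine LinearEquiv.ext fun v => ?_
  rw [LinearEquiv.mul_apply, LinearEquiv.mul_apply, torus_apply, rot_apply, torus_apply, rot_apply]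
  refine ext5 rfl ?_ ?_ ?_ ?_ <;> simp <;> module

variable [FiniteDimensional ℝ K]

theorem det_eq_of_diag {φ : TH K →ₗ[ℝ] TH K} (α β γ : K →ₗ[ℝ] K)
    (h : ∀ v, φ v = (v.1, v.2.1, α v.2.2.1, β v.2.2.2.1, γ v.2.2.2.2)) :
    LinearMap.det φ = LinearMap.det α * LinearMap.det β * LinearMap.det γ := by
  have : φ = LinearMap.prodMap LinearMap.id
      (LinearMap.prodMap LinearMap.id (LinearMap.prodMap α (LinearMap.prodMap β γ))) :=
    LinearMap.ext h
  rw [this, LinearMap.det_prodMap, LinearMap.det_prodMap, LinearMap.det_prodMap,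
    LinearMap.det_prodMap, LinearMap.det_id]
  ring

theorem det_torus (u : K) (hu : nsq u = 1) : LinearEquiv.det (torus u hu) = 1 := by
  have h1 : LinearMap.mulLeft ℝ (star u) ∘ₗ LinearMap.mulLeft ℝ u = LinearMap.id :=
    LinearMap.ext fun x => by simp [star_mul_cancel, hu]
  have h2 : LinearMap.mulRight ℝ (star u) ∘ₗ LinearMap.mulRight ℝ u = LinearMap.id :=
    LinearMap.ext fun x => by simp [mul_cancel_star, hu]
  have h3 := congrArg LinearMap.det h1
  have h4 := congrArg LinearMap.det h2
  rw [LinearMap.det_comp, LinearMap.det_id] at h3 h4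
  rw [Units.ext_iff, LinearEquiv.coe_det, det_eq_of_diag (LinearMap.mulRight ℝ u)
    (LinearMap.mulLeft ℝ (star u) ∘ₗ LinearMap.mulRight ℝ (star u)) (LinearMap.mulLeft ℝ u)
    (torus_apply u hu), LinearMap.det_comp, Units.val_one]
  linear_combination LinearMap.det (LinearMap.mulRight ℝ (star u)) *
    LinearMap.det (LinearMap.mulRight ℝ u) * h3 + h4

theorem det_rot (c s : ℝ) (h : c ^ 2 + s ^ 2 = 1) :
    LinearEquiv.det (rot c s h : TH K ≃ₗ[ℝ] TH K) = 1 := by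
  -- A rotation is conjugate to its inverse, so its determinant has square `1`,
  have sq (c s : ℝ) (h : c ^ 2 + s ^ 2 = 1) :
      LinearEquiv.det (rot c s h : TH K ≃ₗ[ℝ] TH K) ^ 2 = 1 := by
    have h1 := congrArg LinearEquiv.det (torus_neg_one_conj (K := K) c s h)
    rw [map_mul, map_mul, det_torus, one_mul, mul_one] at h1
    rw [pow_two]
    nth_rw 2 [h1]
    rw [← map_mul, rot_mul]
    have : (rot (c * c - s * -s) (c * -s + s * c)
        (by linear_combination (c ^ 2 + s ^ 2 + 1) * h) : TH K ≃ₗ[ℝ] TH K) = 1 := by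
      refine LinearEquiv.ext fun v => ?_
      rw [rot_apply]
      have e1 : c * c - s * -s = 1 := by linear_combination h
      have e2 : c * -s + s * c = 0 := by ring
      simp only [e1, e2]
      refine ext5 ?_ ?_ ?_ ?_ ?_ <;> simp
    rw [this, map_one]
  -- and it is the square of the rotation by half the angle.
  obtain ⟨z, hz⟩ := IsAlgClosed.exists_pow_nat_eq (⟨c, s⟩ : ℂ) (n := 2) (by norm_num)
  have h1 : z.re * z.re - z.im * z.im = c := by
    have := congrArg Complex.re hz
    simp only [pow_succ, pow_zero, one_mul, Complex.mul_re] at this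
    linarith
  have h2 : z.re * z.im + z.im * z.re = s := by
    have := congrArg Complex.im hz
    simp only [pow_succ, pow_zero, one_mul, Complex.mul_im] at this
    linarith
  have h3 : z.re ^ 2 + z.im ^ 2 = 1 := by
    refine (pow_eq_one_iff_of_nonneg (by positivity) two_ne_zero).1 ?_
    rw [← h, ← h1, ← h2]; ring
  have h4 := rot_mul (K := K) z.re z.im z.re z.im h3 h3
  simp only [h1, h2] at h4
  rw [← h4, map_mul, ← pow_two, sq]

theorem det_cyc : LinearEquiv.det (cyc K) = 1 := by
  have h3 : √3 ^ 2 = 3 := Real.sq_sqrt (by norm_num)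
  have h : cyc K * cyc K * cyc K = 1 := by
    refine LinearEquiv.ext fun v => ?_
    rw [LinearEquiv.mul_apply, LinearEquiv.mul_apply, cyc_apply, cyc_apply, cyc_apply]
    refine ext5 ?_ ?_ rfl rfl rfl <;> simp
    · linear_combination (3 * v.1 / 8 + √3 * v.2.1 / 8) * h3
    · linear_combination (3 * v.2.1 / 8 - √3 * v.1 / 8) * h3
  have h1 := congrArg (fun φ => (LinearEquiv.det φ : ℝ)) h
  simp only [map_mul, map_one, Units.val_mul, Units.val_one] at h1
  rw [Units.ext_iff, Units.val_one]
  set d : ℝ := (LinearEquiv.det (cyc K) : ℝ)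
  have h2 : (d - 1) * (d ^ 2 + d + 1) = 0 := by linear_combination h1
  rcases mul_eq_zero.1 h2 with h | h
  · linarith
  · nlinarith [sq_nonneg (d + 1 / 2)]

theorem det_elem {φ : TH K ≃ₗ[ℝ] TH K} (hφ : φ ∈ elem K) : LinearEquiv.det φ = 1 :=
  elem_le (G := (LinearEquiv.det : (TH K ≃ₗ[ℝ] TH K) →* ℝˣ).ker) det_cyc det_rot det_torus hφ

/-- Only the algebra automorphism of the normal form contributes to the determinant, once for each
off-diagonal entry. -/
theorem det_normalForm {φ g : TH K ≃ₗ[ℝ] TH K} (hg : g ∈ elem K) (α : K →ₗ[ℝ] K)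
    (h : ∀ v, (g * φ) v = (v.1, v.2.1, α v.2.2.1, α v.2.2.2.1, α v.2.2.2.2)) :
    (LinearEquiv.det φ : ℝ) = LinearMap.det α ^ 3 := by
  have h1 := det_eq_of_diag (φ := ((g * φ : TH K ≃ₗ[ℝ] TH K) : TH K →ₗ[ℝ] TH K)) α α α h
  rw [← LinearEquiv.coe_det, map_mul, det_elem hg, one_mul] at h1
  rw [h1]; ring

end determinants

/-! ### Matrices and the Jordan product -/

section matrices

variable {K : Type} [NonAssocRing K] [Module ℝ K] [IsScalarTower ℝ K K]
    [SMulCommClass ℝ K K] [StarRing K] [CompAlg K]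

/-- The traceless Hermitian matrix with the given coordinates. -/
def mat : TH K →ₗ[ℝ] Matrix (Fin 3) (Fin 3) K where
  toFun v := !![(v.1 - √3 * v.2.1) • 1, √3 • v.2.2.2.2, √3 • star v.2.2.2.1;
    √3 • star v.2.2.2.2, (v.1 + √3 * v.2.1) • 1, √3 • v.2.2.1;
    √3 • v.2.2.2.1, √3 • star v.2.2.1, (-2 * v.1) • 1]
  map_add' v w := by
    ext i j
    fin_cases i <;> fin_cases j <;> simp <;> module
  map_smul' c v := by
    ext i j
    fin_cases i <;> fin_cases j <;> simp [star_rsmul] <;> module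

theorem mat_apply (v : TH K) : mat v =
    !![(v.1 - √3 * v.2.1) • 1, √3 • v.2.2.2.2, √3 • star v.2.2.2.1;
    √3 • star v.2.2.2.2, (v.1 + √3 * v.2.1) • 1, √3 • v.2.2.1;
    √3 • v.2.2.2.1, √3 • star v.2.2.1, (-2 * v.1) • 1] := rfl

/-- The coordinates of a traceless Hermitian matrix, read off from its entries. -/
def read : Matrix (Fin 3) (Fin 3) K →ₗ[ℝ] TH K where
  toFun M := (-re (M 2 2) / 2, (re (M 1 1) - re (M 0 0)) / (2 * √3), (√3)⁻¹ • M 1 2,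
    (√3)⁻¹ • M 2 0, (√3)⁻¹ • M 0 1)
  map_add' M N := by
    refine ext5 ?_ ?_ ?_ ?_ ?_ <;> simp <;> ring
  map_smul' c M := by
    refine ext5 ?_ ?_ ?_ ?_ ?_ <;> simp [smul_comm c] <;> ring

theorem read_apply (M : Matrix (Fin 3) (Fin 3) K) : read M =
    (-re (M 2 2) / 2, (re (M 1 1) - re (M 0 0)) / (2 * √3), (√3)⁻¹ • M 1 2,
    (√3)⁻¹ • M 2 0, (√3)⁻¹ • M 0 1) := rfl

theorem sqrt_three_ne_zero : √3 ≠ 0 := by simp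

theorem read_mat (v : TH K) : read (mat v) = v := by
  refine ext5 ?_ ?_ ?_ ?_ ?_ <;> simp [read_apply, mat_apply, re_one]
  field_simp
  ring

theorem mat_injective : Function.Injective (mat : TH K → Matrix (Fin 3) (Fin 3) K) :=
  Function.LeftInverse.injective read_mat

theorem star_mat (v : TH K) : star (mat v) = mat v := by
  ext i j
  fin_cases i <;> fin_cases j <;> simp [mat_apply, Matrix.star_apply, star_rsmul]

theorem eq_re_of_star_eq {x : K} (h : star x = x) : x = re x • (1 : K) := by
  rw [star_eq, sub_eq_iff_eq_add, ← two_smul ℝ x, mul_smul] at h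
  exact (smul_right_injective K (two_ne_zero (α := ℝ)) h).symm

/-- Traceless Hermitian matrices are recovered from their coordinates. -/
theorem mat_read {M : Matrix (Fin 3) (Fin 3) K} (hM : star M = M) (ht : re M.trace = 0) :
    mat (read M) = M := by
  have hs (i j : Fin 3) : star (M j i) = M i j := by
    conv_rhs => rw [← hM]
    rw [Matrix.star_apply]
  have h3 := sqrt_three_ne_zero
  rw [Matrix.trace_fin_three, map_add, map_add] at ht
  have hd (i : Fin 3) := eq_re_of_star_eq (hs i i)
  ext i j
  fin_cases i <;> fin_cases j <;> simp [mat_apply, read_apply, star_rsmul, hs, smul_smul, h3]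
  · conv_rhs => rw [hd]
    congr 1
    field_simp
    linarith
  · conv_rhs => rw [hd]
    congr 1
    field_simp
    linarith
  · conv_rhs => rw [hd]
    module

theorem mat_mul_self (v : TH K) : mat v * mat v = mat (prd v v) + (2 * inn v v) • 1 := by
  obtain ⟨p, q, x, y, z⟩ := v
  have h3 : √3 * √3 = 3 := Real.mul_self_sqrt (by norm_num)
  have hx : ip x x = nsq x := rfl
  have hy : ip y y = nsq y := rfl
  have hz : ip z z = nsq z := rfl
  ext i j
  fin_cases i <;> fin_cases j <;>
    simp [mat_apply, prd_def, inn_def, star_rsmul, smul_smul, smul_mul_assoc, mul_smul_comm,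
      mul_star_self_eq, star_mul_self_eq, hx, hy, hz]
  all_goals match_scalars <;> grind

/-- The Jordan product of traceless Hermitian matrices. -/
theorem mat_mul_add (v w : TH K) : mat v * mat w + mat w * mat v =
    (2 : ℝ) • mat (prd v w) + (4 * inn v w) • 1 := by
  have h := mat_mul_self (v + w)
  simp only [map_add, LinearMap.add_apply, add_mul, mul_add, mat_mul_self, prd_comm w v,
    inn_comm w v] at h
  have h' : mat v * mat w + mat w * mat v = mat v * mat w + mat w * mat v + mat (prd v v)
      + (2 * inn v v) • 1 + mat (prd w w) + (2 * inn w w) • 1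
      - (mat (prd v v) + (2 * inn v v) • 1 + mat (prd w w) + (2 * inn w w) • 1) := by abel
  rw [h']
  rw [← sub_eq_zero] at h ⊢
  rw [← h]
  module

end matrices

/-! ### Conjugation by unitary matrices -/

section unitary

variable {K : Type} [Ring K] [Module ℝ K] [IsScalarTower ℝ K K]
    [SMulCommClass ℝ K K] [StarRing K] [CompAlg K]

theorem re_trace_mul_comm (M N : Matrix (Fin 3) (Fin 3) K) :
    re (M * N).trace = re (N * M).trace := by
  simp only [Matrix.trace, Matrix.diag, Matrix.mul_apply, map_sum]
  rw [Finset.sum_comm]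
  simp only [re_mul_comm]

theorem re_trace_mat (v : TH K) : re (mat v).trace = 0 := by
  rw [mat_apply, Matrix.trace_fin_three]
  simp [re_one]
  ring

theorem re_trace_mat_mul (v w : TH K) : re (mat v * mat w).trace = 6 * inn v w := by
  have h := congrArg (fun M => re (Matrix.trace M)) (mat_mul_add v w)
  simp only [Matrix.trace_add, Matrix.trace_smul, map_add, map_smul, re_trace_mul_comm (mat w),
    re_trace_mat, Matrix.trace_one, Fintype.card_fin] at h
  have h3 : re ((3 : ℕ) : K) = 3 := by
    rw [Nat.cast_ofNat, show (3 : K) = 1 + 1 + 1 by norm_num, map_add, map_add, re_one]; norm_num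
  rw [h3] at h
  simp only [smul_eq_mul] at h
  linarith

/-- The group of unitary `3 × 3` matrices over `K`. -/
abbrev U3 (K : Type) [Ring K] [StarRing K] : Type := unitary (Matrix (Fin 3) (Fin 3) K)

theorem mat_read_conj (U : U3 K) (v : TH K) :
    mat (read ((U : Matrix (Fin 3) (Fin 3) K) * mat v * star (U : Matrix (Fin 3) (Fin 3) K))) =
      (U : Matrix (Fin 3) (Fin 3) K) * mat v * star (U : Matrix (Fin 3) (Fin 3) K) := by
  refine mat_read ?_ ?_
  · rw [star_mul, star_mul, star_star, star_mat, mul_assoc]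
  · rw [re_trace_mul_comm, ← mul_assoc, Unitary.coe_star_mul_self, one_mul, re_trace_mat]

variable (K) in
/-- The action of unitary matrices on traceless Hermitian matrices by conjugation. -/
def conjAction : U3 K →* (TH K ≃ₗ[ℝ] TH K) where
  toFun U :=
    { toFun := fun v => read ((U : Matrix (Fin 3) (Fin 3) K) * mat v * star (U : Matrix _ _ K))
      invFun := fun v => read (star (U : Matrix (Fin 3) (Fin 3) K) * mat v * U)
      map_add' := fun v w => by rw [map_add, mul_add, add_mul, map_add]
      map_smul' := fun c v => by
        rw [map_smul, mul_smul_comm, smul_mul_assoc, map_smul, RingHom.id_apply]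
      left_inv := fun v => by
        dsimp only
        rw [mat_read_conj]
        simp only [← mul_assoc, Unitary.star_mul_self_of_mem U.2, one_mul]
        rw [mul_assoc, Unitary.star_mul_self_of_mem U.2, mul_one, read_mat]
      right_inv := fun v => by
        have h := mat_read_conj (star U) v
        rw [Unitary.coe_star, star_star] at h
        dsimp only
        rw [h]
        simp only [← mul_assoc, Unitary.mul_star_self_of_mem U.2, one_mul]
        rw [mul_assoc, Unitary.mul_star_self_of_mem U.2, mul_one, read_mat] }
  map_one' := LinearEquiv.ext fun v => by
    change read ((1 : Matrix (Fin 3) (Fin 3) K) * mat v * star (1 : Matrix _ _ K)) = v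
    rw [one_mul, star_one, mul_one, read_mat]
  map_mul' U V := LinearEquiv.ext fun v => by
    rw [LinearEquiv.mul_apply]
    refine mat_injective ?_
    change mat (read _) = mat (read (_ * mat (read _) * _))
    rw [mat_read_conj, mat_read_conj, mat_read_conj, Submonoid.coe_mul, star_mul]
    simp only [mul_assoc]

theorem mat_conjAction (U : U3 K) (v : TH K) : mat (conjAction K U v) =
    (U : Matrix (Fin 3) (Fin 3) K) * mat v * star (U : Matrix (Fin 3) (Fin 3) K) :=
  mat_read_conj U v

theorem mat_conjAction_mul (U : U3 K) (v : TH K) :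
    mat (conjAction K U v) * (U : Matrix (Fin 3) (Fin 3) K) = U * mat v := by
  rw [mat_conjAction, mul_assoc, Unitary.coe_star_mul_self, mul_one]

theorem conjAction_eq {U : U3 K} {v w : TH K} :
    conjAction K U v = w ↔ mat w * (U : Matrix (Fin 3) (Fin 3) K) = U * mat v := by
  constructor
  · rintro rfl; exact mat_conjAction_mul U v
  · intro h
    refine mat_injective ?_
    rw [mat_conjAction, ← h, mul_assoc, Unitary.mul_star_self_of_mem U.2, mul_one]

theorem inn_conjAction (U : U3 K) (v w : TH K) :
    inn (conjAction K U v) w = (1 / 6) * re ((U : Matrix (Fin 3) (Fin 3) K) * mat v *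
      star (U : Matrix (Fin 3) (Fin 3) K) * mat w).trace := by
  rw [← mat_conjAction, re_trace_mat_mul]; ring

theorem conjAction_mem_aut (U : U3 K) : conjAction K U ∈ aut K := by
  have h2 (v : TH K) : inn (conjAction K U v) (conjAction K U v) = inn v v := by
    rw [inn_conjAction, mat_conjAction]
    have (A M : Matrix (Fin 3) (Fin 3) K) (h : star A * A = 1) :
        A * M * star A * (A * M * star A) = A * (M * M * star A) := by
      simp only [mul_assoc]
      rw [← mul_assoc (star A) A, h, one_mul]
    rw [this _ _ (Unitary.coe_star_mul_self U), re_trace_mul_comm, mul_assoc,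
      Unitary.coe_star_mul_self, mul_one, re_trace_mat_mul]
    ring
  refine mem_aut_of (fun v => mat_injective ?_) h2
  rw [mat_conjAction, ← sub_eq_of_eq_add (mat_mul_self v),
    ← sub_eq_of_eq_add (mat_mul_self (conjAction K U v)), h2, mat_conjAction, mul_sub, sub_mul,
    mul_smul_comm, smul_mul_assoc, mul_one, Unitary.mul_star_self_of_mem U.2]
  congr 1
  simp only [mul_assoc]
  rw [← mul_assoc (star (U : Matrix (Fin 3) (Fin 3) K)) (U : Matrix (Fin 3) (Fin 3) K),
    Unitary.coe_star_mul_self, one_mul]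

theorem continuous_inn_conjAction [TopologicalSpace K] [IsTopologicalRing K] [ContinuousStar K]
    (hre : Continuous (re : K → ℝ)) (v w : TH K) :
    Continuous fun U : U3 K => inn (conjAction K U v) w := by
  simp only [inn_conjAction]
  refine continuous_const.mul (hre.comp (Continuous.matrix_trace ?_))
  fun_prop

/-- The unitary permutation matrix inducing `cyc`. -/
theorem conjAction_cyc {U : U3 K}
    (hU : (U : Matrix (Fin 3) (Fin 3) K) = !![0, 0, 1; 1, 0, 0; 0, 1, 0]) :
    conjAction K U = cyc K := by
  have h3 : √3 * √3 = 3 := Real.mul_self_sqrt (by norm_num)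
  refine LinearEquiv.ext fun v => conjAction_eq.2 ?_
  rw [hU, cyc_apply]
  ext i j
  fin_cases i <;> fin_cases j <;> simp [mat_apply]
  all_goals first | module | (match_scalars; grind)

theorem conjAction_rot {U : U3 K} (c s : ℝ) (h : c ^ 2 + s ^ 2 = 1)
    (hU : (U : Matrix (Fin 3) (Fin 3) K) = !![c • 1, -s • 1, 0; s • 1, c • 1, 0; 0, 0, 1]) :
    conjAction K U = rot c s h := by
  have h3 : √3 * √3 = 3 := Real.mul_self_sqrt (by norm_num)
  refine LinearEquiv.ext fun v => conjAction_eq.2 ?_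
  rw [hU, rot_apply]
  have hst := star_eq v.2.2.2.2
  ext i j
  fin_cases i <;> fin_cases j <;> simp [mat_apply, star_rsmul, hst, smul_smul]
  all_goals match_scalars <;> grind

theorem conjAction_torus {U : U3 K} (u : K) (hu : nsq u = 1)
    (hU : (U : Matrix (Fin 3) (Fin 3) K) = !![u, 0, 0; 0, 1, 0; 0, 0, star u]) :
    conjAction K U = torus u hu := by
  have h1 : u * star u = 1 := by rw [mul_star_self_eq, hu, one_smul]
  have h2 : star u * u = 1 := by rw [star_mul_self_eq, hu, one_smul]
  refine LinearEquiv.ext fun v => conjAction_eq.2 ?_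
  rw [hU, torus_apply]
  ext i j
  fin_cases i <;> fin_cases j <;> 
    simp [mat_apply, mul_assoc, h1, h2, mul_smul_comm]

/-- A unitary matrix whose conjugation only applies an algebra homomorphism to the entries is
scalar. -/
theorem eq_scalar_of_conjAction {U : U3 K} {α : K →ₗ[ℝ] K} (hα : IsIsometricHom α)
    (h : ∀ v, conjAction K U v = (v.1, v.2.1, α v.2.2.1, α v.2.2.2.1, α v.2.2.2.2)) :
    ∃ c : K, (U : Matrix (Fin 3) (Fin 3) K) = Matrix.diagonal (fun _ => c) ∧
      ∀ x, α x * c = c * x := by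
  have e (v : TH K) := conjAction_eq.1 (h v)
  have entry (v : TH K) (i j : Fin 3) := congrFun (congrFun (e v) i) j
  set M : Matrix (Fin 3) (Fin 3) K := U.1 with hM
  have h30 := sqrt_three_ne_zero
  have key (m : K) (hm : -(√3 • m) = √3 • m) : m = 0 := by
    rw [neg_eq_iff_add_eq_zero, ← add_smul] at hm
    exact (smul_eq_zero.1 hm).resolve_left (by positivity)
  have hoff (i j : Fin 3) (hij : i ≠ j) : M i j = 0 := by
    have h2 := entry (0, 1, 0, 0, 0) i j
    fin_cases i <;> fin_cases j <;>
      simp [mat_apply, Matrix.mul_apply, Fin.sum_univ_three] at hij h2 ⊢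
    · exact key _ h2
    · exact h2
    · exact key _ h2.symm
    · exact h2
    · exact h2
    · exact (smul_eq_zero.1 h2.symm).resolve_left h30
  have h0 (x : K) : α x * M 1 1 = M 0 0 * x := by
    have := entry (0, 0, 0, 0, x) 0 1
    simpa [mat_apply, Matrix.mul_apply, Fin.sum_univ_three, h30, mul_smul_comm, smul_mul_assoc]
      using this
  have h1 (x : K) : α x * M 2 2 = M 1 1 * x := by
    have := entry (0, 0, x, 0, 0) 1 2
    simpa [mat_apply, Matrix.mul_apply, Fin.sum_univ_three, h30, mul_smul_comm, smul_mul_assoc]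
      using this
  have h01 : M 1 1 = M 0 0 := by simpa [hα.map_one] using h0 1
  have h12 : M 2 2 = M 1 1 := by simpa [hα.map_one] using h1 1
  refine ⟨M 0 0, ?_, fun x => by rw [← h0, h01]⟩
  ext i j
  by_cases hij : i = j
  · subst hij
    rw [Matrix.diagonal_apply_eq]
    fin_cases i
    · rfl
    · exact h01
    · exact h12.trans h01
  · rw [Matrix.diagonal_apply_ne _ hij, hoff i j hij]

end unitary
end TH

open CompAlg TH

/-! ### From `ℝⁿ` to traceless Hermitian matrices -/

section transport

variable {K : Type} [NonAssocRing K] [Module ℝ K] [IsScalarTower ℝ K K]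
    [SMulCommClass ℝ K K] [StarRing K] [CompAlg K]

/-- A linear isomorphism from `ℝⁿ` conjugates `GL(n, ℝ)` to a group of linear automorphisms. -/
def glEquiv {n : ℕ} {V : Type} [AddCommGroup V] [Module ℝ V] (e : (Fin n → ℝ) ≃ₗ[ℝ] V) :
    GL (Fin n) ℝ ≃* (V ≃ₗ[ℝ] V) :=
  (Matrix.GeneralLinearGroup.toLin.trans (LinearMap.GeneralLinearGroup.congrLinearEquiv e)).trans
    (LinearMap.GeneralLinearGroup.generalLinearEquiv ℝ V)

theorem glEquiv_apply {n : ℕ} {V : Type} [AddCommGroup V] [Module ℝ V]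
    (e : (Fin n → ℝ) ≃ₗ[ℝ] V) (h : GL (Fin n) ℝ) (x : Fin n → ℝ) :
    glEquiv e h (e x) = e ((h : Matrix (Fin n) (Fin n) ℝ).mulVec x) := by
  change e (Matrix.toLin' h.1 (e.symm (e x))) = _
  rw [e.symm_apply_apply, Matrix.toLin'_apply]

theorem det_glEquiv {n : ℕ} {V : Type} [AddCommGroup V] [Module ℝ V]
    (e : (Fin n → ℝ) ≃ₗ[ℝ] V) (h : GL (Fin n) ℝ) :
    (LinearEquiv.det (glEquiv e h) : ℝ) = (h : Matrix (Fin n) (Fin n) ℝ).det := by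
  rw [LinearEquiv.coe_det, ← LinearMap.det_toLin', ← LinearMap.det_conj (Matrix.toLin' h.1) e]
  rfl

/-- The `i`-th vector of the standard basis. -/
abbrev stdBasis {n : ℕ} (i : Fin n) : Fin n → ℝ := Pi.single i 1

/-- A trilinear form in coordinates. -/
theorem trilinear_expand {n : ℕ} (f : (Fin n → ℝ) →ₗ[ℝ] TH K) (x y z : Fin n → ℝ) :
    inn (prd (f x) (f y)) (f z) = ∑ I, ∑ J, ∑ L, x I * y J * z L *
      inn (prd (f (stdBasis I)) (f (stdBasis J))) (f (stdBasis L)) := by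
  have e (x : Fin n → ℝ) : f x = ∑ I, x I • f (stdBasis I) := by
    conv_lhs => rw [pi_eq_sum_univ' x]
    simp only [map_sum, map_smul]
  rw [e x, e y, e z]
  simp only [map_sum, LinearMap.sum_apply, map_smul, LinearMap.smul_apply, smul_eq_mul,
    Finset.mul_sum]
  refine (Finset.sum_congr rfl fun _ _ => Finset.sum_comm).trans (Finset.sum_comm.trans ?_)
  refine Finset.sum_congr rfl fun I _ => Finset.sum_comm.trans ?_
  refine Finset.sum_congr rfl fun J _ => Finset.sum_congr rfl fun L _ => ?_
  ring

/-- The trilinear form is symmetric. -/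
theorem inn_prd_perm (m : Fin 3 → TH K) (σ : Equiv.Perm (Fin 3)) :
    inn (prd (m (σ 0)) (m (σ 1))) (m (σ 2)) = inn (prd (m 0) (m 1)) (m 2) := by
  have h01 : σ 0 ≠ σ 1 := σ.injective.ne (by decide)
  have h02 : σ 0 ≠ σ 2 := σ.injective.ne (by decide)
  have h12 : σ 1 ≠ σ 2 := σ.injective.ne (by decide)
  generalize σ 0 = i at *
  generalize σ 1 = j at *
  generalize σ 2 = l at *
  have s1 := inn_prd_right_comm (m 0) (m 1) (m 2)
  have s2 := inn_prd_left_comm (m 0) (m 1) (m 2)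
  have c1 := prd_comm (m 0) (m 1)
  have c2 := prd_comm (m 0) (m 2)
  have c3 := prd_comm (m 1) (m 2)
  fin_cases i <;> fin_cases j <;> fin_cases l <;>
    first
    | exact absurd rfl h01
    | exact absurd rfl h02
    | exact absurd rfl h12
    | rfl
    | exact s1.symm
    | exact s2.symm
    | exact congrArg (fun t => inn t (m 2)) c1.symm
    | exact (congrArg (fun t => inn t (m 1)) c2.symm).trans s1.symm
    | exact (congrArg (fun t => inn t (m 0)) c3.symm).trans s2.symm

/-- A linear isometry from `ℝⁿ` onto the traceless Hermitian matrices over `K` that turns the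
cubic form `½ det` into the given one. -/
structure IsModel (a : Fin 2) {n : ℕ} (e : (Fin n → ℝ) ≃ₗ[ℝ] TH K) : Prop where
  inn_eq : ∀ x y, inn (e x) (e y) = x ⬝ᵥ y
  cub_eq : ∀ x, cub (e x) = cubicForm a n x

namespace IsModel

variable {a : Fin 2} {k : ℕ} {e : (Fin (3 * k + 2) → ℝ) ≃ₗ[ℝ] TH K}

theorem upsilon_eq (he : IsModel a e) (I J L : Fin (3 * k + 2)) : upsilon a k I J L =
    inn (prd (e (stdBasis I)) (e (stdBasis J))) (e (stdBasis L)) := by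
  let T : ContinuousMultilinearMap ℝ (fun _ : Fin 3 => Fin (3 * k + 2) → ℝ) ℝ :=
    { MultilinearMap.mk' (fun m : Fin 3 → Fin (3 * k + 2) → ℝ =>
          inn (prd (e (m 0)) (e (m 1))) (e (m 2)))
        (fun m i x y => by
          obtain rfl | rfl | rfl : i = 0 ∨ i = 1 ∨ i = 2 := by lia
          all_goals simp [Function.update_of_ne])
        (fun m i c x => by
          obtain rfl | rfl | rfl : i = 0 ∨ i = 1 ∨ i = 2 := by lia
          all_goals simp [Function.update_of_ne]) with
      cont := by
        have h := fun m : Fin 3 → Fin (3 * k + 2) → ℝ =>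
          trilinear_expand (e : (Fin (3 * k + 2) → ℝ) →ₗ[ℝ] TH K) (m 0) (m 1) (m 2)
        simp only [LinearEquiv.coe_coe] at h
        simp only [h]
        fun_prop }
  have hT : cubicForm a (3 * k + 2) = fun x => T fun _ => x := by
    funext x
    rw [← he.cub_eq, TH.cub_eq]
    rfl
  rw [upsilon, hT, ContinuousMultilinearMap.iteratedFDeriv_comp_diagonal]
  have hσ (σ : Equiv.Perm (Fin 3)) : (T fun i => (![stdBasis I, stdBasis J, stdBasis L] (σ i))) =
      inn (prd (e (stdBasis I)) (e (stdBasis J))) (e (stdBasis L)) := by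
    exact inn_prd_perm (fun i => e (![stdBasis I, stdBasis J, stdBasis L] i)) σ
  simp only [hσ]
  rw [Finset.sum_const, Finset.card_univ, Fintype.card_perm, Fintype.card_fin]
  norm_num [Nat.factorial]
  ring

theorem inn_stdBasis (he : IsModel a e) (I J : Fin (3 * k + 2)) :
    inn (e (stdBasis I)) (e (stdBasis J)) = if I = J then 1 else 0 := by
  rw [he.inn_eq, single_one_dotProduct, stdBasis, Pi.single_apply]

theorem inn_e_single (he : IsModel a e) (x : Fin (3 * k + 2) → ℝ) (I : Fin (3 * k + 2)) :
    inn (e x) (e (stdBasis I)) = x I := by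
  rw [he.inn_eq, dotProduct_single_one]

/-- Parseval's identity for the images of the standard basis vectors. -/
theorem sum_inn_mul_inn (he : IsModel a e) (v w : TH K) :
    ∑ I, inn v (e (stdBasis I)) * inn w (e (stdBasis I)) = inn v w := by
  obtain ⟨x, rfl⟩ := e.surjective v
  obtain ⟨y, rfl⟩ := e.surjective w
  simp only [he.inn_e_single, he.inn_eq]
  rfl

theorem trace_eq (he : IsModel a e) (f : TH K →ₗ[ℝ] TH K) :
    LinearMap.trace ℝ _ f = ∑ I, inn (f (e (stdBasis I))) (e (stdBasis I)) := by
  let b : Module.Basis (Fin (3 * k + 2)) ℝ (TH K) := (Pi.basisFun ℝ _).map e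
  rw [LinearMap.trace_eq_matrix_trace ℝ b, Matrix.trace]
  refine Finset.sum_congr rfl fun I _ => ?_
  obtain ⟨x, hx⟩ := e.surjective (f (e (stdBasis I)))
  rw [← hx, he.inn_e_single, Matrix.diag_apply, LinearMap.toMatrix_apply]
  have h2 : b I = e (stdBasis I) := by simp [b]
  rw [h2, ← hx]
  simp [b]

theorem cubicForm_eq (he : IsModel a e) (x : Fin (3 * k + 2) → ℝ) :
    cubicForm a (3 * k + 2) x = ∑ I, ∑ J, ∑ L, upsilon a k I J L * x I * x J * x L := by
  have h := trilinear_expand (e : (Fin (3 * k + 2) → ℝ) →ₗ[ℝ] TH K) x x x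
  simp only [LinearEquiv.coe_coe] at h
  rw [← he.cub_eq, TH.cub_eq, h]
  refine Finset.sum_congr rfl fun I _ => Finset.sum_congr rfl fun J _ =>
    Finset.sum_congr rfl fun L _ => ?_
  rw [he.upsilon_eq]
  ring

theorem upsilon_symm (he : IsModel a e) (I J L : Fin (3 * k + 2)) :
    upsilon a k I J L = (1 / 6) * (upsilon a k I J L + upsilon a k J L I
        + upsilon a k L I J + upsilon a k J I L + upsilon a k I L J + upsilon a k L J I) := by
  simp only [he.upsilon_eq]
  have s1 := inn_prd_right_comm (e (stdBasis I)) (e (stdBasis J)) (e (stdBasis L))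
  have s2 := inn_prd_left_comm (e (stdBasis I)) (e (stdBasis J)) (e (stdBasis L))
  rw [prd_comm (e (stdBasis L)) (e (stdBasis I)), prd_comm (e (stdBasis J)) (e (stdBasis I)),
    prd_comm (e (stdBasis L)) (e (stdBasis J)), ← s1, ← s2]
  ring

theorem sum_upsilon_diag [FiniteDimensional ℝ K] (he : IsModel a e) (I : Fin (3 * k + 2)) :
    ∑ J, upsilon a k I J J = 0 := by
  simp only [he.upsilon_eq]
  rw [← he.trace_eq, trace_prd]

theorem upsilon_contraction (he : IsModel a e) (J K L M : Fin (3 * k + 2)) :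
    ∑ I, upsilon a k J K I * upsilon a k L M I + ∑ I, upsilon a k L J I * upsilon a k K M I
          + ∑ I, upsilon a k K L I * upsilon a k J M I
        = (if J = K then 1 else 0) * (if L = M then 1 else 0)
          + (if L = J then 1 else 0) * (if K = M then 1 else 0)
          + (if K = L then 1 else 0) * (if J = M then 1 else 0) := by
  simp only [he.upsilon_eq, he.sum_inn_mul_inn, ← he.inn_stdBasis]
  exact inn_prd_polar _ _ _ _

theorem transform_eq (he : IsModel a e) (h : GL (Fin (3 * k + 2)) ℝ) (I J L : Fin (3 * k + 2)) :
    transform (upsilon a k) h.val I J L =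
      inn (prd (glEquiv e h (e (stdBasis I))) (glEquiv e h (e (stdBasis J))))
        (glEquiv e h (e (stdBasis L))) := by
  have h1 := trilinear_expand (e : (Fin (3 * k + 2) → ℝ) →ₗ[ℝ] TH K)
    (h.val.mulVec (stdBasis I)) (h.val.mulVec (stdBasis J)) (h.val.mulVec (stdBasis L))
  simp only [LinearEquiv.coe_coe] at h1
  simp only [glEquiv_apply]
  rw [h1, transform]
  simp only [Matrix.mulVec_single_one, Matrix.col_apply, he.upsilon_eq]

/-- The stabilizer of the tensor corresponds to the automorphism group of the cubic form. -/
theorem mem_stabilizer_iff [FiniteDimensional ℝ K] (he : IsModel a e)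
    (h : GL (Fin (3 * k + 2)) ℝ) :
    h ∈ tensorStabilizer (upsilon a k) ↔ glEquiv e h ∈ aut K := by
  constructor
  · intro hh
    have hh : transform (upsilon a k) h.val = upsilon a k := hh
    rw [mem_aut]
    intro v
    obtain ⟨x, rfl⟩ := e.surjective v
    have h1 := trilinear_expand ((glEquiv e h : TH K →ₗ[ℝ] TH K) ∘ₗ
      (e : (Fin (3 * k + 2) → ℝ) →ₗ[ℝ] TH K)) x x x
    have h2 := trilinear_expand (e : (Fin (3 * k + 2) → ℝ) →ₗ[ℝ] TH K) x x x
    simp only [LinearEquiv.coe_coe, LinearMap.comp_apply] at h1 h2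
    rw [TH.cub_eq, TH.cub_eq, h1, h2]
    simp only [← he.transform_eq, hh, he.upsilon_eq]
  · intro hh
    change transform (upsilon a k) h.val = upsilon a k
    funext I J L
    rw [he.transform_eq, aut_trilinear hh, he.upsilon_eq]

theorem stabilizer_le_orthogonal [FiniteDimensional ℝ K] (he : IsModel a e) :
    tensorStabilizer (upsilon a k) ≤ orthogonalSubgroup (3 * k + 2) := by
  intro h hh
  have h1 := (he.mem_stabilizer_iff h).1 hh
  change h.val ∈ Matrix.orthogonalGroup _ ℝ
  rw [Matrix.mem_orthogonalGroup_iff']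
  ext I J
  have h2 := aut_inn h1 (e (stdBasis I)) (e (stdBasis J))
  rw [glEquiv_apply, glEquiv_apply, he.inn_eq, he.inn_eq, Matrix.mulVec_single_one,
    Matrix.mulVec_single_one, single_one_dotProduct, stdBasis, Pi.single_apply] at h2
  exact h2.trans Matrix.one_apply.symm

/-- A compact group acting on the traceless Hermitian matrices by automorphisms of the cubic form,
with an image that contains the elementary automorphisms, acts irreducibly on `ℝⁿ`. -/
theorem isIrreducibleImage [FiniteDimensional ℝ K] (he : IsModel a e)
    {G : Type} [Group G] [TopologicalSpace G] (r : G →* (TH K ≃ₗ[ℝ] TH K))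
    (hc : ∀ v w, Continuous fun g => inn (r g v) w) (hr : r.range ≤ aut K)
    (hel : elem K ≤ r.range) {Z : Subgroup G} (hZ : r.ker = Z)
    {H : Subgroup (GL (Fin (3 * k + 2)) ℝ)} (hH : ∀ h, h ∈ H ↔ glEquiv e h ∈ r.range) :
    IsIrreducibleImage G Z H := by
  let ρ : G →* GL (Fin (3 * k + 2)) ℝ := (glEquiv e).symm.toMonoidHom.comp r
  have hρ (g : G) : glEquiv e (ρ g) = r g := (glEquiv e).apply_symm_apply (r g)
  have hap (g : G) (x) : e ((ρ g).val.mulVec x) = r g (e x) := by rw [← hρ, glEquiv_apply]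
  have hent (g : G) (I J) : (ρ g).val I J = inn (r g (e (stdBasis J))) (e (stdBasis I)) := by
    rw [← hap, he.inn_e_single, Matrix.mulVec_single_one, Matrix.col_apply]
  refine ⟨ρ, ?_, ?_, ?_, ?_⟩
  · rw [Units.continuous_iff]
    constructor
    · refine continuous_matrix fun I J => ?_
      simp only [Function.comp_apply, hent]
      exact hc _ _
    · refine continuous_matrix fun I J => ?_
      have h1 (g : G) : ((ρ g)⁻¹).val I J = inn (r g (e (stdBasis I))) (e (stdBasis J)) := by
        rw [← map_inv, hent, ← aut_inn (hr ⟨g, rfl⟩), map_inv, inn_comm]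
        congr 1
        exact LinearEquiv.apply_symm_apply (r g) (e (stdBasis J))
      simp only [h1]
      exact hc _ _
  · have hnt : Nontrivial (Subrepresentation (toRep ρ)) :=
      ⟨⊥, ⊤, fun h => bot_ne_top (α := Submodule ℝ (Fin (3 * k + 2) → ℝ))
        (congrArg Subrepresentation.toSubmodule h)⟩
    refine { hnt with eq_bot_or_eq_top := fun W => ?_ }
    by_cases h0 : W.toSubmodule = ⊥
    · exact Or.inl (Subrepresentation.toSubmodule_injective h0)
    refine Or.inr (Subrepresentation.toSubmodule_injective ?_)
    have h1 : W.toSubmodule.map (e : (Fin (3 * k + 2) → ℝ) →ₗ[ℝ] TH K) = ⊤ := by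
      refine eq_top_of_invariant _ ?_ fun h => h0 ?_
      · rintro φ hφ _ ⟨x, hx, rfl⟩
        obtain ⟨g, rfl⟩ := hel hφ
        exact ⟨_, W.apply_mem_toSubmodule g hx, hap g x⟩
      · exact (Submodule.map_eq_bot_iff (e := e)).1 h
    exact (Submodule.map_eq_top_iff (e := e)).1 h1
  · rw [← hZ]
    ext g
    rw [MonoidHom.mem_ker, MonoidHom.mem_ker, ← hρ, map_eq_one_iff _ (glEquiv e).injective]
  · ext h
    rw [hH]
    constructor
    · rintro ⟨g, rfl⟩
      exact ⟨g, (hρ g).symm⟩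
    · rintro ⟨g, hg⟩
      exact ⟨g, (glEquiv e).injective ((hρ g).trans hg)⟩

end IsModel

end transport

/-! ### The four composition algebras -/

instance : CompAlg ℝ where
  re := LinearMap.id
  re_one := rfl
  star_eq x := by simp; ring
  re_mul_comm x y := mul_comm x y
  re_mul_assoc x y z := mul_assoc x y z
  star_mul_mul x y := by simp; ring
  re_pos x hx := by simpa using mul_self_pos.2 hx

instance : CompAlg ℂ where
  re := Complex.reLm
  re_one := rfl
  star_eq x := by apply Complex.ext <;> simp; ring
  re_mul_comm x y := by rw [mul_comm]
  re_mul_assoc x y z := by rw [mul_assoc]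
  star_mul_mul x y := by apply Complex.ext <;> simp <;> ring
  re_pos x hx := by
    have h := Complex.normSq_pos.2 hx
    rw [Complex.normSq_apply] at h
    simpa using h

instance : CompAlg ℍ[ℝ] where
  re := { toFun := fun x => x.re, map_add' := fun _ _ => rfl, map_smul' := fun _ _ => rfl }
  re_one := rfl
  star_eq x := by
    change star x = (2 * x.re) • (1 : ℍ[ℝ]) - x
    ext <;> simp
    ring
  re_mul_comm x y := by
    change (x * y).re = (y * x).re
    simp only [Quaternion.re_mul]
    ring
  re_mul_assoc x y z := by
    change (x * y * z).re = (x * (y * z)).re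
    rw [mul_assoc]
  star_mul_mul x y := by
    change star x * (x * y) = (star x * x).re • y
    ext <;> simp <;> ring
  re_pos x hx := by
    have h := (Quaternion.normSq_nonneg (a := x)).lt_of_ne' (Quaternion.normSq_ne_zero.2 hx)
    rw [Quaternion.normSq_def'] at h
    change 0 < (star x * x).re
    simp
    nlinarith

namespace Octonion

instance : One Octonion := ⟨ofReal 1⟩

@[simp] theorem re_one : (1 : Octonion).re = 1 := rfl
@[simp] theorem im_one (i : Fin 7) : (1 : Octonion).im i = 0 := rfl

instance : NonAssocRing Octonion where
  one_mul a := by ext i <;> simp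
  mul_one a := by ext i <;> simp

instance : IsScalarTower ℝ Octonion Octonion where
  smul_assoc c a b := by
    ext i
    · simp only [smul_eq_mul, re_mul, re_smul, im_smul, mul_sub, Finset.mul_sum]
      simp only [mul_assoc]
    · simp only [smul_eq_mul, im_mul, re_smul, im_smul]; ring

instance : SMulCommClass ℝ Octonion Octonion where
  smul_comm c a b := by
    ext i
    · simp only [smul_eq_mul, re_mul, re_smul, im_smul, mul_sub, Finset.mul_sum]
      simp only [mul_left_comm]
    · simp only [smul_eq_mul, im_mul, re_smul, im_smul]; ring

instance : FiniteDimensional ℝ Octonion :=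
  inferInstanceAs (FiniteDimensional ℝ (ℝ × (Fin 7 → ℝ)))

theorem finrank_eq : Module.finrank ℝ Octonion = 8 := by
  change Module.finrank ℝ (ℝ × (Fin 7 → ℝ)) = 8
  simp

theorem ofReal_eq (r : ℝ) : ofReal r = r • (1 : Octonion) := by ext i <;> simp

theorem im_mul_zero (a b : Octonion) : (a * b).im 0 = a.re * b.im 0 + b.re * a.im 0
    + (a.im 4 * b.im 5 - a.im 5 * b.im 4)
    + (a.im 1 * b.im 3 - a.im 3 * b.im 1)
    + (a.im 2 * b.im 6 - a.im 6 * b.im 2) := rfl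

theorem im_mul_one (a b : Octonion) : (a * b).im 1 = a.re * b.im 1 + b.re * a.im 1
    + (a.im 5 * b.im 6 - a.im 6 * b.im 5)
    + (a.im 2 * b.im 4 - a.im 4 * b.im 2)
    + (a.im 3 * b.im 0 - a.im 0 * b.im 3) := rfl

theorem im_mul_two (a b : Octonion) : (a * b).im 2 = a.re * b.im 2 + b.re * a.im 2
    + (a.im 6 * b.im 0 - a.im 0 * b.im 6)
    + (a.im 3 * b.im 5 - a.im 5 * b.im 3)
    + (a.im 4 * b.im 1 - a.im 1 * b.im 4) := rfl

theorem im_mul_three (a b : Octonion) : (a * b).im 3 = a.re * b.im 3 + b.re * a.im 3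
    + (a.im 0 * b.im 1 - a.im 1 * b.im 0)
    + (a.im 4 * b.im 6 - a.im 6 * b.im 4)
    + (a.im 5 * b.im 2 - a.im 2 * b.im 5) := rfl

theorem im_mul_four (a b : Octonion) : (a * b).im 4 = a.re * b.im 4 + b.re * a.im 4
    + (a.im 1 * b.im 2 - a.im 2 * b.im 1)
    + (a.im 5 * b.im 0 - a.im 0 * b.im 5)
    + (a.im 6 * b.im 3 - a.im 3 * b.im 6) := rfl

theorem im_mul_five (a b : Octonion) : (a * b).im 5 = a.re * b.im 5 + b.re * a.im 5
    + (a.im 2 * b.im 3 - a.im 3 * b.im 2)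
    + (a.im 6 * b.im 1 - a.im 1 * b.im 6)
    + (a.im 0 * b.im 4 - a.im 4 * b.im 0) := rfl

theorem im_mul_six (a b : Octonion) : (a * b).im 6 = a.re * b.im 6 + b.re * a.im 6
    + (a.im 3 * b.im 4 - a.im 4 * b.im 3)
    + (a.im 0 * b.im 2 - a.im 2 * b.im 0)
    + (a.im 1 * b.im 5 - a.im 5 * b.im 1) := rfl

theorem forall_fin_seven {p : Fin 7 → Prop} :
    (∀ i, p i) ↔ p 0 ∧ p 1 ∧ p 2 ∧ p 3 ∧ p 4 ∧ p 5 ∧ p 6 := by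
  constructor
  · intro h
    exact ⟨h _, h _, h _, h _, h _, h _, h _⟩
  · rintro ⟨h0, h1, h2, h3, h4, h5, h6⟩ i
    fin_cases i <;> assumption

instance : CompAlg Octonion where
  re := { toFun := re, map_add' := fun _ _ => rfl, map_smul' := fun _ _ => rfl }
  re_one := rfl
  star_eq x := by
    change star x = (2 * x.re) • (1 : Octonion) - x
    ext i <;> simp
    ring
  re_mul_comm x y := by
    change (x * y).re = (y * x).re
    simp [mul_comm]
  re_mul_assoc x y z := by
    change (x * y * z).re = (x * (y * z)).re
    simp only [re_mul, Fin.sum_univ_seven, im_mul_zero,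
      im_mul_one, im_mul_two, im_mul_three, im_mul_four, im_mul_five, im_mul_six]
    ring
  star_mul_mul x y := by
    change star x * (x * y) = (star x * x).re • y
    refine ext ?_ (forall_fin_seven.2 ⟨?_, ?_, ?_, ?_, ?_, ?_, ?_⟩) <;>
    · simp only [re_mul, re_smul, im_smul, re_star, im_star,
        Fin.sum_univ_seven, im_mul_zero, im_mul_one, im_mul_two, im_mul_three, im_mul_four,
        im_mul_five, im_mul_six]
      ring
  re_pos x hx := by
    have h : (star x * x).re = x.re ^ 2 + ∑ i, x.im i ^ 2 := by
      simp only [re_mul, re_star, im_star, neg_mul, Finset.sum_neg_distrib]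
      simp only [sub_neg_eq_add, sq]
    change 0 < (star x * x).re
    rw [h]
    by_contra! h0
    have h1 : ∀ i ∈ Finset.univ, 0 ≤ x.im i ^ 2 := fun i _ => sq_nonneg _
    have h2 := Finset.sum_nonneg h1
    have h3 : ∑ i, x.im i ^ 2 = 0 := by nlinarith [sq_nonneg x.re]
    refine hx (ext (by simpa using (by nlinarith [sq_nonneg x.re] : x.re ^ 2 = 0)) fun i => ?_)
    simpa using (Finset.sum_eq_zero_iff_of_nonneg h1).1 h3 i (Finset.mem_univ i)

theorem re_compAlg (x : Octonion) : CompAlg.re x = x.re := rfl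

theorem ip_eq_sum (x y : Octonion) : ip x y = x.re * y.re + ∑ i, x.im i * y.im i := by
  rw [ip_def, re_compAlg]
  simp

end Octonion

/-! ### The cubic forms as determinants -/

section coordinates

variable {n : ℕ}

theorem coord_add (x y : Fin n → ℝ) (I : ℕ) : coord (x + y) I = coord x I + coord y I := by
  unfold coord
  split_ifs <;> simp

theorem coord_smul (c : ℝ) (x : Fin n → ℝ) (I : ℕ) : coord (c • x) I = c * coord x I := by
  unfold coord
  split_ifs <;> simp

theorem coord_of_lt (x : Fin n → ℝ) {I : ℕ} (h : n < I) : coord x I = 0 :=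
  dif_neg fun h' => by lia

/-- The dot product in terms of coordinates numbered from `1`. -/
theorem dotProduct_eq_sum_coord (x y : Fin n → ℝ) :
    x ⬝ᵥ y = ∑ I ∈ Finset.range n, coord x (I + 1) * coord y (I + 1) := by
  rw [Finset.sum_range]
  refine Finset.sum_congr rfl fun i _ => ?_
  have h : 1 ≤ (i : ℕ) + 1 ∧ (i : ℕ) + 1 ≤ n := ⟨by lia, i.2⟩
  rw [coord, coord, dif_pos h, dif_pos h]
  rfl

theorem octX1_add (x y : Fin n → ℝ) : octX1 (x + y) = octX1 x + octX1 y := by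
  refine Octonion.ext (coord_add ..) (Octonion.forall_fin_seven.2 ?_)
  refine ⟨?_, ?_, ?_, ?_, ?_, ?_, ?_⟩ <;> exact coord_add ..

theorem octX2_add (x y : Fin n → ℝ) : octX2 (x + y) = octX2 x + octX2 y := by
  refine Octonion.ext (coord_add ..) (Octonion.forall_fin_seven.2 ?_)
  refine ⟨?_, ?_, ?_, ?_, ?_, ?_, ?_⟩ <;> exact coord_add ..

theorem octX3_add (x y : Fin n → ℝ) : octX3 (x + y) = octX3 x + octX3 y := by
  refine Octonion.ext (coord_add ..) (Octonion.forall_fin_seven.2 ?_)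
  refine ⟨?_, ?_, ?_, ?_, ?_, ?_, ?_⟩ <;> exact coord_add ..

theorem octX1_smul (c : ℝ) (x : Fin n → ℝ) : octX1 (c • x) = c • octX1 x := by
  refine Octonion.ext (coord_smul ..) (Octonion.forall_fin_seven.2 ?_)
  refine ⟨?_, ?_, ?_, ?_, ?_, ?_, ?_⟩ <;> exact coord_smul ..

theorem octX2_smul (c : ℝ) (x : Fin n → ℝ) : octX2 (c • x) = c • octX2 x := by
  refine Octonion.ext (coord_smul ..) (Octonion.forall_fin_seven.2 ?_)
  refine ⟨?_, ?_, ?_, ?_, ?_, ?_, ?_⟩ <;> exact coord_smul ..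

theorem octX3_smul (c : ℝ) (x : Fin n → ℝ) : octX3 (c • x) = c • octX3 x := by
  refine Octonion.ext (coord_smul ..) (Octonion.forall_fin_seven.2 ?_)
  refine ⟨?_, ?_, ?_, ?_, ?_, ?_, ?_⟩ <;> exact coord_smul ..

theorem isHermitian_hermMatrix (x : Fin n → ℝ) : (hermMatrix x).IsHermitian := by
  have h (r : ℝ) : star (Octonion.ofReal r) = Octonion.ofReal r := by ext <;> simp
  ext1 i j
  fin_cases i <;> fin_cases j <;>
    simp [hermMatrix, h, Matrix.conjTranspose_apply]

theorem trace_hermMatrix (x : Fin n → ℝ) : (hermMatrix x).trace = 0 := by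
  rw [Matrix.trace_fin_three]
  ext i
  · simp [hermMatrix]
    ring
  · simp [hermMatrix]

/-- The determinant of a Hermitian matrix is real: the terms with repeated indices are, and the
last two terms are conjugate to each other. -/
theorem det_hermitian_eq {K : Type} [NonAssocRing K] [Module ℝ K] [IsScalarTower ℝ K K]
    [SMulCommClass ℝ K K] [StarRing K] [CompAlg K] (p q : ℝ) (x y z : K) :
    ((p - √3 * q) • (1 : K)) * ((p + √3 * q) • 1) * ((-2 * p) • 1)
      - (√3 • z) * (√3 • star z) * ((-2 * p) • 1)
      - (√3 • y) * ((p + √3 * q) • 1) * (√3 • star y)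
      - ((p - √3 * q) • 1) * (√3 • x) * (√3 • star x)
      + ((√3 • y) * ((√3 • star x) * (√3 • star z)) + ((√3 • z) * (√3 • x)) * (√3 • star y))
      = (2 * cub (p, q, x, star y, z)) • 1 := by
  -- The last two terms of the determinant are conjugate to each other.
  have h1 : y * (star x * star z) = (2 * re (x * star y * z)) • 1 - z * x * star y := by
    rw [← re_mul_rotate, ← star_eq]
    simp only [star_mul, star_star]
  have h3 : √3 * √3 = 3 := Real.mul_self_sqrt (by norm_num)
  simp only [cub, smul_mul_assoc, mul_smul_comm, smul_smul, one_mul, mul_one, mul_star_self_eq, h1,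
    nsq_star]
  match_scalars
  · linear_combination (2 * p * q ^ 2 + 2 * p * nsq z - p * nsq y - p * nsq x
      - √3 * q * nsq y + √3 * q * nsq x + 2 * √3 * re (x * star y * z)) * h3
  · ring

theorem octDet_zero_hermMatrix (x : Fin n → ℝ) : octDet 0 (hermMatrix x) =
    (2 * cub (K := Octonion) (coord x 5, coord x 4, octX1 x, star (octX2 x), octX3 x)) • 1 := by
  rw [← det_hermitian_eq]
  simp only [← Octonion.ofReal_eq]
  rfl

/-- The second determinant is the first one of the conjugate matrix. -/
theorem octDet_one_hermMatrix (x : Fin n → ℝ) : octDet 1 (hermMatrix x) =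
    (2 * cub (K := Octonion) (coord x 5, coord x 4, star (octX1 x), octX2 x, star (octX3 x))) •
      1 := by
  have h := det_hermitian_eq (coord x 5) (coord x 4) (star (octX1 x)) (star (octX2 x))
    (star (octX3 x))
  simp only [star_star] at h
  rw [← h]
  have h1 : octDet 1 (hermMatrix x) =
      ((coord x 5 - √3 * coord x 4) • (1 : Octonion)) * ((coord x 5 + √3 * coord x 4) • 1)
          * ((-2 * coord x 5) • 1)
        - (√3 • octX3 x) * (√3 • star (octX3 x)) * ((-2 * coord x 5) • 1)
        - (√3 • octX2 x) * ((coord x 5 + √3 * coord x 4) • 1) * (√3 • star (octX2 x))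
        - ((coord x 5 - √3 * coord x 4) • 1) * (√3 • octX1 x) * (√3 • star (octX1 x))
        + ((√3 • star (octX2 x)) * ((√3 • octX1 x) * (√3 • octX3 x))
          + ((√3 • star (octX3 x)) * (√3 • star (octX1 x))) * (√3 • octX2 x)) := by
    simp only [← Octonion.ofReal_eq]
    rfl
  rw [h1]
  simp only [smul_mul_assoc, mul_smul_comm, mul_one, one_mul, star_mul_self_eq, mul_star_self_eq]

theorem cubicForm_zero_eq_cub (x : Fin n → ℝ) : cubicForm 0 n x =
    cub (K := Octonion) (coord x 5, coord x 4, octX1 x, star (octX2 x), octX3 x) := by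
  rw [cubicForm, octDet_zero_hermMatrix]
  simp

theorem cubicForm_one_eq_cub (x : Fin n → ℝ) : cubicForm 1 n x =
    cub (K := Octonion) (coord x 5, coord x 4, star (octX1 x), octX2 x, star (octX3 x)) := by
  rw [cubicForm, octDet_one_hermMatrix]
  simp

theorem octDet_hermMatrix (a : Fin 2) (x : Fin n → ℝ) :
    octDet a (hermMatrix x) = Octonion.ofReal (2 * cubicForm a n x) := by
  rw [Octonion.ofReal_eq]
  fin_cases a
  · exact (octDet_zero_hermMatrix x).trans (by rw [← cubicForm_zero_eq_cub]; rfl)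
  · exact (octDet_one_hermMatrix x).trans (by rw [← cubicForm_one_eq_cub]; rfl)

theorem coord_reflection (x : Fin n → ℝ) (I : ℕ) :
    coord ((reflection n).val.mulVec x) I = (if I ≤ 5 then 1 else -1) * coord x I := by
  unfold coord
  split_ifs with h1 h2 h2 <;> simp [reflection, Matrix.mulVec_diagonal] <;> lia

theorem octX1_reflection (x : Fin n → ℝ) :
    octX1 ((reflection n).val.mulVec x) = star (octX1 x) := by
  refine Octonion.ext ?_ (Octonion.forall_fin_seven.2 ?_)
  · simp [octX1, coord_reflection]
  · simp [octX1, coord_reflection]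

theorem octX2_reflection (x : Fin n → ℝ) :
    octX2 ((reflection n).val.mulVec x) = star (octX2 x) := by
  refine Octonion.ext ?_ (Octonion.forall_fin_seven.2 ?_)
  · simp [octX2, coord_reflection]
  · simp [octX2, coord_reflection]

theorem octX3_reflection (x : Fin n → ℝ) :
    octX3 ((reflection n).val.mulVec x) = star (octX3 x) := by
  refine Octonion.ext ?_ (Octonion.forall_fin_seven.2 ?_)
  · simp [octX3, coord_reflection]
  · simp [octX3, coord_reflection]

theorem cubicForm_reflection (x : Fin n → ℝ) :
    cubicForm 0 n ((reflection n).val.mulVec x) = cubicForm 1 n x := by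
  rw [cubicForm_zero_eq_cub, cubicForm_one_eq_cub, octX1_reflection, octX2_reflection,
    octX3_reflection, coord_reflection, coord_reflection, star_star]
  norm_num

theorem sum_coord_mul_coord_eq {k : ℕ} (hk : k = 1 ∨ k = 2 ∨ k = 4 ∨ k = 8)
    (x y : Fin (3 * k + 2) → ℝ) :
    coord x 5 * coord y 5 + coord x 4 * coord y 4 + ip (octX1 x) (octX1 y)
      + ip (octX2 x) (octX2 y) + ip (octX3 x) (octX3 y) = x ⬝ᵥ y := by
  rw [dotProduct_eq_sum_coord]
  simp only [Octonion.ip_eq_sum, Fin.sum_univ_seven, octX1, octX2, octX3, Octonion.re_mk,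
    Octonion.im_mk]
  obtain rfl | rfl | rfl | rfl := hk <;>
    simp [Finset.sum_range_succ, coord_of_lt] <;> ring

end coordinates

section model

variable {K : Type} [NonAssocRing K] [Module ℝ K] [IsScalarTower ℝ K K]
    [SMulCommClass ℝ K K] [StarRing K] [CompAlg K] [FiniteDimensional ℝ K]

/-- An embedding `ι` of `K` into the octonions whose image contains the entries of the generic
matrix gives an identification of `ℝⁿ` with the traceless Hermitian matrices over `K`. -/
theorem exists_isModel_zero {k : ℕ} (hk : k = 1 ∨ k = 2 ∨ k = 4 ∨ k = 8)
    (hK : Module.finrank ℝ K = k) (ι : K →ₗ[ℝ] Octonion) (hmul : ∀ x y, ι (x * y) = ι x * ι y)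
    (hre : ∀ x, re (ι x) = re x) (hone : ι 1 = 1) (π : Octonion →ₗ[ℝ] K)
    (h1 : ∀ x : Fin (3 * k + 2) → ℝ, ι (π (octX1 x)) = octX1 x)
    (h2 : ∀ x : Fin (3 * k + 2) → ℝ, ι (π (octX2 x)) = octX2 x)
    (h3 : ∀ x : Fin (3 * k + 2) → ℝ, ι (π (octX3 x)) = octX3 x) :
    ∃ e : (Fin (3 * k + 2) → ℝ) ≃ₗ[ℝ] TH K, IsModel 0 e := by
  have hstar (x : K) : ι (star x) = star (ι x) := by
    rw [star_eq, star_eq, map_sub, map_smul, hone, hre]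
  have hip (x y : K) : ip (ι x) (ι y) = ip x y := by
    rw [ip_def, ip_def, ← hstar, ← hmul, hre]
  let f : (Fin (3 * k + 2) → ℝ) →ₗ[ℝ] TH K :=
    { toFun := fun x =>
        (coord x 5, coord x 4, π (octX1 x), star (π (octX2 x)), π (octX3 x))
      map_add' := fun x y => by
        simp only [coord_add, octX1_add, octX2_add, octX3_add, map_add, star_add]
        rfl
      map_smul' := fun c x => by
        simp only [coord_smul, octX1_smul, octX2_smul, octX3_smul, map_smul, star_rsmul]
        rfl }
  have hf (x y) : inn (f x) (f y) = x ⬝ᵥ y := by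
    rw [← sum_coord_mul_coord_eq hk]
    simp only [f, LinearMap.coe_mk, AddHom.coe_mk, inn_def, ip_star_star]
    simp only [← hip, h1, h2, h3]
  have hinj : Function.Injective f := by
    rw [injective_iff_map_eq_zero]
    intro x hx
    have h := hf x x
    rw [hx, map_zero] at h
    exact dotProduct_self_eq_zero.1 h.symm
  have hdim : Module.finrank ℝ (Fin (3 * k + 2) → ℝ) = Module.finrank ℝ (TH K) := by
    simp only [Module.finrank_prod, Module.finrank_self, hK, Module.finrank_fin_fun]
    ring
  refine ⟨LinearEquiv.ofInjectiveOfFinrankEq f hinj hdim, hf, fun x => ?_⟩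
  rw [cubicForm_zero_eq_cub]
  have h4 := h2 x
  change cub (f x) = _
  have hnsq (x : K) : nsq (ι x) = nsq x := hip x x
  simp only [f, LinearMap.coe_mk, AddHom.coe_mk, cub]
  simp only [← hnsq, ← hre, hmul, hstar, h1, h2, h3]

variable {k : ℕ} {e : (Fin (3 * k + 2) → ℝ) ≃ₗ[ℝ] TH K}

namespace IsModel

/-- The models of the two forms differ by the reflection. -/
theorem reflection_trans (he : IsModel 0 e) :
    IsModel 1 (e.trans (glEquiv e (reflection (3 * k + 2)))) where
  inn_eq x y := by
    rw [LinearEquiv.trans_apply, LinearEquiv.trans_apply, glEquiv_apply, glEquiv_apply, he.inn_eq]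
    simp only [reflection, Matrix.mulVec_diagonal, dotProduct]
    refine Finset.sum_congr rfl fun i _ => ?_
    split_ifs <;> ring
  cub_eq x := by
    rw [LinearEquiv.trans_apply, glEquiv_apply, he.cub_eq, cubicForm_reflection]

theorem transform_reflection (he : IsModel 0 e) :
    transform (upsilon 0 k) (reflection (3 * k + 2)).val = upsilon 1 k := by
  funext I J L
  rw [he.transform_eq, he.reflection_trans.upsilon_eq]
  rfl

end IsModel

end model

/-! ### The four models -/

theorem exists_isModel_real : ∃ e : (Fin (3 * 1 + 2) → ℝ) ≃ₗ[ℝ] TH ℝ, IsModel 0 e := by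
  have h (c : ℝ) : c • (1 : Octonion) = .mk c ![0, 0, 0, 0, 0, 0, 0] := by
    refine Octonion.ext (by simp) (Octonion.forall_fin_seven.2 (by simp))
  refine exists_isModel_zero (by simp) (by simp) (LinearMap.toSpanSingleton ℝ Octonion 1)
    (fun x y => ?_) (fun x => ?_) (one_smul ℝ _) CompAlg.re (fun x => ?_) (fun x => ?_)
    (fun x => ?_)
  · simp [smul_smul, mul_comm]
  · simp [re_one]; rfl
  all_goals
    rw [LinearMap.toSpanSingleton_apply, h]
    simp only [octX1, octX2, octX3, Octonion.re_compAlg, Octonion.re_mk]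
    simp [coord_of_lt]

theorem exists_isModel_complex : ∃ e : (Fin (3 * 2 + 2) → ℝ) ≃ₗ[ℝ] TH ℂ, IsModel 0 e := by
  let ι : ℂ →ₗ[ℝ] Octonion :=
    { toFun := fun z => .mk z.re ![z.im, 0, 0, 0, 0, 0, 0]
      map_add' := fun x y =>
        Octonion.ext (by simp) (Octonion.forall_fin_seven.2 (by simp))
      map_smul' := fun c x =>
        Octonion.ext (by simp) (Octonion.forall_fin_seven.2 (by simp)) }
  let π : Octonion →ₗ[ℝ] ℂ :=
    { toFun := fun a => ⟨a.re, a.im 0⟩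
      map_add' := fun x y => rfl
      map_smul' := fun c x => by apply Complex.ext <;> simp }
  refine exists_isModel_zero (by simp) Complex.finrank_real_complex ι
    (fun x y => ?_) (fun x => rfl) ?_ π (fun x => ?_) (fun x => ?_) (fun x => ?_)
  · refine Octonion.ext (by simp [ι, Fin.sum_univ_seven]) (Octonion.forall_fin_seven.2 ?_)
    simp only [Octonion.im_mul_zero, Octonion.im_mul_one, Octonion.im_mul_two,
      Octonion.im_mul_three, Octonion.im_mul_four, Octonion.im_mul_five, Octonion.im_mul_six]
    simp [ι]
    ring
  · exact Octonion.ext (by simp [ι]) (Octonion.forall_fin_seven.2 (by simp [ι]))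
  all_goals
    simp [ι, π, octX1, octX2, octX3, coord_of_lt]
    rfl

theorem exists_isModel_quaternion : ∃ e : (Fin (3 * 4 + 2) → ℝ) ≃ₗ[ℝ] TH ℍ[ℝ], IsModel 0 e := by
  -- `e₁, e₂, e₄` satisfy the relations of `i, j, k`.
  let ι : ℍ[ℝ] →ₗ[ℝ] Octonion :=
    { toFun := fun z => .mk z.re ![z.imI, z.imJ, 0, z.imK, 0, 0, 0]
      map_add' := fun x y =>
        Octonion.ext (by simp) (Octonion.forall_fin_seven.2 (by simp))
      map_smul' := fun c x =>
        Octonion.ext (by simp) (Octonion.forall_fin_seven.2 (by simp)) }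
  let π : Octonion →ₗ[ℝ] ℍ[ℝ] :=
    { toFun := fun a => ⟨a.re, a.im 0, a.im 1, a.im 3⟩
      map_add' := fun x y => rfl
      map_smul' := fun c x => rfl }
  refine exists_isModel_zero (by simp) Quaternion.finrank_eq_four ι
    (fun x y => ?_) (fun x => rfl) ?_ π (fun x => ?_) (fun x => ?_) (fun x => ?_)
  · refine Octonion.ext (by simp [ι, Fin.sum_univ_seven]; ring) (Octonion.forall_fin_seven.2 ?_)
    simp only [Octonion.im_mul_zero, Octonion.im_mul_one, Octonion.im_mul_two,
      Octonion.im_mul_three, Octonion.im_mul_four, Octonion.im_mul_five, Octonion.im_mul_six]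
    simp [ι]
    refine ⟨?_, ?_, ?_⟩ <;> ring
  · exact Octonion.ext (by simp [ι]) (Octonion.forall_fin_seven.2 (by simp [ι]))
  all_goals
    simp [ι, π, octX1, octX2, octX3, coord_of_lt]
    rfl

theorem exists_isModel_octonion : ∃ e : (Fin (3 * 8 + 2) → ℝ) ≃ₗ[ℝ] TH Octonion, IsModel 0 e :=
  exists_isModel_zero (by simp) Octonion.finrank_eq LinearMap.id (fun _ _ => rfl) (fun _ => rfl)
    rfl LinearMap.id (fun _ => rfl) (fun _ => rfl) (fun _ => rfl)

/-! ### Automorphisms of the associative composition algebras -/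

namespace TH.IsIsometricHom

theorem eq_id_of_real {α : ℝ →ₗ[ℝ] ℝ} (h : IsIsometricHom α) : α = LinearMap.id := by
  ext
  exact h.map_one

theorem eq_of_complex {α : ℂ →ₗ[ℝ] ℂ} (h : IsIsometricHom α) :
    α = LinearMap.id ∨ α = Complex.conjLIE.toLinearEquiv.toLinearMap := by
  have hI : α Complex.I * α Complex.I = -1 := by
    rw [← h.map_mul, Complex.I_mul_I, map_neg, h.map_one]
  have h1 : (α Complex.I - Complex.I) * (α Complex.I + Complex.I) = 0 := by
    linear_combination hI - Complex.I_mul_I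
  rcases mul_eq_zero.1 h1 with h2 | h2
  · left
    refine Complex.basisOneI.ext fun i => ?_
    fin_cases i
    · simpa using h.map_one
    · simpa using sub_eq_zero.1 h2
  · right
    refine Complex.basisOneI.ext fun i => ?_
    fin_cases i
    · simpa using h.map_one
    · simpa using eq_neg_of_add_eq_zero_left h2

theorem det_conj : LinearMap.det Complex.conjLIE.toLinearEquiv.toLinearMap = -1 :=
  Complex.det_conjLIE

theorem exists_quaternion_units : ∃ i j : ℍ[ℝ], i ≠ 0 ∧ j ≠ 0 ∧ i * i = -1 ∧ j * j = -1 ∧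
    j * i = -(i * j) ∧ ∀ x : ℍ[ℝ], x = x.re • 1 + x.imI • i + x.imJ • j + x.imK • (i * j) := by
  obtain ⟨i, h0, h1, h2, h3⟩ : ∃ i : ℍ[ℝ], i.re = 0 ∧ i.imI = 1 ∧ i.imJ = 0 ∧ i.imK = 0 :=
    ⟨⟨0, 1, 0, 0⟩, rfl, rfl, rfl, rfl⟩
  obtain ⟨j, h4, h5, h6, h7⟩ : ∃ j : ℍ[ℝ], j.re = 0 ∧ j.imI = 0 ∧ j.imJ = 1 ∧ j.imK = 0 :=
    ⟨⟨0, 0, 1, 0⟩, rfl, rfl, rfl, rfl⟩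
  refine ⟨i, j, ?_, ?_, ?_, ?_, ?_, fun x => ?_⟩
  · rintro rfl; simp at h1
  · rintro rfl; simp at h6
  all_goals ext <;> simp [h0, h1, h2, h3, h4, h5, h6, h7]

/-- Automorphisms of the quaternions are inner.  If `a² = i² = -1` then `1 - a i` intertwines left
multiplication by `a` with right multiplication by `i`; this is used for the image of `i`, and then
for the image of `j`. -/
theorem exists_conj_of_quaternion {α : ℍ[ℝ] →ₗ[ℝ] ℍ[ℝ]} (h : IsIsometricHom α) :
    ∃ q : ℍ[ℝ], q ≠ 0 ∧ ∀ x, α x * q = q * x := by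
  obtain ⟨i, j, hi0, hj0, hii, hjj, hji, hx⟩ := exists_quaternion_units
  have haa : α i * α i = -1 := by rw [← h.map_mul, hii, map_neg, h.map_one]
  have hbb : α j * α j = -1 := by rw [← h.map_mul, hjj, map_neg, h.map_one]
  obtain ⟨q, hq0, hq⟩ : ∃ q : ℍ[ℝ], q ≠ 0 ∧ α i * q = q * i := by
    by_cases h0 : 1 - α i * i = 0
    · have h1 : α i = -i := by
        calc α i = -(α i * (i * i)) := by rw [hii]; simp
          _ = -((α i * i) * i) := by rw [mul_assoc]
          _ = -i := by rw [← sub_eq_zero.1 h0, one_mul]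
      exact ⟨j, hj0, by rw [h1, hji, neg_mul]⟩
    · refine ⟨1 - α i * i, h0, ?_⟩
      rw [mul_sub, sub_mul, ← mul_assoc, haa, mul_assoc, hii]
      simp [add_comm]
  obtain ⟨b, hqb⟩ : ∃ b : ℍ[ℝ], α j * q = q * b :=
    ⟨q⁻¹ * α j * q, by rw [mul_assoc, ← mul_assoc q, mul_inv_cancel₀ hq0, one_mul]⟩
  have hb2 : b * b = -1 := by
    apply mul_left_cancel₀ hq0
    rw [← mul_assoc, ← hqb, mul_assoc, ← hqb, ← mul_assoc, hbb]
    simp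
  have hbi : b * i = -(i * b) := by
    apply mul_left_cancel₀ hq0
    rw [← mul_assoc, ← hqb, mul_assoc, ← hq, ← mul_assoc, ← h.map_mul, hji, map_neg, h.map_mul,
      neg_mul, mul_assoc, hqb, ← mul_assoc, hq, mul_neg, mul_assoc]
  obtain ⟨r, hr0, hri, hrj⟩ : ∃ r : ℍ[ℝ], r ≠ 0 ∧ i * r = r * i ∧ b * r = r * j := by
    by_cases h0 : 1 - b * j = 0
    · have h1 : b = -j := by
        calc b = -(b * (j * j)) := by rw [hjj]; simp
          _ = -((b * j) * j) := by rw [mul_assoc]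
          _ = -j := by rw [← sub_eq_zero.1 h0, one_mul]
      exact ⟨i, hi0, rfl, by rw [h1, neg_mul, hji, neg_neg]⟩
    · refine ⟨1 - b * j, h0, ?_, ?_⟩
      · rw [mul_sub, sub_mul, mul_assoc b, hji, mul_neg, ← mul_assoc b, hbi, neg_mul, neg_neg,
          ← mul_assoc, mul_one, one_mul]
      · rw [mul_sub, sub_mul, ← mul_assoc, hb2, mul_assoc, hjj]
        simp [add_comm]
  have h1 : α i * (q * r) = q * r * i := by rw [← mul_assoc, hq, mul_assoc, hri, mul_assoc]
  have h2 : α j * (q * r) = q * r * j := by rw [← mul_assoc, hqb, mul_assoc, hrj, mul_assoc]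
  refine ⟨q * r, mul_ne_zero hq0 hr0, fun x => ?_⟩
  have h3 : α (i * j) * (q * r) = q * r * (i * j) := by
    rw [h.map_mul, mul_assoc, h2, ← mul_assoc, h1, mul_assoc]
  rw [hx x]
  simp only [map_add, map_smul, add_mul, mul_add, smul_mul_assoc, mul_smul_comm, h.map_one, h1, h2,
    h3, one_mul, mul_one]

/-- An inner automorphism preserves the orientation, since left and right multiplications by
conjugate quaternions are conjugate. -/
theorem det_nonneg_of_quaternion {α : ℍ[ℝ] →ₗ[ℝ] ℍ[ℝ]} (h : IsIsometricHom α) :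
    0 ≤ LinearMap.det α := by
  obtain ⟨q, hq0, hq⟩ := h.exists_conj_of_quaternion
  let S : ℍ[ℝ] →ₗ[ℝ] ℍ[ℝ] :=
    { toFun := star, map_add' := star_add, map_smul' := star_rsmul }
  have hS : LinearMap.det S * LinearMap.det S = 1 := by
    rw [← LinearMap.det_comp, ← LinearMap.det_id (M := ℍ[ℝ]) (A := ℝ)]
    congr 1
    exact LinearMap.ext fun x => star_star x
  have h1 : nsq q • α = (LinearMap.mulLeft ℝ q) ∘ₗ (S ∘ₗ (LinearMap.mulLeft ℝ q) ∘ₗ S) := by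
    refine LinearMap.ext fun x => ?_
    change nsq q • α x = q * star (q * star x)
    rw [star_mul, star_star, ← mul_assoc, ← hq, mul_assoc, mul_star_self_eq, mul_smul_comm, mul_one]
  have h2 := congrArg LinearMap.det h1
  rw [LinearMap.det_smul, LinearMap.det_comp, LinearMap.det_comp, LinearMap.det_comp,
    Quaternion.finrank_eq_four] at h2
  have h3 : 0 < nsq q := (nsq_nonneg q).lt_of_ne' (nsq_eq_zero.not.2 hq0)
  refine nonneg_of_mul_nonneg_right (a := nsq q ^ 4) ?_ (by positivity)
  rw [h2]
  calc (0 : ℝ) ≤ LinearMap.det (LinearMap.mulLeft ℝ q) ^ 2 := sq_nonneg _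
    _ = _ := by linear_combination (-(LinearMap.det (LinearMap.mulLeft ℝ q)) ^ 2) * hS

end TH.IsIsometricHom

/-! ### The groups `SO(3)`, `SU(3)` and `Sp(3)` -/

section matrixGroups

variable {K : Type} [Ring K] [Module ℝ K] [IsScalarTower ℝ K K]
    [SMulCommClass ℝ K K] [StarRing K] [CompAlg K]

variable (K) in
/-- The permutation matrix of the cyclic permutation. -/
abbrev cycMatrix : Matrix (Fin 3) (Fin 3) K := !![0, 0, 1; 1, 0, 0; 0, 1, 0]

variable (K) in
/-- The rotation in the first two coordinates. -/
abbrev rotMatrix (c s : ℝ) : Matrix (Fin 3) (Fin 3) K :=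
  !![c • 1, -s • 1, 0; s • 1, c • 1, 0; 0, 0, 1]

/-- The diagonal matrix `diag(u, 1, ū)`. -/
abbrev torusMatrix (u : K) : Matrix (Fin 3) (Fin 3) K := !![u, 0, 0; 0, 1, 0; 0, 0, star u]

theorem cycMatrix_mem : cycMatrix K ∈ unitary (Matrix (Fin 3) (Fin 3) K) := by
  rw [Unitary.mem_iff]
  constructor <;> ext i j <;> fin_cases i <;> fin_cases j <;>
    simp [Matrix.mul_apply, Fin.sum_univ_three, Matrix.star_apply]

theorem rotMatrix_mem (c s : ℝ) (h : c ^ 2 + s ^ 2 = 1) :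
    rotMatrix K c s ∈ unitary (Matrix (Fin 3) (Fin 3) K) := by
  have h1 : (c * c) • (1 : K) + (s * s) • (1 : K) = 1 := by
    rw [← add_smul, ← sq, ← sq, h, one_smul]
  have h2 : (s * s) • (1 : K) + (c * c) • (1 : K) = 1 := by rw [add_comm, h1]
  rw [Unitary.mem_iff]
  constructor <;> ext i j <;> fin_cases i <;> fin_cases j <;>
    simp [Matrix.mul_apply, Fin.sum_univ_three, Matrix.star_apply, star_rsmul, smul_smul, h1, h2,
      mul_comm s c]

theorem torusMatrix_mem (u : K) (hu : nsq u = 1) :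
    torusMatrix u ∈ unitary (Matrix (Fin 3) (Fin 3) K) := by
  have h1 : u * star u = 1 := by rw [mul_star_self_eq, hu, one_smul]
  have h2 : star u * u = 1 := by rw [star_mul_self_eq, hu, one_smul]
  rw [Unitary.mem_iff]
  constructor <;> ext i j <;> fin_cases i <;> fin_cases j <;>
    simp [Matrix.mul_apply, Fin.sum_univ_three, Matrix.star_apply, h1, h2]

variable {G : Type} [Group G] {f : G →* U3 K}

/-- A group of unitary matrices that contains cyclic permutation, rotations and diagonal matrices
`diag(u, 1, ū)` realizes all elementary automorphisms. -/
theorem elem_le_range_conjAction (h1 : ∃ g, (f g).1 = cycMatrix K)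
    (h2 : ∀ c s : ℝ, c ^ 2 + s ^ 2 = 1 → ∃ g, (f g).1 = rotMatrix K c s)
    (h3 : ∀ u : K, nsq u = 1 → ∃ g, (f g).1 = torusMatrix u) :
    elem K ≤ ((conjAction K).comp f).range := by
  refine elem_le ?_ (fun c s h => ?_) (fun u hu => ?_)
  · obtain ⟨g, hg⟩ := h1
    exact ⟨g, conjAction_cyc hg⟩
  · obtain ⟨g, hg⟩ := h2 c s h
    exact ⟨g, conjAction_rot c s h hg⟩
  · obtain ⟨g, hg⟩ := h3 u hu
    exact ⟨g, conjAction_torus u hu hg⟩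

theorem conjAction_range_le_aut : ((conjAction K).comp f).range ≤ aut K := by
  rintro _ ⟨g, rfl⟩
  exact conjAction_mem_aut _

theorem exists_eq_diagonal_of_conjAction_eq_one {U : U3 K} (h : conjAction K U = 1) :
    ∃ c : K, (U : Matrix (Fin 3) (Fin 3) K) = Matrix.diagonal (fun _ => c) ∧
      ∀ x, x * c = c * x :=
  eq_scalar_of_conjAction (α := LinearMap.id) ⟨rfl, fun _ _ => rfl, fun _ => rfl⟩
    fun v => by rw [h]; rfl

theorem conjAction_eq_one_of_eq_diagonal {U : U3 K} {c : K}
    (h : (U : Matrix (Fin 3) (Fin 3) K) = Matrix.diagonal (fun _ => c)) (hc : ∀ x, x * c = c * x) :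
    conjAction K U = 1 := by
  refine LinearEquiv.ext fun v => conjAction_eq.2 ?_
  rw [h]
  ext i j
  rw [Matrix.mul_diagonal, Matrix.diagonal_mul]
  exact hc _

/-- A matrix that commutes with the cyclic permutation and the diagonal matrices `diag(u, 1, ū)`
is a central scalar. -/
theorem eq_diagonal_of_commute {M : Matrix (Fin 3) (Fin 3) K}
    (h1 : M * cycMatrix K = cycMatrix K * M)
    (h2 : ∀ u : K, nsq u = 1 → M * torusMatrix u = torusMatrix u * M) :
    M = Matrix.diagonal (fun _ => M 0 0) ∧ ∀ x, x * M 0 0 = M 0 0 * x := by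
  have h3 : nsq (-1 : K) = 1 := by simp [nsq, re_one]
  have e1 (i j : Fin 3) := congrFun (congrFun h1 i) j
  have e2 (u : K) (hu : nsq u = 1) (i j : Fin 3) := congrFun (congrFun (h2 u hu) i) j
  have key (m : K) (hm : -m = m) : m = 0 := by
    have h4 : (2 : ℝ) • m = 0 := by rw [two_smul, ← neg_eq_iff_add_eq_zero, hm]
    exact (smul_eq_zero.1 h4).resolve_left two_ne_zero
  simp only [Matrix.mul_apply, Fin.sum_univ_three, cycMatrix, torusMatrix] at e1 e2
  have t1 : M 0 1 = 0 := key _ (by simpa using (e2 _ h3 0 1).symm)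
  have t2 : M 1 0 = 0 := key _ (by simpa using e2 _ h3 1 0)
  have a00 : M 0 1 = M 2 0 := by simpa using e1 0 0
  have a01 : M 0 2 = M 2 1 := by simpa using e1 0 1
  have a02 : M 0 0 = M 2 2 := by simpa using e1 0 2
  have a10 : M 1 1 = M 0 0 := by simpa using e1 1 0
  have a11 : M 1 2 = M 0 1 := by simpa using e1 1 1
  have a12 : M 1 0 = M 0 2 := by simpa using e1 1 2
  constructor
  · ext i j
    fin_cases i <;> fin_cases j <;> simp [t1, t2, a10, a11, ← a00, ← a01, ← a02, ← a12]
  · intro x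
    by_cases hx : x = 0
    · rw [hx, zero_mul, mul_zero]
    · obtain ⟨u, hu, hxu⟩ := exists_normalize hx
      have h5 : M 0 0 * u = u * M 0 0 := by simpa using e2 u hu 0 0
      rw [hxu, smul_mul_assoc, mul_smul_comm, h5]

/-- The kernel of the conjugation action is the centre. -/
theorem ker_conjAction_eq_center (hf : Function.Injective f) (h1 : ∃ g, (f g).1 = cycMatrix K)
    (h3 : ∀ u : K, nsq u = 1 → ∃ g, (f g).1 = torusMatrix u) :
    ((conjAction K).comp f).ker = Subgroup.center G := by
  ext g
  rw [MonoidHom.mem_ker, Subgroup.mem_center_iff]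
  constructor
  · intro h g'
    obtain ⟨c, hc, hx⟩ := exists_eq_diagonal_of_conjAction_eq_one h
    refine hf (Subtype.ext ?_)
    rw [map_mul, map_mul, Submonoid.coe_mul, Submonoid.coe_mul, hc]
    ext i j
    rw [Matrix.mul_diagonal, Matrix.diagonal_mul]
    exact hx _
  · intro h
    have h' (g' : G) : (f g).1 * (f g').1 = (f g').1 * (f g).1 := by
      rw [← Submonoid.coe_mul, ← Submonoid.coe_mul, ← map_mul, ← map_mul, h g']
    obtain ⟨e1, e2⟩ := eq_diagonal_of_commute (M := (f g).1)
      (by obtain ⟨g', hg'⟩ := h1; rw [← hg', h'])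
      (fun u hu => by obtain ⟨g', hg'⟩ := h3 u hu; rw [← hg', h'])
    exact conjAction_eq_one_of_eq_diagonal e1 e2

end matrixGroups

section special

variable {K : Type} [CommRing K] [Module ℝ K] [IsScalarTower ℝ K K]
    [SMulCommClass ℝ K K] [StarRing K] [CompAlg K]

variable (K) in
/-- The inclusion of the special unitary group in the unitary group. -/
def specialInclusion : Matrix.specialUnitaryGroup (Fin 3) K →* U3 K :=
  Submonoid.inclusion inf_le_left

theorem specialInclusion_injective : Function.Injective (specialInclusion K) :=
  Submonoid.inclusion_injective _

theorem exists_specialInclusion_eq {M : Matrix (Fin 3) (Fin 3) K}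
    (h : M ∈ unitary (Matrix (Fin 3) (Fin 3) K)) (hM : M.det = 1) :
    ∃ g, (specialInclusion K g).1 = M :=
  ⟨⟨M, Matrix.mem_specialUnitaryGroup_iff.2 ⟨h, hM⟩⟩, rfl⟩

theorem exists_special_cycMatrix : ∃ g, (specialInclusion K g).1 = cycMatrix K :=
  exists_specialInclusion_eq cycMatrix_mem (by simp [cycMatrix, Matrix.det_fin_three])

theorem exists_special_rotMatrix (c s : ℝ) (h : c ^ 2 + s ^ 2 = 1) :
    ∃ g, (specialInclusion K g).1 = rotMatrix K c s :=
  exists_specialInclusion_eq (rotMatrix_mem c s h) (by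
    simp [rotMatrix, Matrix.det_fin_three, smul_smul]
    rw [← add_smul, ← sq, ← sq, h, one_smul])

theorem exists_special_torusMatrix (u : K) (hu : nsq u = 1) :
    ∃ g, (specialInclusion K g).1 = torusMatrix u :=
  exists_specialInclusion_eq (torusMatrix_mem u hu) (by
    simp [torusMatrix, Matrix.det_fin_three, mul_star_self_eq, hu])

variable (K) in
/-- The action of the special unitary group by conjugation. -/
abbrev specialAction : Matrix.specialUnitaryGroup (Fin 3) K →* (TH K ≃ₗ[ℝ] TH K) :=
  (conjAction K).comp (specialInclusion K)

theorem elem_le_specialAction : elem K ≤ (specialAction K).range :=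
  elem_le_range_conjAction exists_special_cycMatrix exists_special_rotMatrix
    exists_special_torusMatrix

theorem ker_specialAction : (specialAction K).ker = Subgroup.center _ :=
  ker_conjAction_eq_center specialInclusion_injective exists_special_cycMatrix
    exists_special_torusMatrix

theorem continuous_specialAction [TopologicalSpace K] [IsTopologicalRing K] [ContinuousStar K]
    (hre : Continuous (re : K → ℝ)) (v w : TH K) :
    Continuous fun U => inn (specialAction K U v) w :=
  (continuous_inn_conjAction hre v w).comp
    (Continuous.subtype_mk continuous_subtype_val _ : Continuous (specialInclusion K))

end special

/-! ### The stabilizers for `k = 1, 2, 4` -/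

theorem aut_real : aut ℝ = elem ℝ := by
  refine le_antisymm (fun φ hφ => ?_) elem_le_aut
  obtain ⟨g, hg, α, hα, h⟩ := exists_normalForm hφ
  have h1 : g * φ = 1 := LinearEquiv.ext fun v => by rw [h, hα.eq_id_of_real]; rfl
  rw [eq_inv_of_mul_eq_one_right h1]
  exact inv_mem hg

theorem ker_specialAction_real : (specialAction ℝ).ker = ⊥ := by
  refine eq_bot_iff.2 fun g hg => ?_
  obtain ⟨c, hc, -⟩ := exists_eq_diagonal_of_conjAction_eq_one hg
  have hc : g.1 = Matrix.diagonal (fun _ => c) := hc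
  have h1 : g.1.det = 1 := (Matrix.mem_specialUnitaryGroup_iff.1 g.2).2
  rw [hc, Matrix.det_diagonal, Finset.prod_const, Finset.card_univ, Fintype.card_fin] at h1
  have h2 : c = 1 := by
    nlinarith [sq_nonneg (c + 1), sq_nonneg (c - 1), sq_nonneg (c ^ 2 - 1)]
  refine Subtype.ext (hc.trans ?_)
  rw [h2]
  exact Matrix.diagonal_one

/-- An automorphism of the quaternions is realized by a scalar matrix. -/
theorem exists_conjAction_eq_of_quaternion {α : ℍ[ℝ] →ₗ[ℝ] ℍ[ℝ]} (hα : IsIsometricHom α) :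
    ∃ U : Sp3, ∀ v, conjAction ℍ[ℝ] U v =
      (v.1, v.2.1, α v.2.2.1, α v.2.2.2.1, α v.2.2.2.2) := by
  obtain ⟨q, hq0, hq⟩ := hα.exists_conj_of_quaternion
  obtain ⟨u, hu, hqu⟩ := exists_normalize hq0
  have hn : √(nsq q) ≠ 0 := by
    rw [Real.sqrt_ne_zero (nsq_nonneg q)]
    exact nsq_eq_zero.not.2 hq0
  have hαu (x : ℍ[ℝ]) : α x * u = u * x := by
    have h := hq x
    rw [hqu, mul_smul_comm, smul_mul_assoc] at h
    exact smul_right_injective _ hn h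
  have h1 : u * star u = 1 := by rw [mul_star_self_eq, hu, one_smul]
  have h2 : star u * u = 1 := by rw [star_mul_self_eq, hu, one_smul]
  have hU : Matrix.diagonal (fun _ => u) ∈ unitary (Matrix (Fin 3) (Fin 3) ℍ[ℝ]) := by
    rw [Unitary.mem_iff, Matrix.star_eq_conjTranspose, Matrix.diagonal_conjTranspose,
      Matrix.diagonal_mul_diagonal, Matrix.diagonal_mul_diagonal, ← Matrix.diagonal_one]
    exact ⟨congrArg _ (funext fun _ => h2), congrArg _ (funext fun _ => h1)⟩
  refine ⟨⟨_, hU⟩, fun v => conjAction_eq.2 ?_⟩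
  rw [mat_apply, mat_apply]
  ext1 i j
  rw [Matrix.mul_diagonal, Matrix.diagonal_mul]
  fin_cases i <;> fin_cases j <;>
    simp only [← hα.map_star] <;> simp [hαu]

theorem elem_le_conjAction_range : elem ℍ[ℝ] ≤ (conjAction ℍ[ℝ]).range :=
  elem_le_range_conjAction (f := MonoidHom.id Sp3) ⟨⟨_, cycMatrix_mem⟩, rfl⟩
    (fun c s h => ⟨⟨_, rotMatrix_mem c s h⟩, rfl⟩) (fun u hu => ⟨⟨_, torusMatrix_mem u hu⟩, rfl⟩)

theorem aut_quaternion : aut ℍ[ℝ] = (conjAction ℍ[ℝ]).range := by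
  refine le_antisymm (fun φ hφ => ?_) (by rintro _ ⟨U, rfl⟩; exact conjAction_mem_aut U)
  obtain ⟨g, hg, α, hα, h⟩ := exists_normalForm hφ
  obtain ⟨U, hU⟩ := exists_conjAction_eq_of_quaternion hα
  have h1 : g * φ = conjAction ℍ[ℝ] U := LinearEquiv.ext fun v => by rw [h, hU]
  rw [eq_inv_mul_of_mul_eq h1]
  exact mul_mem (inv_mem (elem_le_conjAction_range hg)) ⟨U, rfl⟩

theorem ker_conjAction_quaternion : (conjAction ℍ[ℝ]).ker = Subgroup.center Sp3 :=
  ker_conjAction_eq_center (f := MonoidHom.id Sp3) Function.injective_id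
    ⟨⟨_, cycMatrix_mem⟩, rfl⟩ (fun u hu => ⟨⟨_, torusMatrix_mem u hu⟩, rfl⟩)

/-- Complex conjugation is not induced by a unitary matrix, and it reverses the orientation. -/
theorem mem_specialAction_range_iff (φ : TH ℂ ≃ₗ[ℝ] TH ℂ) :
    φ ∈ (specialAction ℂ).range ↔ φ ∈ aut ℂ ∧ (LinearEquiv.det φ : ℝ) = 1 := by
  constructor
  · rintro ⟨U, rfl⟩
    have hφ : specialAction ℂ U ∈ aut ℂ := conjAction_mem_aut _
    obtain ⟨g, hg, α, hα, h⟩ := exists_normalForm hφ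
    refine ⟨hφ, ?_⟩
    obtain ⟨U', rfl⟩ := elem_le_specialAction hg
    rw [← map_mul] at h
    obtain ⟨c, hc, hx⟩ := eq_scalar_of_conjAction hα h
    have hc0 : c ≠ 0 := by
      rintro rfl
      have h1 := Unitary.coe_star_mul_self (specialInclusion ℂ (U' * U))
      rw [hc, Matrix.diagonal_zero, mul_zero] at h1
      exact zero_ne_one h1
    have hid : α = LinearMap.id := LinearMap.ext fun x => mul_right_cancel₀ hc0 (by
      rw [hx, mul_comm]; rfl)
    rw [det_normalForm hg α (by rw [← map_mul]; exact h), hid, LinearMap.det_id, one_pow]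
  · rintro ⟨hφ, hdet⟩
    obtain ⟨g, hg, α, hα, h⟩ := exists_normalForm hφ
    rw [det_normalForm hg α h] at hdet
    rcases hα.eq_of_complex with rfl | rfl
    · have h1 : g * φ = 1 := LinearEquiv.ext fun v => h v
      rw [eq_inv_of_mul_eq_one_right h1]
      exact elem_le_specialAction (inv_mem hg)
    · rw [IsIsometricHom.det_conj] at hdet
      norm_num at hdet

/-! ### Automorphisms of the octonions preserve the orientation -/

namespace CompAlg

variable {K : Type} [NonAssocRing K] [Module ℝ K] [IsScalarTower ℝ K K]
    [SMulCommClass ℝ K K] [StarRing K] [CompAlg K]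

theorem star_mul_mul_of_ip_eq_zero {x y : K} (h : ip x y = 0) (z : K) :
    star x * (y * z) = -(star y * (x * z)) := by
  rw [eq_neg_iff_add_eq_zero, star_mul_mul_add, h]
  simp

theorem mul_star_mul_of_ip_eq_zero {x y : K} (h : ip x y = 0) (z : K) :
    x * (star y * z) = -(y * (star x * z)) := by
  have h' : ip (star x) (star y) = 0 := by rw [ip_star_star, h]
  simpa using star_mul_mul_of_ip_eq_zero h' z

theorem star_mul_of_ip_eq_zero {x y : K} (h : ip x y = 0) :
    star x * y = -(star y * x) := by
  simpa using star_mul_mul_of_ip_eq_zero h 1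

variable (K) in
/-- The real part of an alternating iterated product of eight elements.  It changes its sign when
orthogonal neighbours are exchanged, and it is compatible with automorphisms. -/
def octupleProduct : MultilinearMap ℝ (fun _ : Fin 8 => K) ℝ :=
  MultilinearMap.mk' (fun v =>
      re (star (v 0) * (v 1 * (star (v 2) * (v 3 * (star (v 4) * (v 5 * (star (v 6) * v 7))))))))
    (fun m i x y => by
      obtain rfl | rfl | rfl | rfl | rfl | rfl | rfl | rfl :
        i = 0 ∨ i = 1 ∨ i = 2 ∨ i = 3 ∨ i = 4 ∨ i = 5 ∨ i = 6 ∨ i = 7 := by lia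
      all_goals simp [Function.update_of_ne, add_mul, mul_add])
    (fun m i c x => by
      obtain rfl | rfl | rfl | rfl | rfl | rfl | rfl | rfl :
        i = 0 ∨ i = 1 ∨ i = 2 ∨ i = 3 ∨ i = 4 ∨ i = 5 ∨ i = 6 ∨ i = 7 := by lia
      all_goals simp [Function.update_of_ne, smul_mul_assoc, mul_smul_comm, star_rsmul])

theorem octupleProduct_apply (v : Fin 8 → K) : octupleProduct K v =
    re (star (v 0) * (v 1 * (star (v 2) * (v 3 * (star (v 4) * (v 5 * (star (v 6) * v 7))))))) :=
  rfl

/-- The octuple product is antisymmetric on orthogonal families, as the symmetric group is generated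
by exchanges of neighbours. -/
theorem octupleProduct_perm (σ : Equiv.Perm (Fin 8)) (v : Fin 8 → K)
    (hv : ∀ i j, i ≠ j → ip (v i) (v j) = 0) :
    octupleProduct K (fun i => v (σ i)) = ((Equiv.Perm.sign σ : ℤ) : ℝ) * octupleProduct K v := by
  have hσ : σ ∈ Submonoid.closure (Set.range fun i : Fin 7 ↦ Equiv.swap i.castSucc i.succ) := by
    rw [Equiv.Perm.mclosure_swap_castSucc_succ]
    trivial
  induction hσ using Submonoid.closure_induction generalizing v with
  | one => simp
  | mul σ τ _ _ h1 h2 =>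
    have h3 := h2 (fun i => v (σ i)) fun i j hij => hv _ _ (σ.injective.ne hij)
    rw [h1 v hv] at h3
    rw [Equiv.Perm.sign_mul]
    push_cast
    rw [mul_comm ((Equiv.Perm.sign σ : ℤ) : ℝ), mul_assoc, ← h3]
    rfl
  | mem σ h =>
    obtain ⟨i, rfl⟩ := h
    dsimp only
    rw [Equiv.Perm.sign_swap (Fin.castSucc_lt_succ).ne]
    have h (i j) (hij : i ≠ j := by decide) := hv i j hij
    simp only [octupleProduct_apply]
    obtain rfl | rfl | rfl | rfl | rfl | rfl | rfl :
        i = 0 ∨ i = 1 ∨ i = 2 ∨ i = 3 ∨ i = 4 ∨ i = 5 ∨ i = 6 := by lia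
    · change re (star (v 1) * (v 0 * (star (v 2) * (v 3 * (star (v 4) *
        (v 5 * (star (v 6) * v 7))))))) = _
      rw [star_mul_mul_of_ip_eq_zero (h 1 0)]; simp
    · change re (star (v 0) * (v 2 * (star (v 1) * (v 3 * (star (v 4) *
        (v 5 * (star (v 6) * v 7))))))) = _
      rw [mul_star_mul_of_ip_eq_zero (h 2 1)]; simp
    · change re (star (v 0) * (v 1 * (star (v 3) * (v 2 * (star (v 4) *
        (v 5 * (star (v 6) * v 7))))))) = _
      rw [star_mul_mul_of_ip_eq_zero (h 3 2)]; simp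
    · change re (star (v 0) * (v 1 * (star (v 2) * (v 4 * (star (v 3) *
        (v 5 * (star (v 6) * v 7))))))) = _
      rw [mul_star_mul_of_ip_eq_zero (h 4 3)]; simp
    · change re (star (v 0) * (v 1 * (star (v 2) * (v 3 * (star (v 5) *
        (v 4 * (star (v 6) * v 7))))))) = _
      rw [star_mul_mul_of_ip_eq_zero (h 5 4)]; simp
    · change re (star (v 0) * (v 1 * (star (v 2) * (v 3 * (star (v 4) *
        (v 6 * (star (v 5) * v 7))))))) = _
      rw [mul_star_mul_of_ip_eq_zero (h 6 5)]; simp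
    · change re (star (v 0) * (v 1 * (star (v 2) * (v 3 * (star (v 4) *
        (v 5 * (star (v 7) * v 6))))))) = _
      rw [star_mul_of_ip_eq_zero (h 7 6)]; simp

/-- In dimension eight, an endomorphism that is compatible with the octuple product has determinant
one: the alternatization of the octuple product is a volume form. -/
theorem det_eq_one_of_octupleProduct {α : K →ₗ[ℝ] K} (hK : Module.finrank ℝ K = 8)
    (hα : ∀ v, octupleProduct K (fun i => α (v i)) = octupleProduct K v) (w : Fin 8 → K)
    (hw : ∀ i j, i ≠ j → ip (w i) (w j) = 0) (hw0 : octupleProduct K w ≠ 0) :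
    LinearMap.det α = 1 := by
  let A := MultilinearMap.alternatization (octupleProduct K)
  have hA (v : Fin 8 → K) : A v =
      ∑ σ : Equiv.Perm (Fin 8),
        ((Equiv.Perm.sign σ : ℤ) : ℝ) * octupleProduct K fun i => v (σ i) := by
    rw [MultilinearMap.alternatization_apply]
    refine Finset.sum_congr rfl fun σ _ => ?_
    rw [MultilinearMap.domDomCongr_apply, Units.smul_def, zsmul_eq_mul]
  have hA0 : A w ≠ 0 := by
    have h1 (σ : Equiv.Perm (Fin 8)) : ((Equiv.Perm.sign σ : ℤ) : ℝ) *
        octupleProduct K (fun i => w (σ i)) = octupleProduct K w := by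
      rw [octupleProduct_perm σ w hw, ← mul_assoc, ← Int.cast_mul, ← Units.val_mul,
        Int.units_mul_self]
      simp
    rw [hA]
    simp only [h1]
    rw [Finset.sum_const, Finset.card_univ, nsmul_eq_mul]
    exact mul_ne_zero (by simp [Fintype.card_ne_zero]) hw0
  have hli : LinearIndependent ℝ w := by
    by_contra h
    exact hA0 (A.map_linearDependent w h)
  let b := basisOfLinearIndependentOfCardEqFinrank hli (by rw [hK, Fintype.card_fin])
  have hb : ⇑b = w := coe_basisOfLinearIndependentOfCardEqFinrank ..
  have h2 : A (α ∘ w) = A w := by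
    rw [hA, hA]
    exact Finset.sum_congr rfl fun σ _ => congrArg _ (hα fun i => w (σ i))
  have h3 : A (α ∘ w) = A w * LinearMap.det α := by
    rw [A.eq_smul_basis_det b]
    simp only [AlternatingMap.smul_apply, Module.Basis.det_comp, hb, smul_eq_mul]
    rw [← hb, b.det_self]
    ring
  rw [h2] at h3
  exact (mul_eq_left₀ hA0).1 h3.symm

end CompAlg

namespace Octonion

@[simp] theorem re_neg (a : Octonion) : (-a).re = -a.re := rfl
@[simp] theorem im_neg (a : Octonion) (i : Fin 7) : (-a).im i = -a.im i := rfl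

/-- The imaginary unit `e_{i+1}`. -/
def imUnit (i : Fin 7) : Octonion := mk 0 (Pi.single i 1)

theorem ip_imUnit {i j : Fin 7} (h : i ≠ j) : ip (imUnit i) (imUnit j) = 0 := by
  simp [ip_eq_sum, imUnit, Pi.single_apply, h.symm]

theorem imUnit_mul (i j l : Fin 7) (c : ℝ) (h0 : i ≠ j)
    (h : ∀ m, (imUnit i * imUnit j).im m = c * (imUnit l).im m) :
    imUnit i * imUnit j = c • imUnit l := by
  refine ext ?_ h
  simp [imUnit, Pi.single_apply, h0.symm]

/-- The octuple product of the standard basis does not vanish. -/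
theorem octupleProduct_imUnit :
    octupleProduct Octonion (Fin.cons 1 imUnit) ≠ 0 := by
  have h5 : imUnit 5 * imUnit 6 = (1 : ℝ) • imUnit 1 :=
    imUnit_mul _ _ _ _ (by decide) (forall_fin_seven.2 (by simp [imUnit, -im_mul, im_mul_zero,
      im_mul_one, im_mul_two, im_mul_three, im_mul_four, im_mul_five, im_mul_six]))
  have h4 : imUnit 4 * imUnit 1 = (1 : ℝ) • imUnit 2 :=
    imUnit_mul _ _ _ _ (by decide) (forall_fin_seven.2 (by simp [imUnit, -im_mul, im_mul_zero,
      im_mul_one, im_mul_two, im_mul_three, im_mul_four, im_mul_five, im_mul_six]))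
  have h3 : imUnit 3 * imUnit 2 = (-1 : ℝ) • imUnit 5 :=
    imUnit_mul _ _ _ _ (by decide) (forall_fin_seven.2 (by simp [imUnit, -im_mul, im_mul_zero,
      im_mul_one, im_mul_two, im_mul_three, im_mul_four, im_mul_five, im_mul_six]))
  have h2 : imUnit 2 * imUnit 5 = (-1 : ℝ) • imUnit 3 :=
    imUnit_mul _ _ _ _ (by decide) (forall_fin_seven.2 (by simp [imUnit, -im_mul, im_mul_zero,
      im_mul_one, im_mul_two, im_mul_three, im_mul_four, im_mul_five, im_mul_six]))
  have h1 : imUnit 1 * imUnit 3 = (1 : ℝ) • imUnit 0 :=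
    imUnit_mul _ _ _ _ (by decide) (forall_fin_seven.2 (by simp [imUnit, -im_mul, im_mul_zero,
      im_mul_one, im_mul_two, im_mul_three, im_mul_four, im_mul_five, im_mul_six]))
  have hs (i : Fin 7) : star (imUnit i) = -imUnit i := by
    rw [star_eq]
    simp [re_compAlg, imUnit]
  have h0 : imUnit 0 * imUnit 0 = (-1 : ℝ) • 1 := by
    refine ext (by simp [imUnit, Pi.single_apply]) (forall_fin_seven.2 ?_)
    simp [imUnit, -im_mul, im_mul_zero, im_mul_one, im_mul_two, im_mul_three, im_mul_four,
      im_mul_five, im_mul_six]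
  have e (i : Fin 7) (j : Fin 8) (h : j = i.succ) :
      (Fin.cons 1 imUnit : Fin 8 → Octonion) j = imUnit i := by subst h; rfl
  have e0 : (Fin.cons 1 imUnit : Fin 8 → Octonion) 0 = 1 := rfl
  rw [octupleProduct_apply, e0, e 0 1 rfl, e 1 2 rfl, e 2 3 rfl, e 3 4 rfl, e 4 5 rfl, e 5 6 rfl,
    e 6 7 rfl]
  simp only [hs, h1, h2, h3, h4, h5, h0, star_one, one_mul, neg_mul, mul_neg, mul_smul_comm,
    map_neg, map_smul]
  simp [CompAlg.re_one]

theorem det_eq_one {α : Octonion →ₗ[ℝ] Octonion} (hα : IsIsometricHom α) :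
    LinearMap.det α = 1 := by
  refine det_eq_one_of_octupleProduct finrank_eq (fun v => ?_) _ (fun i j => ?_)
    octupleProduct_imUnit
  · simp only [octupleProduct_apply, ← hα.map_mul, ← hα.map_star, hα.map_re]
  · refine Fin.cases ?_ (fun i => ?_) i <;> refine Fin.cases ?_ (fun j => ?_) j
    · simp
    · intro _
      simp [re_compAlg, imUnit]
    · intro _
      simp [re_compAlg, imUnit]
    · intro h
      simpa using ip_imUnit fun h' => h (congrArg Fin.succ h')

end Octonion

/-! ### The group `F₄` -/

namespace Octonion

instance : IsTopologicalAddGroup Octonion :=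
  inferInstanceAs (IsTopologicalAddGroup (ℝ × (Fin 7 → ℝ)))
instance : ContinuousSMul ℝ Octonion := inferInstanceAs (ContinuousSMul ℝ (ℝ × (Fin 7 → ℝ)))
instance : T2Space Octonion := inferInstanceAs (T2Space (ℝ × (Fin 7 → ℝ)))

end Octonion

namespace Albert

/-- The unit of the exceptional Jordan algebra. -/
def unit : Albert := ⟨1, star_one _⟩

/-- The inclusion of the traceless matrices in the exceptional Jordan algebra. -/
def ofTH : TH Octonion →ₗ[ℝ] Albert := mat.codRestrict _ star_mat

/-- The trace on the exceptional Jordan algebra. -/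
def tr : Albert →ₗ[ℝ] ℝ :=
  re ∘ₗ Matrix.traceLinearMap (Fin 3) ℝ Octonion ∘ₗ Submodule.subtype _

theorem coe_ofTH (v : TH Octonion) : (ofTH v : Matrix (Fin 3) (Fin 3) Octonion) = mat v := rfl

theorem coe_jordan (A B : Albert) : (A.jordan B : Matrix (Fin 3) (Fin 3) Octonion) =
    (1 / 2 : ℝ) • ((A : Matrix (Fin 3) (Fin 3) Octonion) * B + B * A) := rfl

theorem ofTH_injective : Function.Injective ofTH := fun _ _ h =>
  mat_injective (congrArg Subtype.val h)

theorem tr_unit : tr unit = 3 := by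
  change re (Matrix.trace (1 : Matrix (Fin 3) (Fin 3) Octonion)) = 3
  rw [Matrix.trace_fin_three]
  simp [re_one]
  norm_num

theorem tr_ofTH (v : TH Octonion) : tr (ofTH v) = 0 := by
  change re (Matrix.trace (mat v)) = 0
  rw [mat_apply, Matrix.trace_fin_three]
  simp [re_one]
  ring

theorem exists_eq (A : Albert) : ∃ v, A = (tr A / 3) • unit + ofTH v := by
  have h : tr (A - (tr A / 3) • unit) = 0 := by
    rw [map_sub, map_smul, tr_unit, smul_eq_mul]
    ring
  refine ⟨read (A - (tr A / 3) • unit : Albert).1, ?_⟩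
  have h2 : ofTH (read (A - (tr A / 3) • unit : Albert).1) = A - (tr A / 3) • unit :=
    Subtype.ext (mat_read (A - (tr A / 3) • unit : Albert).2 h)
  rw [h2]
  abel

theorem exists_ofTH_of_tr {A : Albert} (h : tr A = 0) : ofTH (read A.1) = A :=
  Subtype.ext (mat_read A.2 h)

theorem jordan_ofTH (v w : TH Octonion) :
    (ofTH v).jordan (ofTH w) = ofTH (prd v w) + (2 * inn v w) • unit := by
  refine Subtype.ext ?_
  rw [coe_jordan, coe_ofTH, coe_ofTH, mat_mul_add, smul_add, smul_smul, smul_smul]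
  change _ = mat (prd v w) + (2 * inn v w) • 1
  norm_num
  congr 1
  ring

/-- The Jordan product as a bilinear map. -/
def mulLin : Albert →ₗ[ℝ] Albert →ₗ[ℝ] Albert :=
  LinearMap.mk₂ ℝ jordan
    (fun A B C => Subtype.ext (by
      change (1 / 2 : ℝ) • ((A.1 + B.1) * C.1 + C.1 * (A.1 + B.1)) =
        (1 / 2 : ℝ) • (A.1 * C.1 + C.1 * A.1) + (1 / 2 : ℝ) • (B.1 * C.1 + C.1 * B.1)
      rw [add_mul, mul_add]; module))
    (fun c A B => Subtype.ext (by
      change (1 / 2 : ℝ) • ((c • A.1) * B.1 + B.1 * (c • A.1)) =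
        c • (1 / 2 : ℝ) • (A.1 * B.1 + B.1 * A.1)
      rw [smul_mul_assoc, mul_smul_comm]; module))
    (fun A B C => Subtype.ext (by
      change (1 / 2 : ℝ) • (A.1 * (B.1 + C.1) + (B.1 + C.1) * A.1) =
        (1 / 2 : ℝ) • (A.1 * B.1 + B.1 * A.1) + (1 / 2 : ℝ) • (A.1 * C.1 + C.1 * A.1)
      rw [add_mul, mul_add]; module))
    (fun c A B => Subtype.ext (by
      change (1 / 2 : ℝ) • (A.1 * (c • B.1) + (c • B.1) * A.1) =
        c • (1 / 2 : ℝ) • (A.1 * B.1 + B.1 * A.1)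
      rw [smul_mul_assoc, mul_smul_comm]; module))

theorem mulLin_apply (A B : Albert) : mulLin A B = A.jordan B := rfl

theorem mulLin_unit : mulLin unit = LinearMap.id := by
  refine LinearMap.ext fun A => Subtype.ext ?_
  change (1 / 2 : ℝ) • (1 * A.1 + A.1 * 1) = A.1
  rw [one_mul, mul_one]
  module

theorem mulLin_comm (A B : Albert) : mulLin A B = mulLin B A :=
  Subtype.ext (congrArg ((1 / 2 : ℝ) • ·) (add_comm (A.1 * B.1) (B.1 * A.1)))

theorem mulLin_ofTH (v w : TH Octonion) :
    mulLin (ofTH v) (ofTH w) = ofTH (prd v w) + (2 * inn v w) • unit := jordan_ofTH v w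

/-- The decomposition of the exceptional Jordan algebra into scalars and traceless matrices. -/
def equivProd : (ℝ × TH Octonion) ≃ₗ[ℝ] Albert :=
  LinearEquiv.ofBijective (LinearMap.coprod (LinearMap.toSpanSingleton ℝ Albert unit) ofTH) (by
    constructor
    · rw [injective_iff_map_eq_zero]
      rintro ⟨t, v⟩ h
      have h : t • unit + ofTH v = 0 := h
      have h1 := congrArg tr h
      rw [map_add, map_smul, tr_unit, tr_ofTH, map_zero, smul_eq_mul] at h1
      have ht : t = 0 := by linarith
      rw [ht, zero_smul, zero_add] at h
      rw [ht, ofTH_injective (h.trans (map_zero ofTH).symm)]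
      rfl
    · intro A
      obtain ⟨v, hv⟩ := exists_eq A
      exact ⟨(tr A / 3, v), hv.symm⟩)

theorem equivProd_apply (t : ℝ) (v : TH Octonion) : equivProd (t, v) = t • unit + ofTH v := rfl

/-- The extension of a linear automorphism of the traceless matrices that fixes the unit. -/
def extend (ψ : TH Octonion ≃ₗ[ℝ] TH Octonion) : Albert ≃ₗ[ℝ] Albert :=
  (equivProd.symm.trans ((LinearEquiv.refl ℝ ℝ).prodCongr ψ)).trans equivProd

theorem extend_apply (ψ : TH Octonion ≃ₗ[ℝ] TH Octonion) (t : ℝ) (v : TH Octonion) :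
    extend ψ (t • unit + ofTH v) = t • unit + ofTH (ψ v) := by
  rw [← equivProd_apply, ← equivProd_apply]
  simp [extend]

theorem extend_mem {ψ : TH Octonion ≃ₗ[ℝ] TH Octonion} (hψ : ψ ∈ aut Octonion) :
    extend ψ ∈ F4 := by
  intro A B
  obtain ⟨v, hv⟩ := exists_eq A
  obtain ⟨w, hw⟩ := exists_eq B
  have key (s t : ℝ) (v w : TH Octonion) : mulLin (s • unit + ofTH v) (t • unit + ofTH w) =
      (s * t + 2 * inn v w) • unit + ofTH (s • w + t • v + prd v w) := by
    simp only [map_add, map_smul, LinearMap.add_apply, LinearMap.smul_apply, mulLin_unit,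
      LinearMap.id_apply, mulLin_comm _ unit, mulLin_ofTH]
    module
  rw [hv, hw, extend_apply, extend_apply, ← mulLin_apply, ← mulLin_apply, key, key, extend_apply,
    aut_inn hψ, map_add ψ, map_add ψ, map_smul, map_smul, aut_prd hψ]

theorem extend_ofTH (ψ : TH Octonion ≃ₗ[ℝ] TH Octonion) (v : TH Octonion) :
    extend ψ (ofTH v) = ofTH (ψ v) := by
  simpa using extend_apply ψ 0 v

end Albert

namespace F4

open Albert

theorem map_mulLin {φ : Albert ≃ₗ[ℝ] Albert} (hφ : φ ∈ F4) (A B : Albert) :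
    φ (mulLin A B) = mulLin (φ A) (φ B) := hφ A B

theorem map_unit {φ : Albert ≃ₗ[ℝ] Albert} (hφ : φ ∈ F4) : φ unit = unit := by
  have h := map_mulLin hφ unit (φ.symm unit)
  rw [φ.apply_symm_apply, mulLin_unit, mulLin_comm, mulLin_unit] at h
  simpa using h.symm

theorem trace_mulLin {φ : Albert ≃ₗ[ℝ] Albert} (hφ : φ ∈ F4) (A : Albert) :
    LinearMap.trace ℝ Albert (mulLin (φ A)) = LinearMap.trace ℝ Albert (mulLin A) := by
  rw [← LinearMap.trace_conj' (mulLin A) φ]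
  congr 1
  refine LinearMap.ext fun B => ?_
  rw [LinearEquiv.conj_apply_apply, map_mulLin hφ, φ.apply_symm_apply]

/-- The trace of the multiplication operators is proportional to the trace: its restriction to the
traceless matrices is an invariant linear form. -/
theorem trace_mulLin_eq (A : Albert) : LinearMap.trace ℝ Albert (mulLin A) =
    (tr A / 3) * Module.finrank ℝ Albert := by
  have h0 : LinearMap.trace ℝ Albert ∘ₗ mulLin ∘ₗ ofTH = 0 := by
    refine eq_zero_of_invariant _ fun ψ hψ v => ?_
    simp only [LinearMap.comp_apply]
    rw [← extend_ofTH, trace_mulLin (extend_mem (elem_le_aut hψ))]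
  obtain ⟨v, hv⟩ := exists_eq A
  have h1 : LinearMap.trace ℝ Albert (mulLin (ofTH v)) = 0 := LinearMap.congr_fun h0 v
  conv_lhs => rw [hv]
  rw [map_add, map_add, h1, map_smul, map_smul, mulLin_unit, LinearMap.trace_id, add_zero,
    smul_eq_mul]

theorem map_tr {φ : Albert ≃ₗ[ℝ] Albert} (hφ : φ ∈ F4) (A : Albert) : tr (φ A) = tr A := by
  have h := trace_mulLin hφ A
  have hne : (Module.finrank ℝ Albert : ℝ) ≠ 0 := by
    have hnt : Nontrivial Albert := ⟨unit, 0, fun h => by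
      have := congrArg tr h
      rw [tr_unit, map_zero] at this
      norm_num at this⟩
    exact_mod_cast Module.finrank_pos.ne'
  rw [trace_mulLin_eq, trace_mulLin_eq] at h
  have := mul_right_cancel₀ hne h
  linarith

/-- The action of `F₄` on traceless matrices. -/
def action : F4 →* (TH Octonion ≃ₗ[ℝ] TH Octonion) where
  toFun φ :=
    { toFun := fun v => TH.read (φ.1 (ofTH v)).1
      invFun := fun v => TH.read (φ.1.symm (ofTH v)).1
      map_add' := fun v w => by rw [map_add, map_add]; exact map_add TH.read _ _
      map_smul' := fun c v => by rw [map_smul, map_smul]; exact map_smul TH.read _ _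
      left_inv := fun v => by
        dsimp only
        rw [exists_ofTH_of_tr (by rw [map_tr φ.2, tr_ofTH]), φ.1.symm_apply_apply]
        exact read_mat v
      right_inv := fun v => by
        dsimp only
        rw [exists_ofTH_of_tr (by
          rw [← map_tr φ.2, φ.1.apply_symm_apply, tr_ofTH]), φ.1.apply_symm_apply]
        exact read_mat v }
  map_one' := LinearEquiv.ext fun v => read_mat v
  map_mul' φ ψ := LinearEquiv.ext fun v => by
    change TH.read (φ.1 (ψ.1 (ofTH v))).1 = TH.read (φ.1 (ofTH (TH.read (ψ.1 (ofTH v)).1))).1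
    rw [exists_ofTH_of_tr (by rw [map_tr ψ.2, tr_ofTH])]

theorem ofTH_action (φ : F4) (v : TH Octonion) : ofTH (action φ v) = φ.1 (ofTH v) :=
  exists_ofTH_of_tr (by rw [map_tr φ.2, tr_ofTH])

theorem range_action : action.range = aut Octonion := by
  ext ψ
  constructor
  · rintro ⟨φ, rfl⟩
    have h (v w : TH Octonion) : ofTH (action φ (prd v w)) + (2 * inn v w) • unit =
        ofTH (prd (action φ v) (action φ w)) + (2 * inn (action φ v) (action φ w)) • unit := by
      rw [← mulLin_ofTH, ofTH_action, ofTH_action, ofTH_action, ← map_mulLin φ.2, mulLin_ofTH,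
        map_add, map_smul, map_unit φ.2]
    have hinn (v w : TH Octonion) : inn (action φ v) (action φ w) = inn v w := by
      have h1 := congrArg tr (h v w)
      simp only [map_add, map_smul, tr_ofTH, tr_unit, smul_eq_mul] at h1
      linarith
    have hprd (v w : TH Octonion) : action φ (prd v w) = prd (action φ v) (action φ w) := by
      have h1 := h v w
      rw [hinn] at h1
      exact ofTH_injective (add_right_cancel h1)
    rw [mem_aut]
    intro v
    rw [TH.cub_eq, TH.cub_eq, ← hprd, hinn]
  · intro hψ
    refine ⟨⟨_, extend_mem hψ⟩, LinearEquiv.ext fun v => ofTH_injective ?_⟩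
    rw [ofTH_action, extend_ofTH]

theorem ker_action : action.ker = ⊥ := by
  refine eq_bot_iff.2 fun φ hφ => ?_
  have hφ : action φ = 1 := hφ
  refine Subtype.ext (LinearEquiv.ext fun A => ?_)
  obtain ⟨v, hv⟩ := exists_eq A
  rw [hv, map_add, map_smul, map_unit φ.2, ← ofTH_action, hφ]
  rfl

theorem continuous_inn_action (v w : TH Octonion) :
    Continuous fun φ : F4 => inn (action φ v) w := by
  have h1 : Continuous fun M : Matrix (Fin 3) (Fin 3) Octonion => inn (TH.read M) w :=
    LinearMap.continuous_of_finiteDimensional ((inn.flip w) ∘ₗ TH.read)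
  have h2 : Continuous fun φ : F4 => φ.1 (ofTH v) :=
    (continuous_apply (ofTH v)).comp continuous_induced_dom
  exact h1.comp (continuous_subtype_val.comp h2)

theorem elem_le_range_action : elem Octonion ≤ action.range := by
  rw [range_action]
  exact elem_le_aut

end F4

/-! ### The stabilizers and the comparison of the two tensors -/

theorem det_aut_octonion {φ : TH Octonion ≃ₗ[ℝ] TH Octonion} (hφ : φ ∈ aut Octonion) :
    (LinearEquiv.det φ : ℝ) = 1 := by
  obtain ⟨g, hg, α, hα, h⟩ := exists_normalForm hφ
  rw [det_normalForm hg α h, Octonion.det_eq_one hα, one_pow]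

theorem det_aut_real {φ : TH ℝ ≃ₗ[ℝ] TH ℝ} (hφ : φ ∈ aut ℝ) : (LinearEquiv.det φ : ℝ) = 1 := by
  rw [aut_real] at hφ
  rw [det_elem hφ]
  rfl

theorem mem_specialOrthogonalSubgroup_iff {n : ℕ} {h : GL (Fin n) ℝ} :
    h ∈ specialOrthogonalSubgroup n ↔ h ∈ orthogonalSubgroup n ∧ h.val.det = 1 := by
  rw [specialOrthogonalSubgroup, Subgroup.mem_inf, MonoidHom.mem_ker, Units.ext_iff]
  rfl

theorem det_sq_eq_one_of_mem {n : ℕ} {h : GL (Fin n) ℝ} (hh : h ∈ orthogonalSubgroup n) :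
    h.val.det ^ 2 = 1 := by
  have h1 := congrArg Matrix.det ((Matrix.mem_orthogonalGroup_iff _ _).1 hh)
  rw [Matrix.det_mul, Matrix.det_transpose, Matrix.det_one] at h1
  rw [sq, h1]

theorem reflection_mul_reflection (n : ℕ) : reflection n * reflection n = 1 :=
  mul_inv_cancel (reflection n)

theorem reflection_mem_orthogonalSubgroup (n : ℕ) : reflection n ∈ orthogonalSubgroup n := by
  change (reflection n).val ∈ Matrix.orthogonalGroup (Fin n) ℝ
  rw [Matrix.mem_orthogonalGroup_iff]
  have h : (reflection n).val.transpose = (reflection n).val := Matrix.diagonal_transpose _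
  rw [h]
  exact congrArg Units.val (reflection_mul_reflection n)

theorem det_reflection {k : ℕ} (hk : k = 2 ∨ k = 4 ∨ k = 8) :
    (reflection (3 * k + 2)).val.det = -1 := by
  simp only [reflection, Matrix.det_diagonal]
  rw [Fin.prod_univ_eq_prod_range (fun i => if i < 5 then (1 : ℝ) else -1)]
  obtain rfl | rfl | rfl := hk <;> norm_num [Finset.prod_range_succ]

/-- For `k = 1, 2` the entries of the generic matrix commute. -/
theorem upsilon_zero_eq_one {k : ℕ} (hk : k = 1 ∨ k = 2) : upsilon 0 k = upsilon 1 k := by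
  have h : cubicForm 0 (3 * k + 2) = cubicForm 1 (3 * k + 2) := by
    funext x
    rw [cubicForm_zero_eq_cub, cubicForm_one_eq_cub]
    simp only [cub, nsq_star]
    congr 2
    simp only [Octonion.re_compAlg, Octonion.re_mul, Fin.sum_univ_seven, Octonion.im_mul_zero,
      Octonion.im_mul_one, Octonion.im_mul_two, Octonion.im_mul_three, Octonion.im_mul_four,
      Octonion.im_mul_five, Octonion.im_mul_six, Octonion.re_star, Octonion.im_star]
    obtain rfl | rfl := hk
    · simp [octX1, octX2, octX3, coord_of_lt]
    · simp [octX1, octX2, octX3, coord_of_lt]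
      ring
  funext I J L
  rw [upsilon, upsilon, h]

section general

variable {K : Type} [NonAssocRing K] [Module ℝ K] [IsScalarTower ℝ K K]
    [SMulCommClass ℝ K K] [StarRing K] [CompAlg K] [FiniteDimensional ℝ K]
    {a : Fin 2} {k : ℕ} {e : (Fin (3 * k + 2) → ℝ) ≃ₗ[ℝ] TH K}

namespace IsModel

theorem exists_of_zero (h : ∃ e : (Fin (3 * k + 2) → ℝ) ≃ₗ[ℝ] TH K, IsModel 0 e) (a : Fin 2) :
    ∃ e : (Fin (3 * k + 2) → ℝ) ≃ₗ[ℝ] TH K, IsModel a e := by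
  obtain ⟨e, he⟩ := h
  fin_cases a
  exacts [⟨e, he⟩, ⟨_, he.reflection_trans⟩]

theorem stabilizer_le_special (he : IsModel a e)
    (hK : ∀ φ ∈ aut K, (LinearEquiv.det φ : ℝ) = 1) :
    tensorStabilizer (upsilon a k) ≤ specialOrthogonalSubgroup (3 * k + 2) := fun h hh =>
  mem_specialOrthogonalSubgroup_iff.2 ⟨he.stabilizer_le_orthogonal hh, by
    rw [← det_glEquiv e, hK _ ((he.mem_stabilizer_iff h).1 hh)]⟩

/-- The properties of the tensor that hold uniformly in `k`. -/
theorem tensor_properties (he : IsModel a e)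
    (hK : k ≠ 2 → ∀ φ ∈ aut K, (LinearEquiv.det φ : ℝ) = 1) :
    (∀ x : Fin (3 * k + 2) → ℝ,
        (hermMatrix x).IsHermitian ∧ (hermMatrix x).trace = 0 ∧
        octDet a (hermMatrix x) =
          Octonion.ofReal (2 * ∑ I, ∑ J, ∑ K, upsilon a k I J K * x I * x J * x K)) ∧
      (∀ I J K, upsilon a k I J K = (1 / 6) * (upsilon a k I J K + upsilon a k J K I
        + upsilon a k K I J + upsilon a k J I K + upsilon a k I K J + upsilon a k K J I)) ∧
      (∀ I, ∑ J, upsilon a k I J J = 0) ∧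
      (∀ J K L M,
        ∑ I, upsilon a k J K I * upsilon a k L M I + ∑ I, upsilon a k L J I * upsilon a k K M I
          + ∑ I, upsilon a k K L I * upsilon a k J M I
        = (if J = K then 1 else 0) * (if L = M then 1 else 0)
          + (if L = J then 1 else 0) * (if K = M then 1 else 0)
          + (if K = L then 1 else 0) * (if J = M then 1 else 0)) ∧
      tensorStabilizer (upsilon a k) ≤ orthogonalSubgroup (3 * k + 2) ∧
      (k ≠ 2 → tensorStabilizer (upsilon a k) ≤ specialOrthogonalSubgroup (3 * k + 2)) :=
  ⟨fun x => ⟨isHermitian_hermMatrix x, trace_hermMatrix x, by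
      rw [octDet_hermMatrix, he.cubicForm_eq]⟩,
    he.upsilon_symm, he.sum_upsilon_diag, he.upsilon_contraction, he.stabilizer_le_orthogonal,
    fun hk => he.stabilizer_le_special (hK hk)⟩

/-- If all automorphisms preserve the orientation, the two tensors are exchanged only by
transformations of determinant `-1`. -/
theorem not_equivalent (he : IsModel 0 e) (hk : k = 2 ∨ k = 4 ∨ k = 8)
    (hK : ∀ φ ∈ aut K, (LinearEquiv.det φ : ℝ) = 1) :
    ¬ ∃ h ∈ specialOrthogonalSubgroup (3 * k + 2),
      transform (upsilon 0 k) h.val = upsilon 1 k := by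
  rintro ⟨h, hh, ht⟩
  have h1 : h * reflection (3 * k + 2) ∈ tensorStabilizer (upsilon 0 k) := by
    change transform _ (h * reflection (3 * k + 2)).val = _
    rw [Units.val_mul, transform_mul, ht, ← he.transform_reflection, ← transform_mul,
      ← Units.val_mul, reflection_mul_reflection, Units.val_one, transform_one]
  have h2 := (mem_specialOrthogonalSubgroup_iff.1 (he.stabilizer_le_special hK h1)).2
  rw [Units.val_mul, Matrix.det_mul, (mem_specialOrthogonalSubgroup_iff.1 hh).2,
    det_reflection hk] at h2
  norm_num at h2

end IsModel

end general

/-- The determinant is `±1`, and nonnegative by the normal form. -/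
theorem det_aut_quaternion {φ : TH ℍ[ℝ] ≃ₗ[ℝ] TH ℍ[ℝ]} (hφ : φ ∈ aut ℍ[ℝ]) :
    (LinearEquiv.det φ : ℝ) = 1 := by
  obtain ⟨e, he⟩ := exists_isModel_quaternion
  obtain ⟨h, rfl⟩ := (glEquiv e).surjective φ
  have h1 := det_sq_eq_one_of_mem (he.stabilizer_le_orthogonal ((he.mem_stabilizer_iff h).2 hφ))
  rw [← det_glEquiv e] at h1
  obtain ⟨g, hg, α, hα, hn⟩ := exists_normalForm hφ
  have h2 := det_normalForm hg α hn
  have h3 := pow_nonneg hα.det_nonneg_of_quaternion 3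
  rw [← h2] at h3
  nlinarith

theorem isIrreducibleImage_SO3 (a : Fin 2) :
    IsIrreducibleImage SO3 ⊥ (tensorStabilizer (upsilon a 1)) := by
  obtain ⟨e, he⟩ := IsModel.exists_of_zero exists_isModel_real a
  refine he.isIrreducibleImage (specialAction ℝ) (continuous_specialAction continuous_id)
    conjAction_range_le_aut elem_le_specialAction ker_specialAction_real fun h => ?_
  rw [he.mem_stabilizer_iff]
  exact ⟨fun h1 => elem_le_specialAction (aut_real ▸ h1), fun h1 => conjAction_range_le_aut h1⟩

theorem isIrreducibleImage_SU3 (a : Fin 2) : IsIrreducibleImage SU3 (Subgroup.center SU3)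
    (tensorStabilizer (upsilon a 2) ⊓ specialOrthogonalSubgroup (3 * 2 + 2)) := by
  obtain ⟨e, he⟩ := IsModel.exists_of_zero exists_isModel_complex a
  refine he.isIrreducibleImage (specialAction ℂ) (continuous_specialAction Complex.continuous_re)
    conjAction_range_le_aut elem_le_specialAction ker_specialAction fun h => ?_
  rw [mem_specialAction_range_iff, Subgroup.mem_inf, mem_specialOrthogonalSubgroup_iff,
    det_glEquiv, ← he.mem_stabilizer_iff]
  exact ⟨fun h1 => ⟨h1.1, h1.2.2⟩, fun h1 => ⟨h1.1, he.stabilizer_le_orthogonal h1.1, h1.2⟩⟩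

theorem isIrreducibleImage_Sp3 (a : Fin 2) :
    IsIrreducibleImage Sp3 (Subgroup.center Sp3) (tensorStabilizer (upsilon a 4)) := by
  obtain ⟨e, he⟩ := IsModel.exists_of_zero exists_isModel_quaternion a
  refine he.isIrreducibleImage (conjAction ℍ[ℝ])
    (continuous_inn_conjAction Quaternion.continuous_re) aut_quaternion.ge
    elem_le_conjAction_range ker_conjAction_quaternion fun h => ?_
  rw [he.mem_stabilizer_iff, aut_quaternion]

theorem isIrreducibleImage_F4 (a : Fin 2) :
    IsIrreducibleImage F4 ⊥ (tensorStabilizer (upsilon a 8)) := by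
  obtain ⟨e, he⟩ := IsModel.exists_of_zero exists_isModel_octonion a
  refine he.isIrreducibleImage F4.action F4.continuous_inn_action
    F4.range_action.le F4.elem_le_range_action F4.ker_action fun h => ?_
  rw [he.mem_stabilizer_iff, F4.range_action]

/-- For `k = 2` the reflection exchanges two equal tensors. -/
theorem reflection_mem_stabilizer (a : Fin 2) :
    reflection (3 * 2 + 2) ∈ tensorStabilizer (upsilon a 2) := by
  obtain ⟨e, he⟩ := exists_isModel_complex
  have h0 : upsilon a 2 = upsilon 0 2 := by
    fin_cases a
    · rfl
    · exact (upsilon_zero_eq_one (Or.inr rfl)).symm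
  rw [h0]
  exact he.transform_reflection.trans (upsilon_zero_eq_one (Or.inr rfl)).symm

theorem mem_stabilizer_complex_iff (a : Fin 2) (h : GL (Fin (3 * 2 + 2)) ℝ) :
    h ∈ tensorStabilizer (upsilon a 2) ↔
      h ∈ tensorStabilizer (upsilon a 2) ⊓ specialOrthogonalSubgroup (3 * 2 + 2) ∨
      reflection (3 * 2 + 2) * h ∈
        tensorStabilizer (upsilon a 2) ⊓ specialOrthogonalSubgroup (3 * 2 + 2) := by
  obtain ⟨e, he⟩ := IsModel.exists_of_zero exists_isModel_complex a
  have hσ := reflection_mem_stabilizer a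
  constructor
  · intro hh
    have ho := he.stabilizer_le_orthogonal hh
    rcases sq_eq_one_iff.1 (det_sq_eq_one_of_mem ho) with h1 | h1
    · exact Or.inl ⟨hh, mem_specialOrthogonalSubgroup_iff.2 ⟨ho, h1⟩⟩
    · refine Or.inr ⟨mul_mem hσ hh, mem_specialOrthogonalSubgroup_iff.2
        ⟨mul_mem (reflection_mem_orthogonalSubgroup _) ho, ?_⟩⟩
      rw [Units.val_mul, Matrix.det_mul, h1, det_reflection (Or.inl rfl)]
      norm_num
  · rintro (h1 | h1)
    · exact h1.1
    · exact (Subgroup.mul_mem_cancel_left _ hσ).1 h1.1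

end

theorem mainTheorem4 :
    (∀ k ∈ ({1, 2, 4, 8} : Finset ℕ), ∀ a : Fin 2,
      -- the tensors come from the real-valued determinants of traceless Hermitian matrices
      (∀ x : Fin (3 * k + 2) → ℝ,
        (hermMatrix x).IsHermitian ∧ (hermMatrix x).trace = 0 ∧
        octDet a (hermMatrix x) =
          Octonion.ofReal (2 * ∑ I, ∑ J, ∑ K, upsilon a k I J K * x I * x J * x K)) ∧
      -- i), ii), iii)
      (∀ I J K, upsilon a k I J K = (1 / 6) * (upsilon a k I J K + upsilon a k J K I
        + upsilon a k K I J + upsilon a k J I K + upsilon a k I K J + upsilon a k K J I)) ∧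
      (∀ I, ∑ J, upsilon a k I J J = 0) ∧
      (∀ J K L M,
        ∑ I, upsilon a k J K I * upsilon a k L M I + ∑ I, upsilon a k L J I * upsilon a k K M I
          + ∑ I, upsilon a k K L I * upsilon a k J M I
        = (if J = K then 1 else 0) * (if L = M then 1 else 0)
          + (if L = J then 1 else 0) * (if K = M then 1 else 0)
          + (if K = L then 1 else 0) * (if J = M then 1 else 0)) ∧
      -- the stabilizer in `GL` lies in `O`, and in `SO` unless `k = 2`
      tensorStabilizer (upsilon a k) ≤ orthogonalSubgroup (3 * k + 2) ∧
      (k ≠ 2 → tensorStabilizer (upsilon a k) ≤ specialOrthogonalSubgroup (3 * k + 2))) ∧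
    -- the stabilizers
    (∀ a : Fin 2,
      IsIrreducibleImage SO3 ⊥ (tensorStabilizer (upsilon a 1)) ∧
      (IsIrreducibleImage SU3 (Subgroup.center SU3)
          (tensorStabilizer (upsilon a 2) ⊓ specialOrthogonalSubgroup (3 * 2 + 2)) ∧
        ∀ h : GL (Fin (3 * 2 + 2)) ℝ, h ∈ tensorStabilizer (upsilon a 2) ↔
          h ∈ tensorStabilizer (upsilon a 2) ⊓ specialOrthogonalSubgroup (3 * 2 + 2) ∨
          reflection (3 * 2 + 2) * h ∈
            tensorStabilizer (upsilon a 2) ⊓ specialOrthogonalSubgroup (3 * 2 + 2)) ∧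
      IsIrreducibleImage Sp3 (Subgroup.center Sp3) (tensorStabilizer (upsilon a 4)) ∧
      IsIrreducibleImage F4 ⊥ (tensorStabilizer (upsilon a 8))) ∧
    -- comparison of the two tensors
    (∀ k ∈ ({1, 2} : Finset ℕ), upsilon 0 k = upsilon 1 k) ∧
    (∀ k ∈ ({4, 8} : Finset ℕ),
      reflection (3 * k + 2) ∈ orthogonalSubgroup (3 * k + 2) ∧
      transform (upsilon 0 k) (reflection (3 * k + 2)).val = upsilon 1 k ∧
      ¬ ∃ h ∈ specialOrthogonalSubgroup (3 * k + 2), transform (upsilon 0 k) h.val = upsilon 1 k) := by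
  refine ⟨fun k hk a => ?_, fun a => ⟨isIrreducibleImage_SO3 a, ⟨isIrreducibleImage_SU3 a,
    mem_stabilizer_complex_iff a⟩, isIrreducibleImage_Sp3 a, isIrreducibleImage_F4 a⟩,
    fun k hk => upsilon_zero_eq_one (by simpa using hk), fun k hk => ?_⟩
  · simp only [Finset.mem_insert, Finset.mem_singleton] at hk
    obtain rfl | rfl | rfl | rfl := hk
    · obtain ⟨e, he⟩ := IsModel.exists_of_zero exists_isModel_real a
      exact he.tensor_properties fun _ _ => det_aut_real
    · obtain ⟨e, he⟩ := IsModel.exists_of_zero exists_isModel_complex a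
      exact he.tensor_properties fun h => absurd rfl h
    · obtain ⟨e, he⟩ := IsModel.exists_of_zero exists_isModel_quaternion a
      exact he.tensor_properties fun _ _ => det_aut_quaternion
    · obtain ⟨e, he⟩ := IsModel.exists_of_zero exists_isModel_octonion a
      exact he.tensor_properties fun _ _ => det_aut_octonion
  · simp only [Finset.mem_insert, Finset.mem_singleton] at hk
    refine ⟨reflection_mem_orthogonalSubgroup _, ?_⟩
    obtain rfl | rfl := hk
    · obtain ⟨e, he⟩ := exists_isModel_quaternion
      exact ⟨he.transform_reflection, he.not_equivalent (by simp) fun _ => det_aut_quaternion⟩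
    · obtain ⟨e, he⟩ := exists_isModel_octonion
      exact ⟨he.transform_reflection, he.not_equivalent (by simp) fun _ => det_aut_octonion⟩
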